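/- Let $n\ge 2$ and consider $n$ fermionic modes with Majorana operators $c_{j,0}=b_j+b_j^\dagger$, $c_{j,1}=-i(b_j-b_j^\dagger)$, $j=1,\dots,n$, where mode $j$ is held by party $j$. A pure fermionic state (FS) is a unit vector $|\psi\rangle$ of the Fock space such that $|\psi\rangle\langle\psi|$ commutes with the parity operator $P=(-1)^{\sum_j b_j^\dagger b_j}$. It is fully entangled if for no nonempty proper subset $S$ of the modes $|\psi\rangle\langle\psi|=AB$ with positive semidefinite operators $A$, $B$ in the algebras generated by the Majorana operators of the modes in $S$ and of the modes not in $S$, respectively. A Gaussian state is a normalized thermal state $Ke^{-\frac i4\sum_{p,q}G_{pq}c_pc_q}$ with $G$ real antisymmetric, or a limit of such states. A linear map $\mathcal E$ on the operators of the $n$ modes is Gaussian if, for every $m\ge 0$, the map acting as $\mathcal E$ on the $n$ modes and as the identity on $m$ further modes takes Gaussian states to Gaussian states. In one round of an LOCC protocol, some party $j$ performs an instrument whose Kraus operators are operators on mode $j$ of definite parity (on a single mode these are the Gaussian operators), announces the outcome, and then every party $k$ applies a trace-preserving completely positive map with Kraus operators on mode $k$ of definite parity, which may depend on the outcome; a round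 may depend on all earlier outcomes that have been kept, and classical information may be discarded after each round. $\mathcal E$ is a GLOCC operation if it is Gaussian and is the limit of a sequence of deterministic maps realised (after discarding the classical information) by finite-round LOCC protocols each of which extends the preceding one by one round (in particular, any Gaussian map realised by finitely many rounds is GLOCC). A Gaussian local unitary (GLU) is a product $V=U_1\cdots U_n$ with $U_j=e^{\sum_{a,b}h^{(j)}_{ab}c_{j,a}c_{j,b}}\,c_{j,1}^{m_j}$, where $h^{(j)}$ is a real antisymmetric $2\times2$ matrix and $m_j\in\{0,1\}$ ($m_j=1$ includes the parity flip of mode $j$). Then there is no non-trivial GLOCC operation between pure fully entangled $n$-mode $n$-partite FSs: if $\mathcal E$ is a GLOCC operation and $\mathcal E(|\psi\rangle\langle\psi|)=|\phi\rangle\langle\phi|$ for two pure fully entangled FSs $|\psi\rangle,|\phi\rangle$ (Gaussian or not), then there is a GLU $V$ with $\mathcal E(\rho)=V\rho V^\dagger$ for all operators $\rho$. -/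

import Mathlib

open Matrix Filter Topology
open scoped ComplexOrder

noncomputable section

namespace Fermion

/-- Occupation numbers of `n` modes; these label the Fock basis. -/
abbrev Occ (n : ℕ) := Fin n → Bool

/-- Operators on the antisymmetric Fock space of `n` modes, written in the Fock basis
`|k₁ … kₙ⟩ = (b₁†)^k₁ ⋯ (bₙ†)^kₙ |0⟩`. -/
abbrev Op (n : ℕ) := Matrix (Occ n) (Occ n) ℂ

/-- Linear maps on operators; multiplication is composition. -/
abbrev SuperOp (n : ℕ) := Module.End ℂ (Op n)

/-! ### Fermionic modes and fermionic states -/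

/-- The annihilation operator `b j`:
`b j |k⟩ = (-1)^(∑_{l<j} k l) |k with k j = 0⟩` if `k j = 1`, and `0` otherwise. -/
def annihilation {n : ℕ} (j : Fin n) : Op n := fun y x =>
  if x j = true ∧ y = Function.update x j false then
    (-1) ^ (Finset.univ.filter fun l : Fin n => l < j ∧ x l = true).card
  else 0

/-- The Majorana operators of mode `j`: `c (j, 0) = b j + b j†` and
`c (j, 1) = -i (b j - b j†)`. -/
def majorana {n : ℕ} (p : Fin n × Fin 2) : Op n :=
  if p.2 = 0 then annihilation p.1 + (annihilation p.1)ᴴ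
  else -Complex.I • (annihilation p.1 - (annihilation p.1)ᴴ)

/-- The parity operator `(-1)^(n₁ + ⋯ + nₙ)`. -/
def parity (n : ℕ) : Op n :=
  Matrix.diagonal fun x => (-1) ^ (Finset.univ.filter fun l : Fin n => x l = true).card

/-- The algebra of the operators that act on the modes in `S`: it is generated by the Majorana
operators of these modes. -/
def localAlgebra {n : ℕ} (S : Set (Fin n)) : Subalgebra ℂ (Op n) :=
  Algebra.adjoin ℂ (majorana '' {p | p.1 ∈ S})

/-- The operator `|ψ⟩⟨ψ|`. -/
def proj {n : ℕ} (ψ : Occ n → ℂ) : Op n := Matrix.vecMulVec ψ (star ψ)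

/-- A pure fermionic state: a unit vector whose projector commutes with parity. -/
def IsPureFS {n : ℕ} (ψ : Occ n → ℂ) : Prop :=
  star ψ ⬝ᵥ ψ = 1 ∧ Commute (parity n) (proj ψ)

/-- The modes in `S` factorize from the remaining modes: `|ψ⟩⟨ψ|` is a product of a positive
operator on the modes in `S` and a positive operator on the others. -/
def Factorizes {n : ℕ} (ψ : Occ n → ℂ) (S : Set (Fin n)) : Prop :=
  ∃ A ∈ localAlgebra S, ∃ B ∈ localAlgebra Sᶜ,
    A.PosSemidef ∧ B.PosSemidef ∧ proj ψ = A * B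

/-- A pure state is fully entangled if no nonempty proper subset of the modes factorizes. -/
def IsFullyEntangled {n : ℕ} (ψ : Occ n → ℂ) : Prop :=
  ∀ S : Set (Fin n), S.Nonempty → S ≠ Set.univ → ¬ Factorizes ψ S

/-! ### Gaussian states, Gaussian maps, Gaussian local unitaries -/

/-- The quadratic Hamiltonian `(i/4) ∑ G p q c_p c_q`. -/
def quadHamiltonian {n : ℕ} (G : Matrix (Fin n × Fin 2) (Fin n × Fin 2) ℝ) : Op n :=
  (Complex.I / 4) • ∑ p, ∑ q, (G p q : ℂ) • (majorana p * majorana q)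

/-- The normalized thermal state `K e^{-H}` of `H = (i/4) ∑ G p q c_p c_q`. -/
def gibbs {n : ℕ} (G : Matrix (Fin n × Fin 2) (Fin n × Fin 2) ℝ) : Op n :=
  (NormedSpace.exp (-quadHamiltonian G)).trace⁻¹ • NormedSpace.exp (-quadHamiltonian G)

/-- Gaussian fermionic states: thermal states of quadratic Hamiltonians, given by real
antisymmetric matrices, and limits of such states. -/
def IsGaussianState {n : ℕ} (ρ : Op n) : Prop :=
  ρ ∈ closure {σ : Op n | ∃ G : Matrix (Fin n × Fin 2) (Fin n × Fin 2) ℝ,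
    Gᵀ = -G ∧ σ = gibbs G}

/-- The map that acts as `E` on the first `n` modes and as the identity on `m` further modes.
In the Fock basis the operators on the first `n` of `n + m` modes are the matrices `K ⊗ 1`, so
`E` is applied to the `n`-mode blocks. -/
def extend {n : ℕ} (m : ℕ) (E : SuperOp n) (ρ : Op (n + m)) : Op (n + m) := fun x x' =>
  E (fun u u' => ρ (Fin.append u fun i => x (Fin.natAdd n i))
      (Fin.append u' fun i => x' (Fin.natAdd n i)))
    (fun i => x (Fin.castAdd m i)) (fun i => x' (Fin.castAdd m i))

/-- A Gaussian map: it takes Gaussian states to Gaussian states, also when it is applied to a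
part of a larger system of modes. -/
def IsGaussianMap {n : ℕ} (E : SuperOp n) : Prop :=
  ∀ (m : ℕ) (ρ : Op (n + m)), IsGaussianState ρ → IsGaussianState (extend m E ρ)

/-- Gaussian unitaries of the single mode `j`: `e^{-iH}` with `H = i ∑ h a b c_a c_b` quadratic
in the Majorana operators of mode `j` and `h` real antisymmetric, possibly preceded by the
parity-flipping transformation `c (j, 1)`. -/
def IsGaussianModeUnitary {n : ℕ} (j : Fin n) (U : Op n) : Prop :=
  ∃ (h : Matrix (Fin 2) (Fin 2) ℝ) (flip : Bool), hᵀ = -h ∧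
    U = NormedSpace.exp (-Complex.I •
          (Complex.I • ∑ a, ∑ b, (h a b : ℂ) • (majorana (j, a) * majorana (j, b)))) *
        (if flip then majorana (j, 1) else 1)

/-- Gaussian local unitaries (GLU) for one mode per party: products `U₁ ⋯ Uₙ` of Gaussian
unitaries of the single modes. -/
def IsGLU {n : ℕ} (V : Op n) : Prop :=
  ∃ U : Fin n → Op n, (∀ j, IsGaussianModeUnitary j (U j)) ∧ V = (List.ofFn U).prod

/-! ### Local operations and classical communication, one mode per party -/

/-- The map `ρ ↦ K ρ K†`. -/
def conjMap {n : ℕ} (K : Op n) : SuperOp n :=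
  LinearMap.mulLeft ℂ K * LinearMap.mulRight ℂ Kᴴ

/-- Measurement (Kraus) operators available to party `j`: operators on mode `j` of definite
parity. These are the combinations of `1, c (j, 0) c (j, 1)` and the combinations of
`c (j, 0), c (j, 1)`; on a single mode all of them are Gaussian. -/
def IsLocalKraus {n : ℕ} (j : Fin n) (K : Op n) : Prop :=
  K ∈ localAlgebra {j} ∧ (parity n * K = K * parity n ∨ parity n * K = -(K * parity n))

/-- A quantum instrument of party `j` with outcomes `Fin r`, where outcome `i` is obtained from
Kraus operators `K i a` after discarding the label `a`. -/
def IsLocalInstrument {n : ℕ} (j : Fin n) {r : ℕ} (M : Fin r → SuperOp n) : Prop :=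
  ∃ (l : Fin r → ℕ) (K : (i : Fin r) → Fin (l i) → Op n),
    (∀ i a, IsLocalKraus j (K i a)) ∧ (∀ i, M i = ∑ a, conjMap (K i a)) ∧
    ∑ i, ∑ a, (K i a)ᴴ * K i a = 1

/-- A trace-preserving completely positive map applied by party `j`. -/
def IsLocalChannel {n : ℕ} (j : Fin n) (T : SuperOp n) : Prop :=
  IsLocalInstrument j fun _ : Fin 1 => T

/-- One round: some party `j` measures and announces the outcome `i`; then every party `k` applies
a local channel `T i k` that may depend on `i`. -/
def IsRound {n r : ℕ} (R : Fin r → SuperOp n) : Prop :=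
  ∃ (j : Fin n) (M : Fin r → SuperOp n) (T : Fin r → Fin n → SuperOp n),
    IsLocalInstrument j M ∧ (∀ i k, IsLocalChannel k (T i k)) ∧
    ∀ i, R i = (List.ofFn (T i)).prod * M i

/-- A finite family of maps, one for each branch of a protocol. -/
structure Instrument (n : ℕ) where
  size : ℕ
  branch : Fin size → SuperOp n

/-- The map implemented when the whole classical record is discarded. -/
def Instrument.total {n : ℕ} (P : Instrument n) : SuperOp n := ∑ i, P.branch i

/-- `Q` is linked to `P`: first `P` is carried out, then one more round, which may depend on the
branch `i` of `P`, and then classical information may be discarded, as described by `g`. -/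
def IsLinked {n : ℕ} (Q P : Instrument n) : Prop :=
  ∃ (r : Fin P.size → ℕ) (R : (i : Fin P.size) → Fin (r i) → SuperOp n)
    (g : (Σ i : Fin P.size, Fin (r i)) → Fin Q.size),
    (∀ i, IsRound (R i)) ∧
    ∀ b, Q.branch b = ∑ s with g s = b, R s.1 s.2 * P.branch s.1

/-- Instruments of protocols with finitely many rounds. -/
inductive IsFiniteRound {n : ℕ} : Instrument n → Prop
  | start : IsFiniteRound ⟨1, fun _ => 1⟩
  | step {P Q : Instrument n} : IsFiniteRound P → IsLinked Q P → IsFiniteRound Q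

/-- Deterministic fermionic LOCC maps: limits of finite-round protocols each of which extends the
preceding one by one round. As a round may be trivial, this includes the finite-round protocols.
The space of maps is finite-dimensional, so pointwise convergence is convergence in norm. -/
def IsFLOCC {n : ℕ} (E : SuperOp n) : Prop :=
  ∃ P : ℕ → Instrument n, (∀ t, IsFiniteRound (P t)) ∧ (∀ t, IsLinked (P (t + 1)) (P t)) ∧
    ∀ ρ, Tendsto (fun t => (P t).total ρ) atTop (𝓝 (E ρ))

/-- Gaussian LOCC maps on `n` modes held by `n` parties: LOCC maps realized with local Gaussian
measurement operators that map Gaussian states to Gaussian states. -/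
def IsGLOCC {n : ℕ} (E : SuperOp n) : Prop := IsFLOCC E ∧ IsGaussianMap E

end Fermion

end

open scoped Kronecker

noncomputable section

namespace Fermion

variable {n : ℕ}

/-! ### Signed flips of Fock basis vectors -/

/-! Write `P` for the total parity, `Z_j` for the parity of mode `j` and `b_j` for its annihilation
operator. The LOCC structure enters through two facts, both stable under composition, sums and
limits: `E` preserves the trace, and, because every Kraus operator lives on one mode and has
definite parity, `E` commutes with conjugation by `P` and by each `Z_j` (`IsFLOCC.isCovariant`).

Gaussianity enters through the Choi matrix `C`, the image of one half of a maximally entangled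
Gaussian state (`isGaussianState_choiVec_one`). So `C` is a multiple of a Gaussian state on `2n`
modes: it is positive, and `C ⊗ C` commutes with `Λ = ∑ c_p ⊗ c_p`. Conjugating one tensor factor by
the parity of mode `j` and its partner reverses exactly the part `Λ_j` of `Λ` that belongs to this
pair, and covariance says that `C` commutes with this parity. Hence `C ⊗ C` commutes with every
`Λ_j` separately (`commute_localPair`). This is the point where locality and Gaussianity meet.

Since `E` sends `ψ` to the pure state `φ`, every operator in the range of `C` maps `ψ` to a multiple
of `φ`. Apply the relation for `Λ_j` to `v ⊗ v'`, where `v` represents `|φ⟩⟨ψ|`, and contract the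
first factor with `K ↦ ⟨g|K|ψ⟩`. One side vanishes: a Majorana operator changes the parity of `v`,
so the resulting multiple of `φ` would have the wrong parity. What remains is linear in the operator
`L` given by `C v'`. Full entanglement makes `b_j φ` and `b_j† φ` nonzero, and they are orthogonal,
so taking either as `g` yields `b_j L = P L P (y b_j + z b_j†)` and its analogue for `b_j†`, with
coefficients independent of `L`.

The Fock representation is irreducible, so these relations determine `L` up to a scalar
(`exists_eq_smul_of_intertwiner`). Thus `C` has rank one and `E ρ = K ρ K†`. Trace preservation
makes `K` unitary, and `K` carries each `b_j` to a phase times `b_j` or `b_j†`. A Gaussian local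
unitary does the same, so by irreducibility it equals `K` up to a phase. -/

/-- Flip the occupation number of mode `k`. -/
def flipAt (k : Fin n) (x : Occ n) : Occ n := Function.update x k (!x k)

@[simp] lemma flipAt_same (k : Fin n) (x : Occ n) : flipAt k x k = !x k := by simp [flipAt]

lemma flipAt_of_ne {k l : Fin n} (h : l ≠ k) (x : Occ n) : flipAt k x l = x l := by
  simp [flipAt, h]

@[simp] lemma flipAt_flipAt (k : Fin n) (x : Occ n) : flipAt k (flipAt k x) = x := by
  ext l; by_cases h : l = k
  · subst h; simp
  · simp [flipAt_of_ne h]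

lemma flipAt_comm (j k : Fin n) (x : Occ n) : flipAt j (flipAt k x) = flipAt k (flipAt j x) := by
  by_cases h : j = k
  · rw [h]
  · ext l
    by_cases hj : l = j
    · subst hj; simp [flipAt_of_ne h]
    · by_cases hk : l = k
      · subst hk; simp [flipAt_of_ne hj]
      · simp [flipAt_of_ne hj, flipAt_of_ne hk]

lemma eq_flipAt_comm {j : Fin n} {x y : Occ n} : y = flipAt j x ↔ x = flipAt j y :=
  ⟨fun h => by rw [h, flipAt_flipAt], fun h => by rw [h, flipAt_flipAt]⟩

/-- The parity of the modes in `S`, as a sign. -/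
def sgn (S : Finset (Fin n)) (x : Occ n) : ℂ := ∏ l ∈ S, if x l = true then -1 else 1

/-- A product of signs over modes is easier to handle than a power of a count: flipping one mode
changes one factor. -/
lemma pow_card_filter (p : Fin n → Prop) [DecidablePred p] (x : Occ n) :
    (-1 : ℂ) ^ (Finset.univ.filter fun l : Fin n => p l ∧ x l = true).card =
      sgn (Finset.univ.filter p) x := by
  rw [sgn, Finset.prod_ite, Finset.prod_const, Finset.prod_const_one, mul_one,
    Finset.filter_filter]

lemma sgn_flipAt_of_notMem {S : Finset (Fin n)} {k : Fin n} (h : k ∉ S) (x : Occ n) :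
    sgn S (flipAt k x) = sgn S x :=
  Finset.prod_congr rfl fun l hl => by
    rw [flipAt_of_ne (fun e : l = k => h (e ▸ hl))]

lemma sgn_flipAt_of_mem {S : Finset (Fin n)} {k : Fin n} (h : k ∈ S) (x : Occ n) :
    sgn S (flipAt k x) = -sgn S x := by
  rw [sgn, sgn, ← Finset.mul_prod_erase S _ h, ← Finset.mul_prod_erase S _ h]
  have : ∏ l ∈ S.erase k, (if flipAt k x l = true then (-1 : ℂ) else 1) =
      ∏ l ∈ S.erase k, (if x l = true then (-1 : ℂ) else 1) :=
    Finset.prod_congr rfl fun l hl => by rw [flipAt_of_ne (Finset.ne_of_mem_erase hl)]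
  rw [this, ← neg_mul]
  congr 1
  cases hx : x k <;> simp [hx]

lemma sgn_mul_self (S : Finset (Fin n)) (x : Occ n) : sgn S x * sgn S x = 1 := by
  rw [sgn, ← Finset.prod_mul_distrib]
  exact Finset.prod_eq_one fun l _ => by split_ifs <;> simp

lemma star_sgn (S : Finset (Fin n)) (x : Occ n) : star (sgn S x) = sgn S x := by
  simp only [sgn, Complex.star_def, map_prod]
  exact Finset.prod_congr rfl fun l _ => by split_ifs <;> simp

/-- The operator `|x⟩ ↦ f x |flip j x⟩`. -/
def hop (j : Fin n) (f : Occ n → ℂ) : Op n := fun y x => if y = flipAt j x then f x else 0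

lemma mul_hop_apply (A : Op n) (j : Fin n) (f : Occ n → ℂ) (y x : Occ n) :
    (A * hop j f) y x = A y (flipAt j x) * f x := by
  simp [Matrix.mul_apply, hop]

lemma hop_mul_apply (A : Op n) (j : Fin n) (f : Occ n → ℂ) (y x : Occ n) :
    (hop j f * A) y x = f (flipAt j y) * A (flipAt j y) x := by
  simp [Matrix.mul_apply, hop, eq_flipAt_comm (x := _) (y := y)]

/-- The sign `(-1)^(∑_{l<j} x l)`. -/
abbrev jw (j : Fin n) (x : Occ n) : ℂ := sgn (Finset.univ.filter (· < j)) x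

/-- The parity operator of the modes in `S`. -/
def parityOn (S : Finset (Fin n)) : Op n := diagonal (sgn S)

lemma annihilation_apply (j : Fin n) (y x : Occ n) :
    annihilation j y x = if x j = true ∧ y = flipAt j x then jw j x else 0 := by
  rw [annihilation, pow_card_filter]
  by_cases h : x j = true
  · simp [h, flipAt]
  · simp [h]

lemma annihilation_conjTranspose_apply (j : Fin n) (y x : Occ n) :
    (annihilation j)ᴴ y x = if x j = false ∧ y = flipAt j x then jw j x else 0 := by
  rw [conjTranspose_apply, annihilation_apply, apply_ite star, star_sgn, star_zero]
  by_cases h : y = flipAt j x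
  · subst h
    cases hx : x j <;> simp [hx, jw, sgn_flipAt_of_notMem]
  · have h' : ¬ x = flipAt j y := fun e => h (eq_flipAt_comm.2 e)
    simp [h, h']

/-- `b_j` and `b_j†` flip the same mode on complementary sets of basis vectors, so their sum is one
flip with nonvanishing amplitude everywhere. -/
lemma majorana_zero (j : Fin n) : majorana (j, 0) = hop j (jw j) := by
  ext y x
  simp only [majorana, if_true, Matrix.add_apply, annihilation_apply, annihilation_conjTranspose_apply,
    hop]
  cases hx : x j <;> simp

lemma majorana_one (j : Fin n) :
    majorana (j, 1) = hop j (fun x => Complex.I * sgn {j} x * jw j x) := by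
  ext y x
  simp only [majorana, one_ne_zero, if_false, Matrix.smul_apply, Matrix.sub_apply, annihilation_apply,
    annihilation_conjTranspose_apply, hop, sgn, Finset.prod_singleton]
  cases hx : x j <;> by_cases h : y = flipAt j x <;> simp [h]

/-- The amplitudes of a Majorana operator. -/
def amp (p : Fin n × Fin 2) (x : Occ n) : ℂ :=
  if p.2 = 0 then jw p.1 x else Complex.I * sgn {p.1} x * jw p.1 x

lemma majorana_eq_hop (p : Fin n × Fin 2) : majorana p = hop p.1 (amp p) := by
  obtain ⟨j, a⟩ := p
  fin_cases a
  · exact majorana_zero j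
  · exact majorana_one j

/-- The Jordan–Wigner string sees only modes to the left. Of two distinct modes exactly one lies to
the left of the other, and this produces the single sign of anticommutation. -/
lemma amp_flipAt_of_ne (p : Fin n × Fin 2) {k : Fin n} (h : k ≠ p.1) (x : Occ n) :
    amp p (flipAt k x) = if k < p.1 then -amp p x else amp p x := by
  have h1 : sgn {p.1} (flipAt k x) = sgn {p.1} x := sgn_flipAt_of_notMem (by simpa using h) x
  have h2 : jw p.1 (flipAt k x) = if k < p.1 then -jw p.1 x else jw p.1 x := by
    split_ifs with hk
    · exact sgn_flipAt_of_mem (by simpa using hk) x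
    · exact sgn_flipAt_of_notMem (by simpa using hk) x
  simp only [amp, h1, h2]
  split_ifs <;> ring

lemma jw_flipAt_self (j : Fin n) (x : Occ n) : jw j (flipAt j x) = jw j x :=
  sgn_flipAt_of_notMem (by simp) x

/-- The canonical anticommutation relations of the Majorana operators. -/
theorem majorana_anticomm (p q : Fin n × Fin 2) :
    majorana p * majorana q + majorana q * majorana p = if p = q then 2 else 0 := by
  ext y x
  rw [majorana_eq_hop p, majorana_eq_hop q, Matrix.add_apply, mul_hop_apply, mul_hop_apply]
  simp only [hop]
  obtain ⟨j, a⟩ := p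
  obtain ⟨k, b⟩ := q
  by_cases hjk : j = k
  · subst hjk
    have hs : sgn {j} (flipAt j x) = -sgn {j} x := sgn_flipAt_of_mem (by simp) x
    have h1 := sgn_mul_self {j} x
    have h2 : jw j x * jw j x = 1 := sgn_mul_self _ x
    simp only [flipAt_flipAt]
    have h2' : (2 : Op n) y x = if y = x then 2 else 0 := by
      rw [← Nat.cast_ofNat (R := Op n), ← diagonal_natCast, diagonal_apply]; simp
    fin_cases a <;> fin_cases b <;> by_cases h : y = x <;>
      simp [amp, jw_flipAt_self, hs, h, h2']
    · linear_combination 2 * h2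
    · ring
    · ring
    · linear_combination (-2 * (Complex.I * Complex.I) * jw j x * jw j x) * h1
        - 2 * Complex.I * Complex.I * h2 - 2 * Complex.I_mul_I
  · have hpq : ((j, a) : Fin n × Fin 2) ≠ (k, b) := fun h => hjk (congrArg Prod.fst h)
    rw [if_neg hpq, flipAt_comm k j x]
    simp only [amp_flipAt_of_ne (j, a) (k := k) (Ne.symm hjk),
      amp_flipAt_of_ne (k, b) (k := j) hjk]
    rcases lt_or_gt_of_ne hjk with h | h
    · by_cases hy : y = flipAt j (flipAt k x) <;> simp [h, h.not_gt, hy]; ring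
    · by_cases hy : y = flipAt j (flipAt k x) <;> simp [h, h.not_gt, hy]; ring

lemma majorana_mul_self (p : Fin n × Fin 2) : majorana p * majorana p = 1 := by
  have h := majorana_anticomm p p
  rw [if_pos rfl, ← two_mul] at h
  have h2 : (2 : ℂ) • (majorana p * majorana p) = (2 : ℂ) • (1 : Op n) := by
    rw [two_smul, two_smul, ← two_mul, h]; norm_num
  exact smul_right_injective _ (two_ne_zero) h2

lemma majorana_mul_of_ne {p q : Fin n × Fin 2} (h : p ≠ q) :
    majorana p * majorana q = -(majorana q * majorana p) :=
  eq_neg_of_add_eq_zero_left (by rw [majorana_anticomm, if_neg h])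

lemma majorana_conjTranspose (p : Fin n × Fin 2) : (majorana p)ᴴ = majorana p := by
  unfold majorana
  split_ifs
  · rw [conjTranspose_add, conjTranspose_conjTranspose, add_comm]
  · rw [conjTranspose_smul, conjTranspose_sub, conjTranspose_conjTranspose]
    simp only [Complex.star_def, map_neg, Complex.conj_I, smul_sub, neg_smul]
    abel

lemma annihilation_eq (j : Fin n) :
    annihilation j = (1 / 2 : ℂ) • (majorana (j, 0) + Complex.I • majorana (j, 1)) := by
  simp only [majorana, if_true, one_ne_zero, if_false, smul_smul]
  ext y x
  simp
  ring_nf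

lemma annihilation_conjTranspose_eq (j : Fin n) :
    (annihilation j)ᴴ = (1 / 2 : ℂ) • (majorana (j, 0) - Complex.I • majorana (j, 1)) := by
  rw [annihilation_eq, conjTranspose_smul, conjTranspose_add, conjTranspose_smul,
    majorana_conjTranspose, majorana_conjTranspose]
  ext y x
  simp
  ring

/-! ### Parity operators -/

lemma parity_eq (n : ℕ) : parity n = parityOn Finset.univ := by
  unfold parity parityOn
  congr 1
  ext x
  simpa using pow_card_filter (fun _ : Fin n => True) x

lemma parityOn_mul_self (S : Finset (Fin n)) : parityOn S * parityOn S = 1 := by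
  rw [parityOn, diagonal_mul_diagonal, ← diagonal_one]
  congr 1
  ext x
  exact sgn_mul_self S x

lemma parityOn_conjTranspose (S : Finset (Fin n)) : (parityOn S)ᴴ = parityOn S := by
  rw [parityOn, diagonal_conjTranspose]
  congr 1
  ext x
  exact star_sgn S x

lemma parityOn_mul_majorana_of_mem {S : Finset (Fin n)} {p : Fin n × Fin 2} (h : p.1 ∈ S) :
    parityOn S * majorana p = -(majorana p * parityOn S) := by
  ext y x
  rw [majorana_eq_hop, parityOn, Matrix.neg_apply, diagonal_mul, mul_diagonal]
  simp only [hop]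
  split_ifs with hy
  · rw [hy, sgn_flipAt_of_mem h]; ring
  · simp

lemma parityOn_mul_majorana_of_notMem {S : Finset (Fin n)} {p : Fin n × Fin 2} (h : p.1 ∉ S) :
    parityOn S * majorana p = majorana p * parityOn S := by
  ext y x
  rw [majorana_eq_hop, parityOn, diagonal_mul, mul_diagonal]
  simp only [hop]
  split_ifs with hy
  · rw [hy, sgn_flipAt_of_notMem h]; ring
  · simp

lemma majorana_zero_mul_one (j : Fin n) :
    majorana (j, 0) * majorana (j, 1) = Complex.I • parityOn {j} := by
  ext y x
  rw [majorana_zero, majorana_one, mul_hop_apply, Matrix.smul_apply, parityOn, diagonal_apply]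
  simp only [hop, flipAt_flipAt, jw_flipAt_self]
  have h2 : jw j x * jw j x = 1 := sgn_mul_self _ x
  by_cases h : y = x
  · simp [h]; linear_combination Complex.I * sgn {j} x * h2
  · simp [h]

/-! ### The full operator algebra -/

/-- Irreducibility of the Fock representation: products of the projectors `(1 ± Z_j)/2` isolate one
basis vector, and Majorana operators carry it to any other. -/
lemma single_mem_of_majorana_mem (R : Subalgebra ℂ (Op n)) (hR : ∀ p, majorana p ∈ R)
    (x y : Occ n) : single y x 1 ∈ R := by
  have hZ : ∀ j : Fin n, parityOn {j} ∈ R := fun j => by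
    have h : parityOn {j} = (-Complex.I) • (majorana (j, 0) * majorana (j, 1)) := by
      rw [majorana_zero_mul_one, smul_smul]; simp
    rw [h]
    exact R.smul_mem (R.mul_mem (hR _) (hR _)) _
  have hD : ∀ S : Finset (Fin n),
      diagonal (fun z : Occ n => if ∀ j ∈ S, z j = x j then (1 : ℂ) else 0) ∈ R := by
    intro S
    induction S using Finset.induction_on with
    | empty => simp
    | insert j S hj ih =>
      have h1 : diagonal (fun z : Occ n => if z j = x j then (1 : ℂ) else 0) =
          (1 / 2 : ℂ) • ((1 : Op n) + (if x j = true then -1 else 1 : ℂ) • parityOn {j}) := by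
        rw [← diagonal_one, parityOn, ← diagonal_smul, diagonal_add, ← diagonal_smul]
        congr 1
        ext z
        cases hz : z j <;> cases hx : x j <;> simp [sgn, hz] <;> norm_num
      have h2 : diagonal (fun z : Occ n => if ∀ i ∈ insert j S, z i = x i then (1 : ℂ) else 0) =
          diagonal (fun z : Occ n => if z j = x j then (1 : ℂ) else 0) *
          diagonal (fun z : Occ n => if ∀ j ∈ S, z j = x j then (1 : ℂ) else 0) := by
        rw [diagonal_mul_diagonal]
        congr 1
        ext z
        simp only [Finset.mem_insert, forall_eq_or_imp]
        by_cases h : z j = x j <;> simp [h]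
      rw [h2, h1]
      exact R.mul_mem (R.smul_mem (R.add_mem R.one_mem (R.smul_mem (hZ j) _)) _) ih
  have hx : single x x (1 : ℂ) ∈ R := by
    have h := hD Finset.univ
    have e : (fun z : Occ n => if ∀ j ∈ Finset.univ, z j = x j then (1 : ℂ) else 0) =
        Pi.single x 1 := by
      ext z
      simp [Pi.single_apply, funext_iff]
    rw [e] at h
    rwa [diagonal_single] at h
  have hflip : ∀ (j : Fin n) (z : Occ n), single z x (1 : ℂ) ∈ R →
      single (flipAt j z) x (1 : ℂ) ∈ R := by
    intro j z hz
    have h2 : jw j z * jw j z = 1 := sgn_mul_self _ z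
    have e : single (flipAt j z) x (1 : ℂ) = jw j z • (majorana (j, 0) * single z x 1) := by
      ext a b
      rw [Matrix.smul_apply, majorana_zero, hop_mul_apply, single_apply, single_apply]
      by_cases ha : a = flipAt j z
      · subst ha
        by_cases hb : x = b <;> simp [hb, h2]
      · have h3 : ¬ flipAt j z = a := fun e => ha e.symm
        have h4 : ¬ z = flipAt j a := fun e => ha (eq_flipAt_comm.1 e)
        simp [h3, h4]
    rw [e]
    exact R.smul_mem (R.mul_mem (hR _) hz) _
  -- Induction on a set `S` of modes outside which `z` agrees with `x`; each new mode costs at most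
  -- one flip.
  have key : ∀ (S : Finset (Fin n)) (z : Occ n), (∀ j, j ∉ S → z j = x j) →
      single z x (1 : ℂ) ∈ R := by
    intro S
    induction S using Finset.induction_on with
    | empty =>
      intro z hz
      have : z = x := funext fun j => hz j (by simp)
      rwa [this]
    | insert j S hj ih =>
      intro z hz
      by_cases h : z j = x j
      · refine ih z fun i hi => ?_
        by_cases hij : i = j
        · rw [hij, h]
        · exact hz i (by simp [hij, hi])
      · have h1 := hflip j (flipAt j z) (ih _ fun i hi => ?_)
        · rwa [flipAt_flipAt] at h1
        · by_cases hij : i = j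
          · subst hij
            rw [flipAt_same]
            cases hz : z i <;> cases hx : x i <;> simp_all
          · rw [flipAt_of_ne hij]
            exact hz i (by simp [hij, hi])
  exact key Finset.univ y (by simp)

lemma eq_top_of_majorana_mem (R : Subalgebra ℂ (Op n)) (hR : ∀ p, majorana p ∈ R) : R = ⊤ := by
  refine eq_top_iff.2 fun A _ => ?_
  rw [matrix_eq_sum_single A]
  refine R.sum_mem fun y _ => R.sum_mem fun x _ => ?_
  have : single y x (A y x) = A y x • single y x (1 : ℂ) := by simp
  rw [this]
  exact R.smul_mem (single_mem_of_majorana_mem R hR x y) _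

lemma eq_top_of_annihilation_mem (R : Subalgebra ℂ (Op n)) (hR : ∀ j, annihilation j ∈ R)
    (hR' : ∀ j, (annihilation j)ᴴ ∈ R) : R = ⊤ := by
  refine eq_top_of_majorana_mem R fun p => ?_
  unfold majorana
  split_ifs
  · exact R.add_mem (hR _) (hR' _)
  · exact R.smul_mem (R.sub_mem (hR _) (hR' _)) _

/-- An operator that commutes with all annihilation and creation operators is a scalar. -/
theorem exists_eq_smul_one_of_commute {X : Op n} (h : ∀ j, annihilation j * X = X * annihilation j)
    (h' : ∀ j, (annihilation j)ᴴ * X = X * (annihilation j)ᴴ) : ∃ c : ℂ, X = c • (1 : Op n) := by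
  have htop := eq_top_of_annihilation_mem (Subalgebra.centralizer ℂ {X})
    (fun j => by simp [Subalgebra.mem_centralizer_iff, h j])
    (fun j => by simp [Subalgebra.mem_centralizer_iff, h' j])
  obtain ⟨c, hc⟩ := mem_range_scalar_of_commute_single (M := X) fun i j _ => by
    have : single i j (1 : ℂ) ∈ Subalgebra.centralizer ℂ {X} := by rw [htop]; trivial
    exact ((Subalgebra.mem_centralizer_iff ℂ).1 this X rfl).symm
  exact ⟨c, by rw [← hc]; ext; simp [Matrix.one_apply, diagonal_apply]⟩

/-! ### The canonical anticommutation relations of annihilation and creation operators -/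

lemma majorana_one_mul_zero (j : Fin n) :
    majorana (j, 1) * majorana (j, 0) = -(Complex.I • parityOn {j}) := by
  rw [majorana_mul_of_ne (by simp), majorana_zero_mul_one]

lemma annihilation_mul_self (j : Fin n) : annihilation j * annihilation j = 0 := by
  rw [annihilation_eq]
  simp only [smul_mul_assoc, mul_smul_comm, smul_smul, mul_add, add_mul, majorana_mul_self,
    majorana_zero_mul_one, majorana_one_mul_zero, smul_add, smul_neg]
  match_scalars <;> ring_nf
  norm_num [Complex.I_sq]

lemma annihilation_mul_creation (j : Fin n) :
    annihilation j * (annihilation j)ᴴ = (1 / 2 : ℂ) • (1 + parityOn {j}) := by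
  rw [annihilation_conjTranspose_eq, annihilation_eq]
  simp only [smul_mul_assoc, mul_smul_comm, smul_smul, add_mul, mul_sub,
    majorana_mul_self, majorana_zero_mul_one, majorana_one_mul_zero, smul_add, smul_neg, smul_sub]
  match_scalars <;> ring_nf <;> norm_num [Complex.I_sq]

lemma creation_mul_annihilation (j : Fin n) :
    (annihilation j)ᴴ * annihilation j = (1 / 2 : ℂ) • (1 - parityOn {j}) := by
  rw [annihilation_conjTranspose_eq, annihilation_eq]
  simp only [smul_mul_assoc, mul_smul_comm, smul_smul, mul_add, sub_mul,
    majorana_mul_self, majorana_zero_mul_one, majorana_one_mul_zero, smul_add, smul_neg, smul_sub]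
  match_scalars <;> ring_nf <;> norm_num [Complex.I_sq]

lemma annihilation_anticomm_creation (j : Fin n) :
    annihilation j * (annihilation j)ᴴ + (annihilation j)ᴴ * annihilation j = 1 := by
  rw [annihilation_mul_creation, creation_mul_annihilation]
  module

lemma creation_mul_self (j : Fin n) : (annihilation j)ᴴ * (annihilation j)ᴴ = 0 := by
  rw [← conjTranspose_mul, annihilation_mul_self, conjTranspose_zero]

lemma parity_mul_self : parity n * parity n = 1 := by rw [parity_eq, parityOn_mul_self]

lemma parity_conjTranspose : (parity n)ᴴ = parity n := by rw [parity_eq, parityOn_conjTranspose]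

lemma parity_mul_majorana (p : Fin n × Fin 2) :
    parity n * majorana p = -(majorana p * parity n) := by
  rw [parity_eq, parityOn_mul_majorana_of_mem (by simp)]

lemma parityOn_mul_annihilation_of_mem {S : Finset (Fin n)} {j : Fin n} (h : j ∈ S) :
    parityOn S * annihilation j = -(annihilation j * parityOn S) := by
  rw [annihilation_eq, mul_smul_comm, smul_mul_assoc, mul_add, add_mul, mul_smul_comm,
    smul_mul_assoc, parityOn_mul_majorana_of_mem (p := (j, 0)) h,
    parityOn_mul_majorana_of_mem (p := (j, 1)) h]
  module

lemma parityOn_mul_annihilation_of_notMem {S : Finset (Fin n)} {j : Fin n} (h : j ∉ S) :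
    parityOn S * annihilation j = annihilation j * parityOn S := by
  rw [annihilation_eq, mul_smul_comm, smul_mul_assoc, mul_add, add_mul, mul_smul_comm,
    smul_mul_assoc, parityOn_mul_majorana_of_notMem (p := (j, 0)) h,
    parityOn_mul_majorana_of_notMem (p := (j, 1)) h]

lemma parity_mul_annihilation (j : Fin n) :
    parity n * annihilation j = -(annihilation j * parity n) := by
  rw [parity_eq, parityOn_mul_annihilation_of_mem (by simp)]

/-- An operator that commutes with annihilation and creation operators up to conjugation by the
parity is a scalar. -/
theorem exists_eq_smul_one_of_twisted {X : Op n}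
    (h : ∀ j, annihilation j * X = parity n * X * parity n * annihilation j)
    (h' : ∀ j, (annihilation j)ᴴ * X = parity n * X * parity n * (annihilation j)ᴴ) :
    ∃ c : ℂ, X = c • (1 : Op n) := by
  have hP := parity_mul_self (n := n)
  -- Two successive twists by the parity cancel, so the even product `b_j b_j†` commutes with `X` in
  -- the ordinary sense.
  have hN : ∀ j, annihilation j * (annihilation j)ᴴ * X = X * (annihilation j * (annihilation j)ᴴ) := by
    intro j
    have hb : annihilation j * parity n = -(parity n * annihilation j) := by
      rw [parity_mul_annihilation, neg_neg]
    calc annihilation j * (annihilation j)ᴴ * X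
        = (annihilation j * parity n) * X * parity n * (annihilation j)ᴴ := by
          rw [mul_assoc, h' j]; simp only [mul_assoc]
      _ = -(parity n * (annihilation j * X) * parity n * (annihilation j)ᴴ) := by
          rw [hb]; simp only [neg_mul, mul_assoc]
      _ = -((parity n * parity n) * X * (parity n * annihilation j * parity n)
            * (annihilation j)ᴴ) := by rw [h j]; simp only [mul_assoc]
      _ = X * (annihilation j * (annihilation j)ᴴ) := by
          rw [parity_mul_annihilation, neg_mul, mul_assoc (annihilation j), hP]
          simp [mul_assoc]
  have hZ : ∀ j, parityOn {j} * X = X * parityOn {j} := by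
    intro j
    have h1 : parityOn {j} = (2 : ℂ) • (annihilation j * (annihilation j)ᴴ) - 1 := by
      rw [annihilation_mul_creation]; module
    rw [h1, sub_mul, mul_sub, smul_mul_assoc, mul_smul_comm, hN j, one_mul, mul_one]
  -- A nonzero entry of `X` joins basis vectors with the same parity of every mode, hence of the
  -- same total parity. So the twist is trivial and ordinary irreducibility applies.
  have hPX : parity n * X = X * parity n := by
    rw [parity_eq]
    ext y x
    rw [parityOn, diagonal_mul, mul_diagonal]
    by_cases hyx : X y x = 0
    · simp [hyx]
    · have : sgn Finset.univ y = sgn Finset.univ x := by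
        refine Finset.prod_congr rfl fun j _ => ?_
        have e := congrFun (congrFun (hZ j) y) x
        rw [parityOn, diagonal_mul, mul_diagonal, mul_comm] at e
        simpa [sgn] using mul_left_cancel₀ hyx e
      rw [this, mul_comm]
  have hX : parity n * X * parity n = X := by rw [hPX, mul_assoc, hP, mul_one]
  exact exists_eq_smul_one_of_commute (fun j => by rw [h j, hX]) (fun j => by rw [h' j, hX])

/-! ### Gaussian states -/

lemma quadHamiltonian_isHermitian {G : Matrix (Fin n × Fin 2) (Fin n × Fin 2) ℝ} (hG : Gᵀ = -G) :
    (quadHamiltonian G).IsHermitian := by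
  have hG' : ∀ p q, G q p = -G p q := fun p q => congrFun (congrFun hG p) q
  rw [IsHermitian, quadHamiltonian, conjTranspose_smul, conjTranspose_sum, Finset.sum_congr rfl
    fun p _ => conjTranspose_sum _ _, Finset.sum_comm]
  have : star (Complex.I / 4) = -(Complex.I / 4) := by simp [neg_div]
  rw [this, neg_smul, ← smul_neg, ← Finset.sum_neg_distrib]
  congr 1
  refine Finset.sum_congr rfl fun p _ => ?_
  rw [← Finset.sum_neg_distrib]
  refine Finset.sum_congr rfl fun q _ => ?_
  rw [conjTranspose_smul, conjTranspose_mul, majorana_conjTranspose, majorana_conjTranspose,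
    hG' p q]
  simp

/-- The exponential is the square of the Hermitian matrix `exp (A/2)`. -/
lemma posSemidef_exp {m : Type*} [Fintype m] [DecidableEq m] {A : Matrix m m ℂ}
    (hA : A.IsHermitian) : (NormedSpace.exp A).PosSemidef := by
  have h : A = (1 / 2 : ℂ) • A + (1 / 2 : ℂ) • A := by module
  have hB : ((1 / 2 : ℂ) • A).IsHermitian := by
    rw [IsHermitian, conjTranspose_smul, hA.eq]; simp
  rw [h, Matrix.exp_add_of_commute _ _ (Commute.refl _)]
  nth_rewrite 2 [← hB.exp.eq]
  exact posSemidef_self_mul_conjTranspose _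

lemma isClosed_posSemidef (m : Type*) [Fintype m] [DecidableEq m] :
    IsClosed {A : Matrix m m ℂ | A.PosSemidef} := by
  have : {A : Matrix m m ℂ | A.PosSemidef} =
      {A | Aᴴ = A} ∩ ⋂ x : m → ℂ, {A | 0 ≤ star x ⬝ᵥ (A *ᵥ x)} := by
    ext A
    simp only [Set.mem_ofPred_eq, Set.mem_inter_iff, Set.mem_iInter]
    exact ⟨fun h => ⟨h.1, fun x => h.dotProduct_mulVec_nonneg x⟩,
      fun h => PosSemidef.of_dotProduct_mulVec_nonneg h.1 h.2⟩
  rw [this]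
  refine IsClosed.inter (isClosed_eq (by fun_prop) continuous_id) (isClosed_iInter fun x => ?_)
  exact isClosed_le continuous_const (by fun_prop)

theorem IsGaussianState.posSemidef {ρ : Op n} (h : IsGaussianState ρ) : ρ.PosSemidef := by
  refine closure_minimal ?_ (isClosed_posSemidef (Occ n)) h
  rintro σ ⟨G, hG, rfl⟩
  have h1 : (NormedSpace.exp (-quadHamiltonian G)).PosSemidef :=
    posSemidef_exp (quadHamiltonian_isHermitian hG).neg
  refine h1.smul ?_
  have := h1.trace_nonneg
  exact inv_nonneg.2 this

/-- The operator `∑ c_p ⊗ c_p`. -/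
def majoranaPair (n : ℕ) : Matrix (Occ n × Occ n) (Occ n × Occ n) ℂ :=
  ∑ p : Fin n × Fin 2, majorana p ⊗ₖ majorana p

/-- A quadratic Hamiltonian acts on the span of the Majorana operators as an infinitesimal complex
rotation, with antisymmetric matrix `i G`. Invariance of `∑ c_p ⊗ c_p` follows from this
antisymmetry. -/
lemma quadHamiltonian_commutator (G : Matrix (Fin n × Fin 2) (Fin n × Fin 2) ℝ) (hG : Gᵀ = -G)
    (r : Fin n × Fin 2) :
    quadHamiltonian G * majorana r - majorana r * quadHamiltonian G =
      ∑ p, (Complex.I * G p r) • majorana p := by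
  have hG' : ∀ p q, G q p = -G p q := fun p q => congrFun (congrFun hG p) q
  have h1 : ∀ p q : Fin n × Fin 2, majorana p * majorana q * majorana r -
      majorana r * (majorana p * majorana q) =
      (if q = r then (2 : ℂ) else 0) • majorana p - (if p = r then (2 : ℂ) else 0) • majorana q := by
    intro p q
    have e1 : majorana p * majorana q * majorana r - majorana r * (majorana p * majorana q) =
      majorana p * (majorana q * majorana r + majorana r * majorana q) -
        (majorana p * majorana r + majorana r * majorana p) * majorana q := by noncomm_ring
    rw [e1, majorana_anticomm, majorana_anticomm]
    have h2 : ∀ A : Op n, (2 : Op n) * A = (2 : ℂ) • A := fun A => by rw [two_smul, two_mul]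
    have h3 : ∀ A : Op n, A * (2 : Op n) = (2 : ℂ) • A := fun A => by rw [two_smul, mul_two]
    split_ifs <;> simp [h2, h3]
  have h2 : quadHamiltonian G * majorana r - majorana r * quadHamiltonian G =
      (Complex.I / 4) • ∑ p, ∑ q, (G p q : ℂ) • (majorana p * majorana q * majorana r -
        majorana r * (majorana p * majorana q)) := by
    simp only [quadHamiltonian, smul_mul_assoc, mul_smul_comm, Finset.sum_mul, Finset.mul_sum,
      ← smul_sub, ← Finset.sum_sub_distrib]
  rw [h2]
  simp only [h1, smul_sub, Finset.sum_sub_distrib, smul_smul, ite_smul, smul_ite, zero_smul,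
    smul_zero, Finset.sum_ite_eq', Finset.mem_univ, if_true]
  have h3 : ∑ x : Fin n × Fin 2, ∑ q : Fin n × Fin 2,
      (if x = r then ((G x q : ℂ) * 2) • majorana q else 0) =
      - ∑ p, ((G p r : ℂ) * 2) • majorana p := by
    rw [Finset.sum_comm, ← Finset.sum_neg_distrib]
    refine Finset.sum_congr rfl fun q _ => ?_
    rw [Finset.sum_ite_eq' Finset.univ r, if_pos (Finset.mem_univ _), hG' q r]
    simp
  rw [h3, smul_neg, sub_neg_eq_add, ← smul_add, ← Finset.sum_add_distrib, Finset.smul_sum]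
  refine Finset.sum_congr rfl fun p _ => ?_
  rw [← add_smul, smul_smul]
  congr 1
  ring

lemma majoranaPair_commute_quadHamiltonian (G : Matrix (Fin n × Fin 2) (Fin n × Fin 2) ℝ)
    (hG : Gᵀ = -G) :
    Commute (majoranaPair n) (quadHamiltonian G ⊗ₖ (1 : Op n) + (1 : Op n) ⊗ₖ quadHamiltonian G) := by
  have hG' : ∀ p q, G q p = -G p q := fun p q => congrFun (congrFun hG p) q
  set H := quadHamiltonian G
  refine (sub_eq_zero.1 ?_ : _ * _ = _ * _).symm
  have hsum : (H ⊗ₖ (1 : Op n) + (1 : Op n) ⊗ₖ H) * majoranaPair n -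
      majoranaPair n * (H ⊗ₖ (1 : Op n) + (1 : Op n) ⊗ₖ H) =
      ∑ r, ((H * majorana r - majorana r * H) ⊗ₖ majorana r +
        majorana r ⊗ₖ (H * majorana r - majorana r * H)) := by
    rw [majoranaPair, Finset.mul_sum, Finset.sum_mul, ← Finset.sum_sub_distrib]
    refine Finset.sum_congr rfl fun r _ => ?_
    rw [add_mul, mul_add]
    simp only [← mul_kronecker_mul, one_mul, mul_one]
    ext ⟨a, b⟩ ⟨c, d⟩
    simp only [Matrix.add_apply, Matrix.sub_apply, kronecker_apply]
    ring
  rw [hsum]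
  simp only [H, quadHamiltonian_commutator G hG]
  ext ⟨a, b⟩ ⟨c, d⟩
  simp only [Matrix.sum_apply, Matrix.add_apply, kronecker_apply, Matrix.smul_apply, Finset.sum_mul,
    Finset.mul_sum, smul_eq_mul, Matrix.zero_apply, Finset.sum_add_distrib]
  -- Exchanging the two indices in one of the sums pairs `G p r` with `G r p`, and the terms cancel.
  rw [Finset.sum_comm, ← Finset.sum_add_distrib]
  refine Finset.sum_eq_zero fun r _ => ?_
  rw [← Finset.sum_add_distrib]
  refine Finset.sum_eq_zero fun p _ => ?_
  rw [hG' p r]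
  push_cast
  ring

lemma exp_kronecker_one {m : Type*} [Fintype m] [DecidableEq m] (A : Matrix m m ℂ) :
    NormedSpace.exp (A ⊗ₖ (1 : Matrix m m ℂ)) = NormedSpace.exp A ⊗ₖ (1 : Matrix m m ℂ) := by
  let f : Matrix m m ℂ →+* Matrix (m × m) (m × m) ℂ :=
    { toFun := fun A => A ⊗ₖ (1 : Matrix m m ℂ)
      map_one' := one_kronecker_one
      map_mul' := fun A B => by rw [← mul_kronecker_mul, mul_one]
      map_zero' := zero_kronecker _
      map_add' := fun A B => add_kronecker _ _ _ }
  have hf : Continuous f := by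
    refine continuous_matrix fun a b => ?_
    simp only [f, RingHom.coe_mk, MonoidHom.coe_mk, OneHom.coe_mk, kroneckerMap_apply]
    fun_prop
  open scoped Norms.Operator in exact (NormedSpace.map_exp f hf A).symm

lemma exp_one_kronecker {m : Type*} [Fintype m] [DecidableEq m] (A : Matrix m m ℂ) :
    NormedSpace.exp ((1 : Matrix m m ℂ) ⊗ₖ A) = (1 : Matrix m m ℂ) ⊗ₖ NormedSpace.exp A := by
  let f : Matrix m m ℂ →+* Matrix (m × m) (m × m) ℂ :=
    { toFun := fun A => (1 : Matrix m m ℂ) ⊗ₖ A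
      map_one' := one_kronecker_one
      map_mul' := fun A B => by rw [← mul_kronecker_mul, mul_one]
      map_zero' := kronecker_zero _
      map_add' := fun A B => kronecker_add _ _ _ }
  have hf : Continuous f := by
    refine continuous_matrix fun a b => ?_
    simp only [f, RingHom.coe_mk, MonoidHom.coe_mk, OneHom.coe_mk, kroneckerMap_apply]
    fun_prop
  open scoped Norms.Operator in exact (NormedSpace.map_exp f hf A).symm

/-- `e^{-H} ⊗ e^{-H}` is the exponential of `-(H ⊗ 1 + 1 ⊗ H)`, whose exponent commutes with `∑ c_p
⊗ c_p`; normalization is a scalar and the relation is closed. Together with positivity this is all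
that is later extracted from a Gaussian Choi state. -/
theorem IsGaussianState.commute_majoranaPair {ρ : Op n} (h : IsGaussianState ρ) :
    Commute (majoranaPair n) (ρ ⊗ₖ ρ) := by
  have hcl : IsClosed {ρ : Op n | Commute (majoranaPair n) (ρ ⊗ₖ ρ)} := by
    have hc : Continuous fun ρ : Op n => ρ ⊗ₖ ρ := by
      refine continuous_matrix fun a b => ?_
      simp only [kroneckerMap_apply]
      fun_prop
    exact isClosed_eq (continuous_const.matrix_mul hc) (hc.matrix_mul continuous_const)
  refine closure_minimal ?_ hcl h
  rintro σ ⟨G, hG, rfl⟩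
  have hH := (majoranaPair_commute_quadHamiltonian G hG).neg_right
  set H := quadHamiltonian G
  have hcomm : Commute ((-H) ⊗ₖ (1 : Op n)) ((1 : Op n) ⊗ₖ (-H)) := by
    rw [Commute, SemiconjBy, ← mul_kronecker_mul, ← mul_kronecker_mul]; simp
  have e : NormedSpace.exp (-H) ⊗ₖ NormedSpace.exp (-H) =
      NormedSpace.exp (-(H ⊗ₖ (1 : Op n) + (1 : Op n) ⊗ₖ H)) := by
    have h1 : -(H ⊗ₖ (1 : Op n) + (1 : Op n) ⊗ₖ H) = (-H) ⊗ₖ (1 : Op n) + (1 : Op n) ⊗ₖ (-H) := by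
      ext ⟨a, b⟩ ⟨c, d⟩
      simp
      ring
    rw [h1, Matrix.exp_add_of_commute _ _ hcomm, exp_kronecker_one, exp_one_kronecker,
      ← mul_kronecker_mul, mul_one, one_mul]
  have h2 : Commute (majoranaPair n) (NormedSpace.exp (-H) ⊗ₖ NormedSpace.exp (-H)) := by
    rw [e]
    exact hH.exp_right
  show Commute _ (gibbs G ⊗ₖ gibbs G)
  rw [gibbs, smul_kronecker, kronecker_smul]
  exact (h2.smul_right _).smul_right _

/-! ### Operators as vectors on a doubled system of modes -/

lemma annihilation_mulVec (j : Fin n) (v : Occ n → ℂ) (y : Occ n) :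
    (annihilation j *ᵥ v) y = if y j = false then jw j y * v (flipAt j y) else 0 := by
  rw [mulVec, dotProduct, Finset.sum_eq_single (flipAt j y)]
  · rw [annihilation_apply, flipAt_flipAt, jw_flipAt_self]
    cases hy : y j <;> simp [hy]
  · intro x _ hx
    rw [annihilation_apply, if_neg fun h => hx (eq_flipAt_comm.1 h.2), zero_mul]
  · simp

lemma creation_mulVec (j : Fin n) (v : Occ n → ℂ) (y : Occ n) :
    ((annihilation j)ᴴ *ᵥ v) y = if y j = true then jw j y * v (flipAt j y) else 0 := by
  rw [mulVec, dotProduct, Finset.sum_eq_single (flipAt j y)]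
  · rw [annihilation_conjTranspose_apply, flipAt_flipAt, jw_flipAt_self]
    cases hy : y j <;> simp [hy]
  · intro x _ hx
    rw [annihilation_conjTranspose_apply, if_neg fun h => hx (eq_flipAt_comm.1 h.2), zero_mul]
  · simp

lemma annihilation_mul_apply (j : Fin n) (K : Op n) (y x : Occ n) :
    (annihilation j * K) y x = if y j = false then jw j y * K (flipAt j y) x else 0 :=
  annihilation_mulVec j (fun z => K z x) y

lemma creation_mul_apply (j : Fin n) (K : Op n) (y x : Occ n) :
    ((annihilation j)ᴴ * K) y x = if y j = true then jw j y * K (flipAt j y) x else 0 :=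
  creation_mulVec j (fun z => K z x) y

lemma mul_annihilation_apply (j : Fin n) (K : Op n) (y x : Occ n) :
    (K * annihilation j) y x = if x j = true then K y (flipAt j x) * jw j x else 0 := by
  rw [Matrix.mul_apply, Finset.sum_eq_single (flipAt j x)]
  · rw [annihilation_apply]
    cases hy : x j <;> simp
  · intro z _ hz
    rw [annihilation_apply, if_neg fun h => hz h.2, mul_zero]
  · simp

lemma mul_creation_apply (j : Fin n) (K : Op n) (y x : Occ n) :
    (K * (annihilation j)ᴴ) y x = if x j = false then K y (flipAt j x) * jw j x else 0 := by
  rw [Matrix.mul_apply, Finset.sum_eq_single (flipAt j x)]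
  · rw [annihilation_conjTranspose_apply]
    cases hy : x j <;> simp
  · intro z _ hz
    rw [annihilation_conjTranspose_apply, if_neg fun h => hz h.2, mul_zero]
  · simp

/-- The sign `(-1)^(k choose 2)` of a Fock basis vector with `k` particles. -/
def pairSign (x : Occ n) : ℂ :=
  (-1) ^ ((Finset.univ.filter fun l : Fin n => x l = true).card.choose 2)

lemma pairSign_mul_self (x : Occ n) : pairSign x * pairSign x = 1 := by
  rw [pairSign, ← mul_pow]; simp

lemma star_pairSign (x : Occ n) : star (pairSign x) = pairSign x := by
  rw [pairSign, star_pow]; simp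

/-- Pascal's rule: `(k+1 choose 2) = k + (k choose 2)`. The extra factor is the parity of the second
copy. Joined with the Jordan–Wigner string of second-copy modes across the first copy, it becomes
conjugation by the parity. -/
lemma pairSign_flipAt {j : Fin n} {x : Occ n} (h : x j = false) :
    pairSign (flipAt j x) = sgn Finset.univ x * pairSign x := by
  have h1 : (Finset.univ.filter fun l : Fin n => flipAt j x l = true) =
      insert j (Finset.univ.filter fun l : Fin n => x l = true) := by
    ext l
    by_cases hl : l = j
    · subst hl; simp [h]
    · simp [flipAt_of_ne hl, hl]
  have h2 : sgn Finset.univ x = (-1) ^ (Finset.univ.filter fun l : Fin n => x l = true).card := by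
    simpa using (pow_card_filter (fun _ : Fin n => True) x).symm
  rw [pairSign, h1, Finset.card_insert_of_notMem (by simp [h]), h2, pairSign, ← pow_add,
    Nat.choose_succ_succ' _ 1, Nat.choose_one_right]

/-- The occupation numbers of the first `n` of `n + n` modes. -/
def leftOcc (w : Occ (n + n)) : Occ n := fun i => w (Fin.castAdd n i)

/-- The occupation numbers of the last `n` of `n + n` modes. -/
def rightOcc (w : Occ (n + n)) : Occ n := fun i => w (Fin.natAdd n i)

@[simp] lemma leftOcc_append (u x : Occ n) : leftOcc (Fin.append u x) = u := by
  ext i; simp [leftOcc]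

@[simp] lemma rightOcc_append (u x : Occ n) : rightOcc (Fin.append u x) = x := by
  ext i; rw [rightOcc, Fin.append_right]

@[simp] lemma append_leftOcc_rightOcc (w : Occ (n + n)) :
    Fin.append (leftOcc w) (rightOcc w) = w :=
  Fin.append_castAdd_natAdd

lemma leftOcc_flipAt_castAdd (j : Fin n) (w : Occ (n + n)) :
    leftOcc (flipAt (Fin.castAdd n j) w) = flipAt j (leftOcc w) := by
  ext i
  by_cases h : i = j
  · subst h; simp [leftOcc]
  · rw [flipAt_of_ne h, leftOcc, flipAt_of_ne (by simpa using h), leftOcc]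

lemma rightOcc_flipAt_castAdd (j : Fin n) (w : Occ (n + n)) :
    rightOcc (flipAt (Fin.castAdd n j) w) = rightOcc w := by
  ext i
  rw [rightOcc, flipAt_of_ne, rightOcc]
  exact fun h => by have := congrArg Fin.val h; simp at this; omega

lemma leftOcc_flipAt_natAdd (j : Fin n) (w : Occ (n + n)) :
    leftOcc (flipAt (Fin.natAdd n j) w) = leftOcc w := by
  ext i
  rw [leftOcc, flipAt_of_ne, leftOcc]
  exact fun h => by have := congrArg Fin.val h; simp at this; omega

lemma rightOcc_flipAt_natAdd (j : Fin n) (w : Occ (n + n)) :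
    rightOcc (flipAt (Fin.natAdd n j) w) = flipAt j (rightOcc w) := by
  ext i
  by_cases h : i = j
  · subst h; simp [rightOcc]
  · rw [flipAt_of_ne h, rightOcc, flipAt_of_ne (by simpa using h), rightOcc]

lemma jw_castAdd (j : Fin n) (w : Occ (n + n)) :
    jw (Fin.castAdd n j) w = jw j (leftOcc w) := by
  have h : ∀ i : Fin n, ¬ Fin.natAdd n i < Fin.castAdd n j := fun i => by
    rw [Fin.lt_def]; simp; omega
  simp only [jw, sgn, Finset.prod_filter, Fin.prod_univ_add, h, if_false, Finset.prod_const_one,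
    mul_one, leftOcc]
  rfl

lemma jw_natAdd (j : Fin n) (w : Occ (n + n)) :
    jw (Fin.natAdd n j) w = sgn Finset.univ (leftOcc w) * jw j (rightOcc w) := by
  have h : ∀ i : Fin n, Fin.castAdd n i < Fin.natAdd n j := fun i => by
    rw [Fin.lt_def]; simp; omega
  simp only [jw, sgn, Finset.prod_filter, Fin.prod_univ_add, h, if_true, leftOcc, rightOcc]
  rw [Finset.prod_congr rfl fun x _ => if_congr (Fin.natAdd_lt_natAdd_iff _) rfl rfl]
  rfl

/-- The vector on the doubled system that represents the operator `K`: the image of a maximally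
entangled Gaussian vector under `K`, applied to the first `n` modes. -/
def choiVec : Op n →ₗ[ℂ] (Occ (n + n) → ℂ) where
  toFun K := fun w => K (leftOcc w) (rightOcc w) * pairSign (rightOcc w)
  map_add' K L := by ext w; simp [add_mul]
  map_smul' c K := by ext w; simp [mul_assoc]

/-- The inverse of `choiVec`. -/
def choiOp : (Occ (n + n) → ℂ) →ₗ[ℂ] Op n where
  toFun v := Matrix.of fun u x => v (Fin.append u x) * pairSign x
  map_add' K L := by ext; simp [add_mul]
  map_smul' c K := by ext; simp [mul_assoc]

lemma choiVec_apply (K : Op n) (w : Occ (n + n)) :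
    choiVec K w = K (leftOcc w) (rightOcc w) * pairSign (rightOcc w) := rfl

@[simp] lemma choiVec_choiOp (v : Occ (n + n) → ℂ) : choiVec (choiOp v) = v := by
  ext w
  simp [choiVec_apply, choiOp, mul_assoc, pairSign_mul_self]

@[simp] lemma choiOp_choiVec (K : Op n) : choiOp (choiVec K) = K := by
  ext u x
  simp [choiVec_apply, choiOp, mul_assoc, pairSign_mul_self]

lemma annihilation_castAdd_choiVec (j : Fin n) (K : Op n) :
    annihilation (Fin.castAdd n j) *ᵥ choiVec K = choiVec (annihilation j * K) := by
  ext w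
  rw [annihilation_mulVec, choiVec_apply, choiVec_apply, annihilation_mul_apply, jw_castAdd,
    leftOcc_flipAt_castAdd, rightOcc_flipAt_castAdd, ite_mul, zero_mul, mul_assoc]
  rfl

lemma creation_castAdd_choiVec (j : Fin n) (K : Op n) :
    (annihilation (Fin.castAdd n j))ᴴ *ᵥ choiVec K = choiVec ((annihilation j)ᴴ * K) := by
  ext w
  rw [creation_mulVec, choiVec_apply, choiVec_apply, creation_mul_apply, jw_castAdd,
    leftOcc_flipAt_castAdd, rightOcc_flipAt_castAdd, ite_mul, zero_mul, mul_assoc]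
  rfl

/-- First-copy operators multiply `K` on the left. Those of the second copy multiply on the right
with creation and annihilation exchanged; the twist by the parity reflects that the two copies
anticommute. -/
lemma annihilation_natAdd_choiVec (j : Fin n) (K : Op n) :
    annihilation (Fin.natAdd n j) *ᵥ choiVec K =
      choiVec (-(parity n * K * parity n * (annihilation j)ᴴ)) := by
  ext w
  rw [annihilation_mulVec, choiVec_apply, choiVec_apply, Matrix.neg_apply, mul_creation_apply,
    jw_natAdd, leftOcc_flipAt_natAdd, rightOcc_flipAt_natAdd, parity_eq, parityOn, mul_diagonal,
    diagonal_mul]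
  have e : w (Fin.natAdd n j) = rightOcc w j := rfl
  rw [e]
  split_ifs with h
  · rw [pairSign_flipAt h, sgn_flipAt_of_mem (Finset.mem_univ j)]; ring
  · simp

lemma creation_natAdd_choiVec (j : Fin n) (K : Op n) :
    (annihilation (Fin.natAdd n j))ᴴ *ᵥ choiVec K =
      choiVec (parity n * K * parity n * annihilation j) := by
  ext w
  rw [creation_mulVec, choiVec_apply, choiVec_apply, mul_annihilation_apply,
    jw_natAdd, leftOcc_flipAt_natAdd, rightOcc_flipAt_natAdd, parity_eq, parityOn, mul_diagonal,
    diagonal_mul]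
  have e : w (Fin.natAdd n j) = rightOcc w j := rfl
  rw [e]
  split_ifs with h
  · have h1 : flipAt j (rightOcc w) j = false := by simp [h]
    have h2 := pairSign_flipAt h1
    rw [flipAt_flipAt] at h2
    rw [h2]
    linear_combination (-sgn Finset.univ (leftOcc w) * jw j (rightOcc w) *
      K (leftOcc w) (flipAt j (rightOcc w)) * pairSign (flipAt j (rightOcc w))) *
      sgn_mul_self Finset.univ (flipAt j (rightOcc w))
  · simp

/-! ### The ground state of a quadratic Hamiltonian is Gaussian -/

/-- The normalized exponentials of a Hermitian matrix converge to the projector on the eigenvector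
of the largest eigenvalue, if this eigenvalue is simple. -/
lemma tendsto_normalized_exp {m : Type*} [Fintype m] [DecidableEq m] {A : Matrix m m ℂ}
    (hA : A.IsHermitian) {c : ℝ} (hc : ((c : ℂ) • 1 - A).PosSemidef) {Ω : m → ℂ} (hΩ : Ω ≠ 0)
    (hAΩ : A *ᵥ Ω = (c : ℂ) • Ω) (hker : ∀ v, A *ᵥ v = (c : ℂ) • v → ∃ a : ℂ, v = a • Ω) :
    Tendsto (fun k : ℕ => (NormedSpace.exp ((k : ℂ) • A)).trace⁻¹ • NormedSpace.exp ((k : ℂ) • A))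
      atTop (𝓝 ((star Ω ⬝ᵥ Ω)⁻¹ • vecMulVec Ω (star Ω))) := by
  set d := hA.eigenvalues
  set U : Matrix m m ℂ := (hA.eigenvectorUnitary : Matrix m m ℂ)
  have hUU : U * Uᴴ = 1 := Unitary.coe_mul_star_self hA.eigenvectorUnitary
  have hUU' : Uᴴ * U = 1 := Unitary.coe_star_mul_self hA.eigenvectorUnitary
  have hAU : A = U * diagonal (fun i => (d i : ℂ)) * Uᴴ := hA.spectral_theorem
  have hUinv : U⁻¹ = Uᴴ := inv_eq_right_inv hUU
  have hUu : IsUnit U := IsUnit.of_mul_eq_one _ hUU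
  have hd : ∀ i, d i ≤ c := by
    intro i
    have h1 : ((c : ℂ) • 1 - A) = U * diagonal (fun i => ((c - d i : ℝ) : ℂ)) * Uᴴ := by
      have : diagonal (fun i => ((c - d i : ℝ) : ℂ)) =
          (c : ℂ) • (1 : Matrix m m ℂ) - diagonal (fun i => (d i : ℂ)) := by
        rw [← diagonal_one, ← diagonal_smul, diagonal_sub]
        congr 1; ext i; simp
      rw [this, mul_sub, sub_mul, ← hAU]; simp [hUU]
    have h2 := (hc.conjTranspose_mul_mul_same U)
    rw [h1] at h2
    have h3 : Uᴴ * (U * diagonal (fun i => ((c - d i : ℝ) : ℂ)) * Uᴴ) * U =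
        diagonal (fun i => ((c - d i : ℝ) : ℂ)) := by
      calc _ = (Uᴴ * U) * diagonal (fun i => ((c - d i : ℝ) : ℂ)) * (Uᴴ * U) := by
            simp only [mul_assoc]
        _ = _ := by rw [hUU', one_mul, mul_one]
    rw [h3, posSemidef_diagonal_iff] at h2
    have := h2 i
    rw [Complex.zero_le_real] at this
    linarith
  -- After the factor `e^{kc}` is removed, the eigenvalues of `exp (k A)` are these powers. They
  -- tend to the indicator `e` of the top eigenvalue, so `D` is the spectral projector onto it.
  let f : ℕ → m → ℂ := fun k i => ((Real.exp (d i - c) ^ k : ℝ) : ℂ)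
  let e : m → ℂ := fun i => if d i = c then 1 else 0
  let D : Matrix m m ℂ := U * diagonal e * Uᴴ
  have hf : Tendsto f atTop (𝓝 e) := by
    refine tendsto_pi_nhds.2 fun i => ?_
    by_cases h : d i = c
    · simp [f, e, h]
    · have h1 : Real.exp (d i - c) < 1 := by
        rw [Real.exp_lt_one_iff]
        exact sub_neg.2 (lt_of_le_of_ne (hd i) h)
      have h2 := tendsto_pow_atTop_nhds_zero_of_lt_one (Real.exp_pos (d i - c)).le h1
      have h3 := (Complex.continuous_ofReal.tendsto 0).comp h2
      simpa [f, e, h, Function.comp_def] using h3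
  have hDk : Tendsto (fun k => U * diagonal (f k) * Uᴴ) atTop (𝓝 D) := by
    have hcont : Continuous fun g : m → ℂ => U * diagonal g * Uᴴ := by fun_prop
    exact (hcont.tendsto e).comp hf
  have hexp : ∀ k : ℕ, NormedSpace.exp ((k : ℂ) • A) =
      Complex.exp (k * c) • (U * diagonal (f k) * Uᴴ) := by
    intro k
    have h1 : (k : ℂ) • A = U * diagonal (fun i => (k : ℂ) * d i) * U⁻¹ := by
      have : diagonal (fun i => (k : ℂ) * d i) = (k : ℂ) • diagonal (fun i => (d i : ℂ)) := by
        rw [← diagonal_smul]; rfl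
      rw [hUinv, this, mul_smul_comm, smul_mul_assoc, ← hAU]
    rw [h1, Matrix.exp_conj _ _ hUu, Matrix.exp_diagonal, hUinv, ← smul_mul_assoc, ← mul_smul_comm,
      ← diagonal_smul]
    congr 3
    ext i
    rw [Pi.coe_exp, Pi.smul_apply, smul_eq_mul, ← Complex.exp_eq_exp_ℂ]
    simp only [f]
    push_cast
    rw [← Complex.exp_nat_mul, ← Complex.exp_add]
    congr 1
    ring
  have hAD : A * D = (c : ℂ) • D := by
    have h1 : diagonal (fun i => (d i : ℂ)) * diagonal e = (c : ℂ) • diagonal e := by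
      rw [diagonal_mul_diagonal, ← diagonal_smul]
      congr 1
      ext i
      by_cases h : d i = c <;> simp [e, h]
    calc A * D = U * diagonal (fun i => (d i : ℂ)) * (Uᴴ * U) * diagonal e * Uᴴ := by
          conv_lhs => rw [hAU]
          simp only [D, mul_assoc]
      _ = U * (diagonal (fun i => (d i : ℂ)) * diagonal e) * Uᴴ := by
          rw [hUU', mul_one]; simp only [mul_assoc]
      _ = (c : ℂ) • D := by rw [h1, mul_smul_comm, smul_mul_assoc]
  have hDH : Dᴴ = D := by
    have : star e = e := by ext i; by_cases h : d i = c <;> simp [e, h]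
    simp only [D, conjTranspose_mul, conjTranspose_conjTranspose, diagonal_conjTranspose, this,
      mul_assoc]
  have hDΩ : D *ᵥ Ω = Ω := by
    have h1 : diagonal (fun i => (d i : ℂ)) *ᵥ (Uᴴ *ᵥ Ω) = (c : ℂ) • (Uᴴ *ᵥ Ω) := by
      rw [← mulVec_smul, ← hAΩ]
      conv_rhs => rw [hAU]
      rw [mulVec_mulVec, mulVec_mulVec]
      congr 1
      simp only [← mul_assoc, hUU', one_mul]
    have h2 : diagonal e *ᵥ (Uᴴ *ᵥ Ω) = Uᴴ *ᵥ Ω := by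
      ext i
      have := congrFun h1 i
      rw [mulVec_diagonal, Pi.smul_apply, smul_eq_mul] at this
      rw [mulVec_diagonal]
      by_cases h : d i = c
      · simp [e, h]
      · have h3 : ((d i : ℂ) - c) * (Uᴴ *ᵥ Ω) i = 0 := by rw [sub_mul, this, sub_self]
        have h4 : ((d i : ℂ) - c) ≠ 0 := by
          rw [sub_ne_zero]; exact_mod_cast h
        rw [(mul_eq_zero.1 h3).resolve_left h4, mul_zero]
    calc D *ᵥ Ω = U *ᵥ (diagonal e *ᵥ (Uᴴ *ᵥ Ω)) := by
          simp only [D, mulVec_mulVec, mul_assoc]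
      _ = Ω := by rw [h2, mulVec_mulVec, hUU, one_mulVec]
  -- Every column of `D` lies in the one-dimensional top eigenspace. Hermiticity and `D Ω = Ω` then
  -- identify the coefficients as the normalized conjugate of `Ω`.
  have hcol : ∀ b, ∃ a : ℂ, (fun i => D i b) = a • Ω := fun b => hker _ <| by
    ext i
    exact congrFun (congrFun hAD i) b
  choose g hg using hcol
  have hDg : ∀ a b, D a b = g b * Ω a := fun a b => congrFun (hg b) a
  have hgΩ : ∑ b, g b * Ω b = 1 := by
    obtain ⟨a, ha⟩ := Function.ne_iff.1 hΩ
    have h1 := congrFun hDΩ a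
    simp only [mulVec, dotProduct, hDg] at h1
    have h2 : (∑ b, g b * Ω b) * Ω a = 1 * Ω a := by
      refine Eq.trans ?_ (h1.trans (one_mul _).symm)
      rw [Finset.sum_mul]
      exact Finset.sum_congr rfl fun b _ => by ring
    exact mul_right_cancel₀ ha h2
  have hN : star Ω ⬝ᵥ Ω ≠ 0 := fun h => hΩ (dotProduct_star_self_eq_zero.1 h)
  have hg' : ∀ a, star (g a) * (star Ω ⬝ᵥ Ω) = Ω a := by
    intro a
    have h1 : ∀ b, g b * Ω a = star (g a) * star (Ω b) := fun b => by
      have := congrFun (congrFun hDH a) b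
      rw [conjTranspose_apply, hDg, hDg, star_mul', mul_comm] at this
      rw [← this]; ring
    calc star (g a) * (star Ω ⬝ᵥ Ω) = ∑ b, (g b * Ω a) * Ω b := by
          simp only [h1, dotProduct, Finset.mul_sum, Pi.star_apply, mul_assoc]
      _ = (∑ b, g b * Ω b) * Ω a := by
          rw [Finset.sum_mul]; exact Finset.sum_congr rfl fun b _ => by ring
      _ = Ω a := by rw [hgΩ, one_mul]
  have hNs : star (star Ω ⬝ᵥ Ω) = star Ω ⬝ᵥ Ω := by
    exact (star_dotProduct _ _).symm
  have hD : D = (star Ω ⬝ᵥ Ω)⁻¹ • vecMulVec Ω (star Ω) := by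
    ext a b
    have h1 : g b * (star Ω ⬝ᵥ Ω) = star (Ω b) := by
      rw [← hg' b, star_mul', star_star, hNs]
    rw [hDg, Matrix.smul_apply, vecMulVec_apply, Pi.star_apply, ← h1, smul_eq_mul]
    field_simp
  have htr : D.trace = 1 := by
    rw [trace]
    simp only [diag_apply, hDg]
    exact hgΩ
  have hlim : Tendsto (fun k => (U * diagonal (f k) * Uᴴ).trace⁻¹ • (U * diagonal (f k) * Uᴴ)) atTop
      (𝓝 (D.trace⁻¹ • D)) := by
    have ht : Tendsto (fun k => (U * diagonal (f k) * Uᴴ).trace) atTop (𝓝 D.trace) := by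
      have hcont : Continuous fun B : Matrix m m ℂ => B.trace := by fun_prop
      exact (hcont.tendsto D).comp hDk
    exact (ht.inv₀ (by rw [htr]; exact one_ne_zero)).smul hDk
  rw [htr, inv_one, one_smul] at hlim
  rw [← hD]
  refine hlim.congr fun k => ?_
  rw [hexp, trace_smul, smul_smul, smul_eq_mul, mul_inv, mul_right_comm,
    inv_mul_cancel₀ (Complex.exp_ne_zero _), one_mul]

/-! ### The maximally entangled Gaussian state -/

lemma majorana_castAdd_choiVec (j : Fin n) (a : Fin 2) (K : Op n) :
    majorana (Fin.castAdd n j, a) *ᵥ choiVec K = choiVec (majorana (j, a) * K) := by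
  unfold majorana
  fin_cases a
  · simp [add_mulVec, annihilation_castAdd_choiVec, creation_castAdd_choiVec, add_mul]
  · simp [sub_mulVec, neg_mulVec, smul_mulVec, annihilation_castAdd_choiVec,
      creation_castAdd_choiVec, sub_mul]

/-- The opposite signs in the rules for `b_j` and `b_j†` turn sums into differences. Hence the
shifted index `a + 1` and the factor `i`. -/
lemma majorana_natAdd_choiVec (j : Fin n) (a : Fin 2) (K : Op n) :
    majorana (Fin.natAdd n j, a + 1) *ᵥ choiVec K =
      choiVec (Complex.I • (parity n * K * parity n * majorana (j, a))) := by
  have h1 := annihilation_natAdd_choiVec j K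
  have h2 := creation_natAdd_choiVec j K
  unfold majorana
  fin_cases a
  · have e : ((0 : Fin 2) + 1) ≠ 0 := by decide
    simp only [Fin.zero_eta, e, if_false, if_true, smul_mulVec, sub_mulVec, h1, h2]
    rw [← map_sub, ← map_smul, mul_add, smul_add, smul_sub]
    congr 1
    module
  · have e : ((1 : Fin 2) + 1) = 0 := by decide
    simp only [Fin.mk_one, e, one_ne_zero, if_false, if_true, add_mulVec, h1, h2]
    rw [← map_add, mul_smul_comm, smul_smul, mul_sub]
    congr 1
    simp only [mul_neg, Complex.I_mul_I, neg_neg, one_smul]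
    abel

/-- The involution that couples a Majorana mode with its partner in the second copy. -/
def pairing (j : Fin n) (a : Fin 2) : Op (n + n) :=
  -Complex.I • (majorana (Fin.castAdd n j, a) * majorana (Fin.natAdd n j, a + 1))

lemma castAdd_ne_natAdd (j k : Fin n) (a b : Fin 2) :
    ((Fin.castAdd n j, a) : Fin (n + n) × Fin 2) ≠ (Fin.natAdd n k, b) := fun h => by
  have := congrArg (fun p => p.1.val) h
  simp at this
  omega

lemma pairing_isHermitian (j : Fin n) (a : Fin 2) : (pairing j a)ᴴ = pairing j a := by
  rw [pairing, conjTranspose_smul, conjTranspose_mul, majorana_conjTranspose,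
    majorana_conjTranspose, majorana_mul_of_ne (castAdd_ne_natAdd j j a (a + 1))]
  simp

lemma pairing_mul_self (j : Fin n) (a : Fin 2) : pairing j a * pairing j a = 1 := by
  set p : Fin (n + n) × Fin 2 := (Fin.castAdd n j, a)
  set q : Fin (n + n) × Fin 2 := (Fin.natAdd n j, a + 1)
  have h : majorana p * majorana q = -(majorana q * majorana p) :=
    majorana_mul_of_ne (castAdd_ne_natAdd j j a (a + 1))
  have h2 : majorana p * majorana q * (majorana p * majorana q) = -1 := by
    nth_rewrite 1 [h]
    rw [neg_mul, mul_assoc, ← mul_assoc (majorana p), majorana_mul_self, one_mul,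
      majorana_mul_self]
  rw [pairing, smul_mul_assoc, mul_smul_comm, smul_smul, h2]
  simp

/-- Being fixed by a pairing thus means `c K = P K P c`. The identity satisfies this for every
Majorana operator, and only its multiples do. -/
lemma pairing_choiVec (j : Fin n) (a : Fin 2) (K : Op n) :
    pairing j a *ᵥ choiVec K =
      choiVec (majorana (j, a) * (parity n * K * parity n * majorana (j, a))) := by
  rw [pairing, smul_mulVec, ← mulVec_mulVec, majorana_natAdd_choiVec, majorana_castAdd_choiVec,
    ← map_smul]
  congr 1
  rw [mul_smul_comm, smul_smul]
  simp

lemma one_sub_pairing_posSemidef (j : Fin n) (a : Fin 2) : (1 - pairing j a).PosSemidef := by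
  have h : 1 - pairing j a = (1 / 2 : ℂ) • ((1 - pairing j a)ᴴ * (1 - pairing j a)) := by
    rw [conjTranspose_sub, conjTranspose_one, pairing_isHermitian, sub_mul, mul_sub, mul_sub,
      pairing_mul_self, one_mul, one_mul, mul_one]
    module
  rw [h]
  exact (posSemidef_conjTranspose_mul_self _).smul (by simp)

/-- A coupling matrix whose Hamiltonian is the sum of the pairing involutions. -/
def pairCoupling (n k : ℕ) : Matrix (Fin (n + n) × Fin 2) (Fin (n + n) × Fin 2) ℝ :=
  -- Both orders of a pair contribute equally, with prefactor `i/4`; the weight `2k` therefore gives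
  -- each pairing the coefficient `k`.
  ∑ j : Fin n, ∑ a : Fin 2,
    (single (Fin.castAdd n j, a) (Fin.natAdd n j, a + 1) (2 * k : ℝ) -
      single (Fin.natAdd n j, a + 1) (Fin.castAdd n j, a) (2 * k : ℝ))

lemma pairCoupling_transpose (k : ℕ) : (pairCoupling n k)ᵀ = -pairCoupling n k := by
  simp only [pairCoupling, transpose_sum, transpose_sub, transpose_single,
    ← Finset.sum_neg_distrib, neg_sub]

/-- `quadHamiltonian` as an additive map. -/
def quadHamiltonianHom (n : ℕ) : Matrix (Fin n × Fin 2) (Fin n × Fin 2) ℝ →+ Op n where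
  toFun := quadHamiltonian
  map_zero' := by simp [quadHamiltonian]
  map_add' A B := by
    simp [quadHamiltonian, add_smul, Finset.sum_add_distrib]

lemma quadHamiltonian_single (p q : Fin n × Fin 2) (r : ℝ) :
    quadHamiltonian (single p q r) = (Complex.I / 4 * r) • (majorana p * majorana q) := by
  rw [quadHamiltonian, Finset.sum_eq_single p, Finset.sum_eq_single q, single_apply_same, smul_smul]
  · intro b _ hb
    simp [hb.symm]
  · simp
  · intro b _ hb
    exact Finset.sum_eq_zero fun c _ => by simp [hb.symm]
  · simp

lemma neg_quadHamiltonian_pairCoupling (k : ℕ) :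
    -quadHamiltonian (pairCoupling n k) = (k : ℂ) • ∑ j : Fin n, ∑ a : Fin 2, pairing j a := by
  change -quadHamiltonianHom (n + n) (pairCoupling n k) = _
  rw [pairCoupling, map_sum, Finset.smul_sum, ← Finset.sum_neg_distrib]
  refine Finset.sum_congr rfl fun j _ => ?_
  rw [map_sum, Finset.smul_sum, ← Finset.sum_neg_distrib]
  refine Finset.sum_congr rfl fun a _ => ?_
  rw [map_sub]
  change -(quadHamiltonian _ - quadHamiltonian _) = _
  rw [quadHamiltonian_single, quadHamiltonian_single,
    majorana_mul_of_ne (castAdd_ne_natAdd j j a (a + 1)).symm, pairing]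
  push_cast
  module

lemma choiVec_one_ne_zero : choiVec (1 : Op n) ≠ 0 := fun h => by
  have := congrArg choiOp h
  rw [choiOp_choiVec, map_zero] at this
  exact one_ne_zero this

/-- The maximally entangled state `choiVec 1` is Gaussian. -/
theorem isGaussianState_choiVec_one :
    IsGaussianState ((star (choiVec (1 : Op n)) ⬝ᵥ choiVec (1 : Op n))⁻¹ •
      vecMulVec (choiVec (1 : Op n)) (star (choiVec (1 : Op n)))) := by
  set A : Op (n + n) := ∑ j : Fin n, ∑ a : Fin 2, pairing j a with hAdef
  have hA : A.IsHermitian := by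
    simp only [IsHermitian, A, conjTranspose_sum, pairing_isHermitian]
  -- There are `2n` pairings, each bounded by `1`, so the candidate for the largest eigenvalue is
  -- `2n`.
  have hsub : ((2 * n : ℝ) : ℂ) • (1 : Op (n + n)) - A =
      ∑ j : Fin n, ∑ a : Fin 2, (1 - pairing j a) := by
    simp only [A, Finset.sum_sub_distrib, Finset.sum_const, Finset.card_univ, Fintype.card_fin]
    congr 1
    rw [← Nat.cast_smul_eq_nsmul ℂ, ← Nat.cast_smul_eq_nsmul ℂ, smul_smul]
    congr 1
    push_cast
    ring
  have hmem : ∀ k : ℕ, (NormedSpace.exp ((k : ℂ) • A)).trace⁻¹ • NormedSpace.exp ((k : ℂ) • A) ∈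
      {σ : Op (n + n) | ∃ G : Matrix (Fin (n + n) × Fin 2) (Fin (n + n) × Fin 2) ℝ,
        Gᵀ = -G ∧ σ = gibbs G} := fun k =>
    ⟨pairCoupling n k, pairCoupling_transpose k, by
      rw [gibbs, neg_quadHamiltonian_pairCoupling]⟩
  refine mem_closure_of_tendsto (tendsto_normalized_exp hA (c := 2 * n) ?_ choiVec_one_ne_zero
    ?_ ?_) (Eventually.of_forall hmem)
  · rw [hsub]
    exact posSemidef_sum _ fun j _ => posSemidef_sum _ fun a _ => one_sub_pairing_posSemidef j a
  · have h1 : ∀ (j : Fin n) (a : Fin 2), pairing j a *ᵥ choiVec (1 : Op n) = choiVec 1 := by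
      intro j a
      rw [pairing_choiVec, mul_one, parity_mul_self, one_mul, majorana_mul_self]
    simp only [A, sum_mulVec, h1, Finset.sum_const, Finset.card_univ, Fintype.card_fin]
    rw [← Nat.cast_smul_eq_nsmul ℂ, ← Nat.cast_smul_eq_nsmul ℂ, smul_smul]
    congr 1
    push_cast
    ring
  · intro v hv
    have h0 : ∑ j : Fin n, ∑ a : Fin 2, star v ⬝ᵥ ((1 - pairing j a) *ᵥ v) = 0 := by
      have h1 : (∑ j : Fin n, ∑ a : Fin 2, (1 - pairing j a)) *ᵥ v = 0 := by
        rw [← hsub, sub_mulVec, smul_mulVec, one_mulVec, hv, sub_self]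
      have h2 := congrArg (star v ⬝ᵥ ·) h1
      simpa only [sum_mulVec, dotProduct_sum, dotProduct_zero] using h2
    -- A vanishing sum of nonnegative expectations vanishes term by term, so an eigenvector for `2n`
    -- is fixed by every pairing.
    have hnn : ∀ (j : Fin n) (a : Fin 2), 0 ≤ star v ⬝ᵥ ((1 - pairing j a) *ᵥ v) := fun j a =>
      (one_sub_pairing_posSemidef j a).dotProduct_mulVec_nonneg v
    have hzero : ∀ (j : Fin n) (a : Fin 2), pairing j a *ᵥ v = v := by
      intro j a
      rw [Finset.sum_eq_zero_iff_of_nonneg fun j _ => Finset.sum_nonneg fun a _ => hnn j a] at h0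
      have h1 := h0 j (Finset.mem_univ j)
      rw [Finset.sum_eq_zero_iff_of_nonneg fun a _ => hnn j a] at h1
      have h2 := ((one_sub_pairing_posSemidef j a).dotProduct_mulVec_zero_iff v).1
        (h1 a (Finset.mem_univ a))
      rw [sub_mulVec, one_mulVec, sub_eq_zero] at h2
      exact h2.symm
    have hv' := choiVec_choiOp v
    set K := choiOp v
    have hK : ∀ p, majorana p * K = parity n * K * parity n * majorana p := by
      rintro ⟨j, a⟩
      have h1 := hzero j a
      rw [← hv', pairing_choiVec] at h1
      have h2 := congrArg choiOp h1
      rw [choiOp_choiVec, choiOp_choiVec] at h2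
      conv_lhs => rw [← h2]
      rw [← mul_assoc, majorana_mul_self, one_mul]
    obtain ⟨c, hc⟩ := exists_eq_smul_one_of_twisted (X := K)
      (fun j => by
        rw [annihilation_eq, smul_mul_assoc, mul_smul_comm, add_mul, mul_add, smul_mul_assoc,
          mul_smul_comm, hK, hK])
      (fun j => by
        rw [annihilation_conjTranspose_eq, smul_mul_assoc, mul_smul_comm, sub_mul, mul_sub,
          smul_mul_assoc, mul_smul_comm, hK, hK])
    exact ⟨c, by rw [← hv', hc, map_smul]⟩

/-! ### Fermionic LOCC maps are trace preserving and covariant under local parities -/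

/-- The map commutes with conjugation by `Z`. -/
def IsCovariant (Z : Op n) (E : SuperOp n) : Prop := ∀ ρ, E (Z * ρ * Z) = Z * E ρ * Z

lemma IsCovariant.one (Z : Op n) : IsCovariant Z 1 := fun _ => rfl

lemma IsCovariant.mul {Z : Op n} {E F : SuperOp n} (hE : IsCovariant Z E) (hF : IsCovariant Z F) :
    IsCovariant Z (E * F) := fun ρ => by
  rw [Module.End.mul_apply, hF, hE, Module.End.mul_apply]

lemma IsCovariant.sum {Z : Op n} {ι : Type*} {s : Finset ι} {E : ι → SuperOp n}
    (hE : ∀ i ∈ s, IsCovariant Z (E i)) : IsCovariant Z (∑ i ∈ s, E i) := fun ρ => by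
  simp only [LinearMap.sum_apply, Finset.mul_sum, Finset.sum_mul]
  exact Finset.sum_congr rfl fun i hi => hE i hi ρ

lemma IsCovariant.list_prod {Z : Op n} {l : List (SuperOp n)} (h : ∀ E ∈ l, IsCovariant Z E) :
    IsCovariant Z l.prod := by
  induction l with
  | nil => exact IsCovariant.one Z
  | cons a l ih =>
    rw [List.prod_cons]
    exact (h a (by simp)).mul (ih fun E hE => h E (by simp [hE]))

lemma conjMap_apply (K ρ : Op n) : conjMap K ρ = K * ρ * Kᴴ := by
  simp [conjMap, mul_assoc]

/-- A sign picked up at `K` occurs again at its adjoint and cancels. -/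
lemma isCovariant_conjMap {Z K : Op n} (hZ : Zᴴ = Z) (h : Z * K = K * Z ∨ Z * K = -(K * Z)) :
    IsCovariant Z (conjMap K) := by
  intro ρ
  rw [conjMap_apply, conjMap_apply]
  rcases h with h | h
  · have h' : Z * Kᴴ = Kᴴ * Z := by
      have := congrArg conjTranspose h
      rw [conjTranspose_mul, conjTranspose_mul, hZ] at this
      exact this.symm
    calc K * (Z * ρ * Z) * Kᴴ = (K * Z) * ρ * (Z * Kᴴ) := by simp only [mul_assoc]
      _ = _ := by rw [← h, h']; simp only [mul_assoc]
  · have h' : Z * Kᴴ = -(Kᴴ * Z) := by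
      have := congrArg conjTranspose h
      rw [conjTranspose_neg, conjTranspose_mul, conjTranspose_mul, hZ] at this
      rw [this, neg_neg]
    have h2 : K * Z = -(Z * K) := by rw [h, neg_neg]
    calc K * (Z * ρ * Z) * Kᴴ = (K * Z) * ρ * (Z * Kᴴ) := by simp only [mul_assoc]
      _ = _ := by rw [h2, h']; simp only [mul_assoc, neg_mul, mul_neg, neg_neg]

lemma commute_of_mem_localAlgebra {S : Set (Fin n)} {R K : Op n} (hK : K ∈ localAlgebra S)
    (hR : ∀ p : Fin n × Fin 2, p.1 ∈ S → R * majorana p = majorana p * R) : R * K = K * R := by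
  have h : localAlgebra S ≤ Subalgebra.centralizer ℂ {R} := by
    refine Algebra.adjoin_le ?_
    rintro _ ⟨p, hp, rfl⟩
    rw [SetLike.mem_coe, Subalgebra.mem_centralizer_iff]
    rintro _ rfl
    exact hR p hp
  exact (Subalgebra.mem_centralizer_iff ℂ).1 (h hK) R rfl

/-- On another mode `Z_j` commutes with `K`. On the same mode `Z_j P` is the parity of the remaining
modes and commutes with `K`, so definite parity under `P` transfers to `Z_j`. -/
lemma IsLocalKraus.parityOn_comm {k : Fin n} {K : Op n} (hK : IsLocalKraus k K) (j : Fin n) :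
    parityOn {j} * K = K * parityOn {j} ∨ parityOn {j} * K = -(K * parityOn {j}) := by
  by_cases hjk : j = k
  · subst hjk
    have hR : parityOn {j} * parity n * K = K * (parityOn {j} * parity n) :=
      commute_of_mem_localAlgebra hK.1 fun p hp => by
        rw [mul_assoc, parity_mul_majorana, mul_neg, ← mul_assoc,
          parityOn_mul_majorana_of_mem (by simpa using hp), neg_mul, neg_neg, mul_assoc]
    have e : ∀ A B : Op n, A * parity n = B * parity n → A = B := fun A B h => by
      have := congrArg (· * parity n) h
      simpa only [mul_assoc, parity_mul_self, mul_one] using this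
    rcases hK.2 with h | h
    · left
      refine e _ _ ?_
      rw [mul_assoc, ← h, ← mul_assoc, hR, mul_assoc]
    · right
      refine e _ _ ?_
      rw [mul_assoc, show K * parity n = -(parity n * K) by rw [h, neg_neg], mul_neg, ← mul_assoc, hR, neg_mul, mul_assoc]
  · left
    exact commute_of_mem_localAlgebra hK.1 fun p hp => by
      rw [parityOn_mul_majorana_of_notMem]
      rw [Set.mem_singleton_iff] at hp
      simpa [hp] using Ne.symm hjk

/-- Operators under which all the local Kraus operators have definite parity. -/
def IsLocalParity (Z : Op n) : Prop :=
  Zᴴ = Z ∧ ∀ (k : Fin n) (K : Op n), IsLocalKraus k K → Z * K = K * Z ∨ Z * K = -(K * Z)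

lemma isLocalParity_parityOn (j : Fin n) : IsLocalParity (parityOn {j}) :=
  ⟨parityOn_conjTranspose _, fun _ _ hK => hK.parityOn_comm j⟩

lemma isLocalParity_parity : IsLocalParity (parity n) :=
  ⟨parity_conjTranspose, fun _ _ hK => hK.2⟩

lemma IsLocalInstrument.isCovariant {j : Fin n} {r : ℕ} {M : Fin r → SuperOp n}
    (h : IsLocalInstrument j M) {Z : Op n} (hZ : IsLocalParity Z) (i : Fin r) :
    IsCovariant Z (M i) := by
  obtain ⟨l, K, hK, hM, -⟩ := h
  rw [hM]
  exact IsCovariant.sum fun a _ => isCovariant_conjMap hZ.1 (hZ.2 j _ (hK i a))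

lemma IsLocalInstrument.trace {j : Fin n} {r : ℕ} {M : Fin r → SuperOp n}
    (h : IsLocalInstrument j M) (ρ : Op n) : ∑ i, (M i ρ).trace = ρ.trace := by
  obtain ⟨l, K, -, hM, hsum⟩ := h
  calc ∑ i, (M i ρ).trace = ∑ i, ∑ a, ((K i a)ᴴ * K i a * ρ).trace := by
        refine Finset.sum_congr rfl fun i _ => ?_
        rw [hM, LinearMap.sum_apply, trace_sum]
        refine Finset.sum_congr rfl fun a _ => ?_
        rw [conjMap_apply, trace_mul_comm, mul_assoc]
    _ = ((∑ i, ∑ a, (K i a)ᴴ * K i a) * ρ).trace := by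
        simp only [Finset.sum_mul, trace_sum]
    _ = ρ.trace := by rw [hsum, one_mul]

lemma IsLocalChannel.trace {j : Fin n} {T : SuperOp n} (h : IsLocalChannel j T) (ρ : Op n) :
    (T ρ).trace = ρ.trace := by
  simpa using IsLocalInstrument.trace h ρ

lemma trace_list_prod {l : List (SuperOp n)} (h : ∀ T ∈ l, ∀ ρ, (T ρ).trace = ρ.trace)
    (ρ : Op n) : (l.prod ρ).trace = ρ.trace := by
  induction l with
  | nil => rfl
  | cons a l ih =>
    rw [List.prod_cons, Module.End.mul_apply, h a (by simp), ih fun T hT => h T (by simp [hT])]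

lemma IsRound.isCovariant {r : ℕ} {R : Fin r → SuperOp n} (h : IsRound R) {Z : Op n}
    (hZ : IsLocalParity Z) (i : Fin r) : IsCovariant Z (R i) := by
  obtain ⟨j, M, T, hM, hT, hR⟩ := h
  rw [hR]
  refine (IsCovariant.list_prod fun E hE => ?_).mul (hM.isCovariant hZ i)
  obtain ⟨k, rfl⟩ := (List.mem_ofFn' _ _).1 hE
  exact IsLocalInstrument.isCovariant (hT i k) hZ 0

lemma IsRound.trace {r : ℕ} {R : Fin r → SuperOp n} (h : IsRound R) (ρ : Op n) :
    ∑ i, (R i ρ).trace = ρ.trace := by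
  obtain ⟨j, M, T, hM, hT, hR⟩ := h
  rw [← hM.trace ρ]
  refine Finset.sum_congr rfl fun i _ => ?_
  rw [hR, Module.End.mul_apply]
  refine trace_list_prod (fun E hE => ?_) _
  obtain ⟨k, rfl⟩ := (List.mem_ofFn' _ _).1 hE
  exact (hT i k).trace

lemma IsFiniteRound.isCovariant {P : Instrument n} (h : IsFiniteRound P) {Z : Op n}
    (hZ : IsLocalParity Z) (b : Fin P.size) : IsCovariant Z (P.branch b) := by
  induction h with
  | start => exact IsCovariant.one Z
  | step _ hL ih =>
    obtain ⟨r, R, g, hR, hQ⟩ := hL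
    rw [hQ]
    exact IsCovariant.sum fun s _ => ((hR s.1).isCovariant hZ s.2).mul (ih s.1)

lemma IsFiniteRound.trace {P : Instrument n} (h : IsFiniteRound P) (ρ : Op n) :
    (P.total ρ).trace = ρ.trace := by
  induction h with
  | start => simp [Instrument.total]
  | @step P Q _ hL ih =>
    obtain ⟨r, R, g, hR, hQ⟩ := hL
    rw [← ih, Instrument.total, Instrument.total]
    simp only [LinearMap.sum_apply, trace_sum, hQ]
    -- Discarding classical information only groups branches into the fibres of `g`, which leaves
    -- the total unchanged.
    rw [Finset.sum_fiberwise Finset.univ g fun s => ((R s.1 s.2 * P.branch s.1) ρ).trace,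
      Fintype.sum_sigma]
    refine Finset.sum_congr rfl fun i _ => ?_
    rw [← (hR i).trace (P.branch i ρ)]
    rfl

/-- Covariance holds for each finite-round map, and both sides are continuous in the image of `ρ`.
-/
theorem IsFLOCC.isCovariant {E : SuperOp n} (h : IsFLOCC E) {Z : Op n} (hZ : IsLocalParity Z) :
    IsCovariant Z E := by
  obtain ⟨P, hP, -, hlim⟩ := h
  intro ρ
  refine tendsto_nhds_unique (hlim (Z * ρ * Z)) ?_
  have hcov : ∀ t, IsCovariant Z (P t).total := fun t =>
    IsCovariant.sum fun b _ => (hP t).isCovariant hZ b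
  have hcont : Continuous fun A : Op n => Z * A * Z := by fun_prop
  have h1 : Tendsto (fun t => Z * (P t).total ρ * Z) atTop (𝓝 (Z * E ρ * Z)) :=
    (hcont.tendsto (E ρ)).comp (hlim ρ)
  have h2 : (fun t => (P t).total (Z * ρ * Z)) = fun t => Z * (P t).total ρ * Z :=
    funext fun t => hcov t ρ
  rw [h2]
  exact h1

theorem IsFLOCC.trace {E : SuperOp n} (h : IsFLOCC E) (ρ : Op n) : (E ρ).trace = ρ.trace := by
  obtain ⟨P, hP, -, hlim⟩ := h
  have hcont : Continuous fun A : Op n => A.trace := by fun_prop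
  refine tendsto_nhds_unique ((hcont.tendsto _).comp (hlim ρ)) ?_
  exact tendsto_const_nhds.congr fun t => ((hP t).trace ρ).symm

/-! ### The Choi matrix of a Gaussian map -/

/-- The Choi matrix of a map: its action on one half of the vector `choiVec 1`. -/
def choiMatrix (E : SuperOp n) : Op (n + n) := fun w w' =>
  pairSign (rightOcc w) * pairSign (rightOcc w') *
    E (single (rightOcc w) (rightOcc w') 1) (leftOcc w) (leftOcc w')

/-- The block of the maximally entangled projector at given second-copy occupations is a signed
multiple of a matrix unit. -/
lemma extend_choiVec_one (E : SuperOp n) (c : ℂ) :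
    extend n E (c • vecMulVec (choiVec (1 : Op n)) (star (choiVec (1 : Op n)))) =
      c • choiMatrix E := by
  ext w w'
  have h : (fun u u' : Occ n => (c • vecMulVec (choiVec (1 : Op n)) (star (choiVec (1 : Op n))))
      (Fin.append u (rightOcc w)) (Fin.append u' (rightOcc w'))) =
      (c * (pairSign (rightOcc w) * pairSign (rightOcc w'))) •
        (single (rightOcc w) (rightOcc w') 1 : Op n) := by
    ext u u'
    rw [Matrix.smul_apply, vecMulVec_apply, Pi.star_apply, choiVec_apply, choiVec_apply,
      leftOcc_append, rightOcc_append, leftOcc_append, rightOcc_append, Matrix.smul_apply,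
      single_apply, star_mul', star_pairSign, one_apply, one_apply]
    by_cases h1 : u = rightOcc w <;> by_cases h2 : u' = rightOcc w' <;>
      simp [h1, h2, eq_comm]
  change E (fun u u' : Occ n => (c • vecMulVec (choiVec (1 : Op n)) (star (choiVec (1 : Op n))))
      (Fin.append u (rightOcc w)) (Fin.append u' (rightOcc w'))) (leftOcc w) (leftOcc w') = _
  rw [h, map_smul, Matrix.smul_apply, Matrix.smul_apply, choiMatrix, smul_eq_mul, smul_eq_mul]
  ring

lemma star_dotProduct_choiVec_one_pos : 0 < star (choiVec (1 : Op n)) ⬝ᵥ choiVec (1 : Op n) :=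
  dotProduct_star_self_pos_iff.2 choiVec_one_ne_zero

lemma IsGaussianMap.isGaussianState_choiMatrix {E : SuperOp n} (h : IsGaussianMap E) :
    IsGaussianState ((star (choiVec (1 : Op n)) ⬝ᵥ choiVec (1 : Op n))⁻¹ • choiMatrix E) := by
  rw [← extend_choiVec_one]
  exact h n _ isGaussianState_choiVec_one

lemma IsGaussianMap.choiMatrix_posSemidef {E : SuperOp n} (h : IsGaussianMap E) :
    (choiMatrix E).PosSemidef := by
  have h1 := h.isGaussianState_choiMatrix.posSemidef
  have hN := star_dotProduct_choiVec_one_pos (n := n)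
  have h2 := h1.smul hN.le
  rwa [smul_smul, mul_inv_cancel₀ hN.ne', one_smul] at h2

lemma IsGaussianMap.commute_majoranaPair {E : SuperOp n} (h : IsGaussianMap E) :
    Commute (majoranaPair (n + n)) (choiMatrix E ⊗ₖ choiMatrix E) := by
  have h1 := h.isGaussianState_choiMatrix.commute_majoranaPair
  have hN := (star_dotProduct_choiVec_one_pos (n := n)).ne'
  set N := star (choiVec (1 : Op n)) ⬝ᵥ choiVec (1 : Op n)
  have h2 := (h1.smul_right N).smul_right N
  rw [smul_kronecker, kronecker_smul, smul_smul, smul_smul, smul_smul] at h2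
  have e : N * N * N⁻¹ * N⁻¹ = 1 := by field_simp
  rwa [e, one_smul] at h2

/-- The parity of the modes in `S` and of their partners in the second copy. -/
def pairParity (S : Finset (Fin n)) : Op (n + n) :=
  diagonal fun w => sgn S (leftOcc w) * sgn S (rightOcc w)

lemma pairParity_mul_self (S : Finset (Fin n)) : pairParity S * pairParity S = 1 := by
  rw [pairParity, diagonal_mul_diagonal, ← diagonal_one]
  congr 1
  ext w
  linear_combination (sgn S (rightOcc w) * sgn S (rightOcc w)) * sgn_mul_self S (leftOcc w) +
    sgn_mul_self S (rightOcc w)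

lemma pairParity_mul_majorana_castAdd (S : Finset (Fin n)) (j : Fin n) (a : Fin 2) :
    pairParity S * majorana (Fin.castAdd n j, a) =
      (if j ∈ S then -1 else 1 : ℂ) • (majorana (Fin.castAdd n j, a) * pairParity S) := by
  ext y x
  rw [majorana_eq_hop, pairParity, Matrix.smul_apply, diagonal_mul, mul_diagonal]
  simp only [hop]
  split_ifs with hy hj hj
  · rw [hy, leftOcc_flipAt_castAdd, rightOcc_flipAt_castAdd, sgn_flipAt_of_mem hj, smul_eq_mul]
    ring
  · rw [hy, leftOcc_flipAt_castAdd, rightOcc_flipAt_castAdd, sgn_flipAt_of_notMem hj, smul_eq_mul]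
    ring
  · simp
  · simp

lemma pairParity_mul_majorana_natAdd (S : Finset (Fin n)) (j : Fin n) (a : Fin 2) :
    pairParity S * majorana (Fin.natAdd n j, a) =
      (if j ∈ S then -1 else 1 : ℂ) • (majorana (Fin.natAdd n j, a) * pairParity S) := by
  ext y x
  rw [majorana_eq_hop, pairParity, Matrix.smul_apply, diagonal_mul, mul_diagonal]
  simp only [hop]
  split_ifs with hy hj hj
  · rw [hy, leftOcc_flipAt_natAdd, rightOcc_flipAt_natAdd, sgn_flipAt_of_mem hj, smul_eq_mul]
    ring
  · rw [hy, leftOcc_flipAt_natAdd, rightOcc_flipAt_natAdd, sgn_flipAt_of_notMem hj, smul_eq_mul]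
    ring
  · simp
  · simp

lemma pairParity_choiVec (S : Finset (Fin n)) (K : Op n) :
    pairParity S *ᵥ choiVec K = choiVec (parityOn S * K * parityOn S) := by
  ext w
  rw [pairParity, mulVec_diagonal, choiVec_apply, choiVec_apply, parityOn, mul_diagonal,
    diagonal_mul]
  ring

lemma IsCovariant.pairParity_mul_choiMatrix {S : Finset (Fin n)} {E : SuperOp n}
    (h : IsCovariant (parityOn S) E) :
    pairParity S * choiMatrix E = choiMatrix E * pairParity S := by
  have h1 : pairParity S * choiMatrix E * pairParity S = choiMatrix E := by
    ext w w'
    rw [pairParity, mul_diagonal, diagonal_mul, choiMatrix]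
    have e : parityOn S * single (rightOcc w) (rightOcc w') (1 : ℂ) * parityOn S =
        (sgn S (rightOcc w) * sgn S (rightOcc w')) • single (rightOcc w) (rightOcc w') (1 : ℂ) := by
      ext a b
      rw [parityOn, mul_diagonal, diagonal_mul, Matrix.smul_apply, single_apply]
      split_ifs with hab
      · rw [hab.1, hab.2, smul_eq_mul]; ring
      · simp
    have h2 := h (single (rightOcc w) (rightOcc w') 1)
    rw [e, map_smul] at h2
    have h3 := congrFun (congrFun h2 (leftOcc w)) (leftOcc w')
    rw [parityOn, mul_diagonal, diagonal_mul, Matrix.smul_apply, smul_eq_mul] at h3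
    have s1 := sgn_mul_self S (leftOcc w)
    have s2 := sgn_mul_self S (leftOcc w')
    generalize E (single (rightOcc w) (rightOcc w') 1) (leftOcc w) (leftOcc w') = e at *
    linear_combination (pairSign (rightOcc w) * pairSign (rightOcc w') * sgn S (leftOcc w) *
      sgn S (leftOcc w')) * h3 + pairSign (rightOcc w) * pairSign (rightOcc w') * e *
      (sgn S (leftOcc w') * sgn S (leftOcc w')) * s1 +
      pairSign (rightOcc w) * pairSign (rightOcc w') * e * s2
  calc pairParity S * choiMatrix E
      = pairParity S * choiMatrix E * (pairParity S * pairParity S) := by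
        rw [pairParity_mul_self, mul_one]
    _ = (pairParity S * choiMatrix E * pairParity S) * pairParity S := by
        simp only [mul_assoc]
    _ = _ := by rw [h1]

/-- The part of `majoranaPair` that belongs to mode `j` and its partner. -/
def localPair (j : Fin n) : Matrix (Occ (n + n) × Occ (n + n)) (Occ (n + n) × Occ (n + n)) ℂ :=
  ∑ a : Fin 2, (majorana (Fin.castAdd n j, a) ⊗ₖ majorana (Fin.castAdd n j, a) +
    majorana (Fin.natAdd n j, a) ⊗ₖ majorana (Fin.natAdd n j, a))

lemma majoranaPair_eq_sum_localPair : majoranaPair (n + n) = ∑ j : Fin n, localPair j := by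
  simp only [majoranaPair, localPair, Fintype.sum_prod_type, Fin.sum_univ_add,
    Finset.sum_add_distrib]

/-- The parity acts on one tensor factor only, so each `c ⊗ c` of pair `j` changes sign once instead
of twice. -/
lemma pairParity_conj_localPair (j k : Fin n) :
    (pairParity {j} ⊗ₖ (1 : Op (n + n))) * localPair k * (pairParity {j} ⊗ₖ (1 : Op (n + n))) =
      (if k = j then -1 else 1 : ℂ) • localPair k := by
  simp only [localPair, Finset.mul_sum, Finset.sum_mul, Finset.smul_sum]
  refine Finset.sum_congr rfl fun a _ => ?_
  rw [mul_add, add_mul, smul_add, ← mul_kronecker_mul, ← mul_kronecker_mul, ← mul_kronecker_mul,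
    ← mul_kronecker_mul, pairParity_mul_majorana_castAdd, pairParity_mul_majorana_natAdd]
  simp only [smul_mul_assoc, mul_assoc, pairParity_mul_self, one_mul, mul_one, smul_kronecker,
    Finset.mem_singleton]

/-- The full pairing minus its conjugate under the parity of pair `j` is twice the part of this
pair, and both terms commute with `C ⊗ C`. -/
lemma commute_localPair {E : SuperOp n} (h : IsGaussianMap E) (j : Fin n)
    (hcov : IsCovariant (parityOn {j}) E) :
    Commute (localPair j) (choiMatrix E ⊗ₖ choiMatrix E) := by
  set Y := pairParity {j} ⊗ₖ (1 : Op (n + n))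
  have hY : Commute Y (choiMatrix E ⊗ₖ choiMatrix E) := by
    rw [Commute, SemiconjBy, ← mul_kronecker_mul, ← mul_kronecker_mul,
      hcov.pairParity_mul_choiMatrix, one_mul, mul_one]
  have hM := h.commute_majoranaPair
  have h1 : Commute (Y * majoranaPair (n + n) * Y) (choiMatrix E ⊗ₖ choiMatrix E) :=
    (hY.mul_left hM).mul_left hY
  have h2 : localPair j = (1 / 2 : ℂ) • (majoranaPair (n + n) - Y * majoranaPair (n + n) * Y) := by
    rw [majoranaPair_eq_sum_localPair, Finset.mul_sum, Finset.sum_mul,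
      ← Finset.sum_sub_distrib, Finset.sum_eq_single j]
    · rw [pairParity_conj_localPair, if_pos rfl]; module
    · intro k _ hk
      rw [pairParity_conj_localPair, if_neg hk, one_smul, sub_self]
    · simp
  rw [h2]
  exact (hM.sub_left h1).smul_left _

lemma kronecker_mulVec_mul {m : Type*} [Fintype m] (A B : Matrix m m ℂ) (u v : m → ℂ) (i k : m) :
    ((A ⊗ₖ B) *ᵥ fun p => u p.1 * v p.2) (i, k) = (A *ᵥ u) i * (B *ᵥ v) k := by
  simp only [mulVec, dotProduct, Fintype.sum_prod_type, kronecker_apply, Finset.sum_mul_sum]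
  exact Finset.sum_congr rfl fun a _ => Finset.sum_congr rfl fun b _ => by ring

lemma sum_majorana_mulVec (j : Fin n) (u v : Occ n → ℂ) (i k : Occ n) :
    ∑ a : Fin 2, (majorana (j, a) *ᵥ u) i * (majorana (j, a) *ᵥ v) k =
      2 * ((annihilation j *ᵥ u) i * ((annihilation j)ᴴ *ᵥ v) k +
        ((annihilation j)ᴴ *ᵥ u) i * (annihilation j *ᵥ v) k) := by
  rw [Fin.sum_univ_two]
  simp only [majorana, if_true, one_ne_zero, if_false, add_mulVec, smul_mulVec, sub_mulVec,
    Pi.add_apply, Pi.sub_apply, Pi.smul_apply, smul_eq_mul]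
  linear_combination (((annihilation j *ᵥ u) i - ((annihilation j)ᴴ *ᵥ u) i) *
    ((annihilation j *ᵥ v) k - ((annihilation j)ᴴ *ᵥ v) k)) * Complex.I_mul_I

lemma localPair_mulVec (j : Fin n) (u v : Occ (n + n) → ℂ) (i k : Occ (n + n)) :
    (localPair j *ᵥ fun p => u p.1 * v p.2) (i, k) =
      2 * ((annihilation (Fin.castAdd n j) *ᵥ u) i * ((annihilation (Fin.castAdd n j))ᴴ *ᵥ v) k +
        ((annihilation (Fin.castAdd n j))ᴴ *ᵥ u) i * (annihilation (Fin.castAdd n j) *ᵥ v) k +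
        ((annihilation (Fin.natAdd n j) *ᵥ u) i * ((annihilation (Fin.natAdd n j))ᴴ *ᵥ v) k +
        ((annihilation (Fin.natAdd n j))ᴴ *ᵥ u) i * (annihilation (Fin.natAdd n j) *ᵥ v) k)) := by
  simp only [localPair, sum_mulVec, add_mulVec, Finset.sum_apply, Pi.add_apply,
    kronecker_mulVec_mul, Finset.sum_add_distrib]
  rw [sum_majorana_mulVec, sum_majorana_mulVec]
  ring

/-- The commutation relation of the Choi matrix with the Majorana operators of mode `j` and its
partner, contracted with a functional that vanishes on the images of the displaced vector. -/
lemma contracted_localPair {E : SuperOp n} (h : IsGaussianMap E) (j : Fin n)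
    (hcov : IsCovariant (parityOn {j}) E) (F : (Occ (n + n) → ℂ) →ₗ[ℂ] ℂ) (v : Occ (n + n) → ℂ)
    (hF : ∀ p, F (choiMatrix E *ᵥ (majorana p *ᵥ v)) = 0) (v' : Occ (n + n) → ℂ) :
    F (annihilation (Fin.castAdd n j) *ᵥ (choiMatrix E *ᵥ v)) •
        ((annihilation (Fin.castAdd n j))ᴴ *ᵥ (choiMatrix E *ᵥ v')) +
      F ((annihilation (Fin.castAdd n j))ᴴ *ᵥ (choiMatrix E *ᵥ v)) •
        (annihilation (Fin.castAdd n j) *ᵥ (choiMatrix E *ᵥ v')) +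
      (F (annihilation (Fin.natAdd n j) *ᵥ (choiMatrix E *ᵥ v)) •
        ((annihilation (Fin.natAdd n j))ᴴ *ᵥ (choiMatrix E *ᵥ v')) +
      F ((annihilation (Fin.natAdd n j))ᴴ *ᵥ (choiMatrix E *ᵥ v)) •
        (annihilation (Fin.natAdd n j) *ᵥ (choiMatrix E *ᵥ v'))) = 0 := by
  set C := choiMatrix E
  have hC := commute_localPair h j hcov
  have hFa : ∀ J, F (C *ᵥ (annihilation J *ᵥ v)) = 0 := fun J => by
    rw [annihilation_eq, smul_mulVec, add_mulVec, smul_mulVec, mulVec_smul, mulVec_add,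
      mulVec_smul, map_smul, map_add, map_smul, hF, hF]
    simp
  have hFc : ∀ J, F (C *ᵥ ((annihilation J)ᴴ *ᵥ v)) = 0 := fun J => by
    rw [annihilation_conjTranspose_eq, smul_mulVec, sub_mulVec, smul_mulVec, mulVec_smul,
      mulVec_sub, mulVec_smul, map_smul, map_sub, map_smul, hF, hF]
    simp
  ext k
  have key : ∀ i, (localPair j *ᵥ fun p => (C *ᵥ v) p.1 * (C *ᵥ v') p.2) (i, k) =
      ((C ⊗ₖ C) *ᵥ (localPair j *ᵥ fun p => v p.1 * v' p.2)) (i, k) := by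
    intro i
    have e : (fun p : Occ (n + n) × Occ (n + n) => (C *ᵥ v) p.1 * (C *ᵥ v') p.2) =
        (C ⊗ₖ C) *ᵥ fun p => v p.1 * v' p.2 := by
      ext ⟨a, b⟩
      rw [kronecker_mulVec_mul]
    rw [e, mulVec_mulVec, mulVec_mulVec, hC.eq]
  set b₁ := annihilation (Fin.castAdd n j)
  set b₂ := annihilation (Fin.natAdd n j)
  have e2 : (localPair j *ᵥ fun p => v p.1 * v' p.2) = (2 : ℂ) •
      ((fun p => (b₁ *ᵥ v) p.1 * (b₁ᴴ *ᵥ v') p.2) + (fun p => (b₁ᴴ *ᵥ v) p.1 * (b₁ *ᵥ v') p.2) +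
      ((fun p => (b₂ *ᵥ v) p.1 * (b₂ᴴ *ᵥ v') p.2) +
        (fun p => (b₂ᴴ *ᵥ v) p.1 * (b₂ *ᵥ v') p.2))) := by
    ext ⟨a, b⟩
    rw [localPair_mulVec]
    rfl
  -- The second factor is evaluated at `k` and the first kept as a vector, ready for `F`, which
  -- annihilates the whole right-hand side.
  have key2 : (b₁ᴴ *ᵥ (C *ᵥ v')) k • (b₁ *ᵥ (C *ᵥ v)) + (b₁ *ᵥ (C *ᵥ v')) k • (b₁ᴴ *ᵥ (C *ᵥ v)) +
      ((b₂ᴴ *ᵥ (C *ᵥ v')) k • (b₂ *ᵥ (C *ᵥ v)) + (b₂ *ᵥ (C *ᵥ v')) k • (b₂ᴴ *ᵥ (C *ᵥ v))) =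
      (C *ᵥ (b₁ᴴ *ᵥ v')) k • (C *ᵥ (b₁ *ᵥ v)) + (C *ᵥ (b₁ *ᵥ v')) k • (C *ᵥ (b₁ᴴ *ᵥ v)) +
      ((C *ᵥ (b₂ᴴ *ᵥ v')) k • (C *ᵥ (b₂ *ᵥ v)) + (C *ᵥ (b₂ *ᵥ v')) k • (C *ᵥ (b₂ᴴ *ᵥ v))) := by
    ext i
    have := key i
    rw [localPair_mulVec, e2, mulVec_smul, mulVec_add, mulVec_add, mulVec_add, Pi.smul_apply,
      Pi.add_apply, Pi.add_apply, Pi.add_apply, kronecker_mulVec_mul, kronecker_mulVec_mul,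
      kronecker_mulVec_mul, kronecker_mulVec_mul, smul_eq_mul] at this
    have h3 := mul_left_cancel₀ two_ne_zero this
    simp only [Pi.add_apply, Pi.smul_apply, smul_eq_mul]
    linear_combination h3
  have h4 := congrArg F key2
  have a1 : F (C *ᵥ (b₁ *ᵥ v)) = 0 := hFa _
  have a2 : F (C *ᵥ (b₂ *ᵥ v)) = 0 := hFa _
  have c1 : F (C *ᵥ (b₁ᴴ *ᵥ v)) = 0 := hFc _
  have c2 : F (C *ᵥ (b₂ᴴ *ᵥ v)) = 0 := hFc _
  simp only [map_add, map_smul, a1, a2, c1, c2, smul_eq_mul, mul_zero, add_zero] at h4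
  simp only [Pi.add_apply, Pi.smul_apply, smul_eq_mul, Pi.zero_apply]
  linear_combination h4

/-! ### Operators that implement Bogoliubov transformations of the single modes -/

/-- The combination `y b + z b†` of the annihilation and creation operators of mode `j`. -/
def modeComb (j : Fin n) (y z : ℂ) : Op n := y • annihilation j + z • (annihilation j)ᴴ

lemma modeComb_mul_add_mul (j : Fin n) (y z x w : ℂ) :
    modeComb j y z * modeComb j x w + modeComb j x w * modeComb j y z =
      (y * w + z * x) • (1 : Op n) := by
  have h := annihilation_anticomm_creation j
  rw [← h]
  simp only [modeComb, add_mul, mul_add, smul_mul_assoc, mul_smul_comm,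
    annihilation_mul_self, creation_mul_self, smul_zero]
  module

lemma modeComb_mul_self (j : Fin n) (y z : ℂ) :
    modeComb j y z * modeComb j y z = (y * z) • (1 : Op n) := by
  have h := annihilation_anticomm_creation j
  rw [← h]
  simp only [modeComb, add_mul, mul_add, smul_mul_assoc, mul_smul_comm,
    annihilation_mul_self, creation_mul_self, smul_zero]
  module

lemma smul_eq_zero_of_ne {K : Op n} (hK : K ≠ 0) {c : ℂ} (h : c • K = 0) : c = 0 :=
  (smul_eq_zero.1 h).resolve_right hK

/-- Operators `A'` with `A K = K A'` for some `A`. -/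
def intertwined (K : Op n) : Subalgebra ℂ (Op n) where
  carrier := {A' | ∃ A, A * K = K * A'}
  mul_mem' := by
    rintro a b ⟨A, hA⟩ ⟨B, hB⟩
    exact ⟨A * B, by rw [mul_assoc, hB, ← mul_assoc, hA, mul_assoc]⟩
  add_mem' := by
    rintro a b ⟨A, hA⟩ ⟨B, hB⟩
    exact ⟨A + B, by rw [add_mul, mul_add, hA, hB]⟩
  algebraMap_mem' c := ⟨algebraMap ℂ (Op n) c, Algebra.commutes c K⟩

/-- If `K v = 0`, then `K A' v = A K v = 0` for every `A'`. For `v ≠ 0` the vectors `A' v` exhaust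
the space, which would force `K = 0`. -/
lemma isUnit_of_intertwined_eq_top {K : Op n} (hK : K ≠ 0) (h : intertwined K = ⊤) :
    IsUnit K := by
  rw [← Matrix.mulVec_injective_iff_isUnit]
  have h0 : ∀ v, K *ᵥ v = 0 → v = 0 := by
    intro v hv
    by_contra hne
    apply hK
    have hN : star v ⬝ᵥ v ≠ 0 := fun h => hne (dotProduct_star_self_eq_zero.1 h)
    refine Matrix.ext_of_mulVec_single fun i => ?_
    have hmem : vecMulVec (Pi.single i 1) ((star v ⬝ᵥ v)⁻¹ • star v) ∈ intertwined K := by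
      rw [h]; trivial
    obtain ⟨A, hA⟩ := hmem
    have h1 : vecMulVec (Pi.single i 1) ((star v ⬝ᵥ v)⁻¹ • star v) *ᵥ v = Pi.single i (1 : ℂ) := by
      rw [vecMulVec_mulVec, smul_dotProduct, smul_eq_mul, inv_mul_cancel₀ hN]
      simp
    rw [← h1, mulVec_mulVec, ← hA, ← mulVec_mulVec, hv, mulVec_zero, zero_mulVec]
  intro u v huv
  exact sub_eq_zero.1 (h0 _ (by rw [mulVec_sub, sub_eq_zero]; exact huv))

/-! ### Rigidity: the transformation of the modes determines its implementer up to a scalar. -/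

section Intertwiner

variable {K : Op n} {δ : ℂ} {y z x w : Fin n → ℂ}

/-- The relations `b² = 0`, `b†² = 0` and `b b† + b† b = 1` are carried through the nonzero `K`;
each product contains `δ` twice, so the sign drops out. -/
lemma intertwiner_coeff (hK : K ≠ 0) (hδ : δ * δ = 1)
    (hb : ∀ j, annihilation j * K = δ • (K * modeComb j (y j) (z j)))
    (hc : ∀ j, (annihilation j)ᴴ * K = δ • (K * modeComb j (w j) (x j))) (j : Fin n) :
    y j * z j = 0 ∧ x j * w j = 0 ∧ y j * x j + z j * w j = 1 := by
  refine ⟨?_, ?_, ?_⟩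
  · refine smul_eq_zero_of_ne hK ?_
    have h1 : annihilation j * (annihilation j * K) = 0 := by
      rw [← mul_assoc, annihilation_mul_self, zero_mul]
    rw [hb, mul_smul_comm, ← mul_assoc, hb, smul_mul_assoc, smul_smul, hδ, one_smul, mul_assoc,
      modeComb_mul_self, mul_smul_comm, mul_one] at h1
    exact h1
  · refine smul_eq_zero_of_ne hK ?_
    have h1 : (annihilation j)ᴴ * ((annihilation j)ᴴ * K) = 0 := by
      rw [← mul_assoc, creation_mul_self, zero_mul]
    rw [hc, mul_smul_comm, ← mul_assoc, hc, smul_mul_assoc, smul_smul, hδ, one_smul, mul_assoc,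
      modeComb_mul_self, mul_smul_comm, mul_one] at h1
    rwa [mul_comm]
  · have h1 : annihilation j * ((annihilation j)ᴴ * K) + (annihilation j)ᴴ * (annihilation j * K)
        = K := by
      rw [← mul_assoc, ← mul_assoc, ← add_mul, annihilation_anticomm_creation, one_mul]
    rw [hb, hc, mul_smul_comm, mul_smul_comm, ← mul_assoc, ← mul_assoc, hb, hc, smul_mul_assoc,
      smul_mul_assoc, smul_smul, smul_smul, hδ, one_smul, one_smul, mul_assoc, mul_assoc,
      ← mul_add, modeComb_mul_add_mul, mul_smul_comm, mul_one] at h1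
    have h2 : (y j * x j + z j * w j - 1) • K = 0 := by
      rw [sub_smul, h1, one_smul, sub_self]
    exact sub_eq_zero.1 (smul_eq_zero_of_ne hK h2)

/-- Inverts the transformation of one mode. The coefficient of `b†` is `2 x z`, which the three
relations force to vanish. -/
lemma annihilation_eq_modeComb {y z x w : ℂ} (h1 : y * z = 0) (h2 : x * w = 0)
    (h3 : y * x + z * w = 1) (j : Fin n) :
    annihilation j = x • modeComb j y z + z • modeComb j w x := by
  have h4 : x * z = 0 := by linear_combination (-x * z) * h3 + x * x * h1 + z * z * h2
  simp only [modeComb, smul_add, smul_smul]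
  have e : annihilation j = (y * x + z * w) • annihilation j +
      (2 * (x * z)) • (annihilation j)ᴴ := by rw [h3, h4]; simp
  conv_lhs => rw [e]
  module

lemma creation_eq_modeComb {y z x w : ℂ} (h1 : y * z = 0) (h2 : x * w = 0)
    (h3 : y * x + z * w = 1) (j : Fin n) :
    (annihilation j)ᴴ = w • modeComb j y z + y • modeComb j w x := by
  have h4 : y * w = 0 := by linear_combination (-y * w) * h3 + y * y * h2 + w * w * h1
  simp only [modeComb, smul_add, smul_smul]
  have e : (annihilation j)ᴴ = (y * x + z * w) • (annihilation j)ᴴ +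
      (2 * (y * w)) • annihilation j := by rw [h3, h4]; simp
  conv_lhs => rw [e]
  module

/-- An operator that implements the same parity-twisted transformation of the modes as `K`
is a multiple of `K`. -/
theorem exists_eq_smul_of_intertwiner (hK : K ≠ 0) (hδ : δ * δ = 1)
    (hP : parity n * K * parity n = δ • K)
    (hb : ∀ j, annihilation j * K = δ • (K * modeComb j (y j) (z j)))
    (hc : ∀ j, (annihilation j)ᴴ * K = δ • (K * modeComb j (w j) (x j))) {L : Op n}
    (hLb : ∀ j, annihilation j * L = parity n * L * parity n * modeComb j (y j) (z j))
    (hLc : ∀ j, (annihilation j)ᴴ * L = parity n * L * parity n * modeComb j (w j) (x j)) :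
    ∃ c : ℂ, L = c • K := by
  have hcoef := intertwiner_coeff hK hδ hb hc
  have hδ0 : δ ≠ 0 := left_ne_zero_of_mul_eq_one hδ
  have hβ : ∀ j, modeComb j (y j) (z j) ∈ intertwined K := fun j =>
    ⟨δ⁻¹ • annihilation j, by rw [smul_mul_assoc, hb, smul_smul, inv_mul_cancel₀ hδ0, one_smul]⟩
  have hγ : ∀ j, modeComb j (w j) (x j) ∈ intertwined K := fun j =>
    ⟨δ⁻¹ • (annihilation j)ᴴ, by
      rw [smul_mul_assoc, hc, smul_smul, inv_mul_cancel₀ hδ0, one_smul]⟩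
  have htop : intertwined K = ⊤ := by
    refine eq_top_of_annihilation_mem _ (fun j => ?_) fun j => ?_
    · rw [annihilation_eq_modeComb (hcoef j).1 (hcoef j).2.1 (hcoef j).2.2 j]
      exact Subalgebra.add_mem _ (Subalgebra.smul_mem _ (hβ j) _) (Subalgebra.smul_mem _ (hγ j) _)
    · rw [creation_eq_modeComb (hcoef j).1 (hcoef j).2.1 (hcoef j).2.2 j]
      exact Subalgebra.add_mem _ (Subalgebra.smul_mem _ (hβ j) _) (Subalgebra.smul_mem _ (hγ j) _)
  obtain ⟨⟨K', Ki, hKi, hiK⟩, rfl⟩ := isUnit_of_intertwined_eq_top hK htop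
  simp only at *
  -- `K` is invertible, and `K⁻¹ L` satisfies the twisted commutation relations with the transformed
  -- modes. These span the original ones, so it is a scalar.
  set X := Ki * L
  have hLX : L = K' * X := by rw [← mul_assoc, hKi, one_mul]
  have hPL : parity n * L * parity n = δ • (K' * (parity n * X * parity n)) := by
    rw [hLX]
    calc parity n * (K' * X) * parity n
        = parity n * K' * (parity n * parity n) * X * parity n := by
          rw [parity_mul_self]; simp only [mul_assoc, one_mul]
      _ = (parity n * K' * parity n) * (parity n * X * parity n) := by simp only [mul_assoc]
      _ = _ := by rw [hP, smul_mul_assoc]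
  have hcancel : ∀ A B : Op n, δ • (K' * A) = δ • (K' * B) → A = B := fun A B h => by
    have h1 := congrArg (Ki * ·) (smul_right_injective _ hδ0 h)
    simpa only [← mul_assoc, hiK, one_mul] using h1
  have hXβ : ∀ j, modeComb j (y j) (z j) * X = parity n * X * parity n * modeComb j (y j) (z j) := by
    intro j
    refine hcancel _ _ ?_
    have h1 := hLb j
    rw [hPL, hLX, ← mul_assoc, hb, smul_mul_assoc, smul_mul_assoc, mul_assoc, mul_assoc] at h1
    exact h1
  have hXγ : ∀ j, modeComb j (w j) (x j) * X = parity n * X * parity n * modeComb j (w j) (x j) := by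
    intro j
    refine hcancel _ _ ?_
    have h1 := hLc j
    rw [hPL, hLX, ← mul_assoc, hc, smul_mul_assoc, smul_mul_assoc, mul_assoc, mul_assoc] at h1
    exact h1
  obtain ⟨c, hc'⟩ := exists_eq_smul_one_of_twisted (X := X)
    (fun j => by
      rw [annihilation_eq_modeComb (hcoef j).1 (hcoef j).2.1 (hcoef j).2.2 j, add_mul, mul_add,
        smul_mul_assoc, smul_mul_assoc, mul_smul_comm, mul_smul_comm, hXβ, hXγ])
    (fun j => by
      rw [creation_eq_modeComb (hcoef j).1 (hcoef j).2.1 (hcoef j).2.2 j, add_mul, mul_add,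
        smul_mul_assoc, smul_mul_assoc, mul_smul_comm, mul_smul_comm, hXβ, hXγ])
  exact ⟨c, by rw [hLX, hc', mul_smul_comm, mul_one]⟩

end Intertwiner

/-! ### The Choi matrix of a map between pure states -/

/-- Basis vectors of the doubled system are pairs of basis vectors. -/
def appendEquiv (n : ℕ) : Occ n × Occ n ≃ Occ (n + n) where
  toFun p := Fin.append p.1 p.2
  invFun w := (leftOcc w, rightOcc w)
  left_inv _ := Prod.ext (leftOcc_append _ _) (rightOcc_append _ _)
  right_inv w := append_leftOcc_rightOcc w

lemma sum_occ_add {M : Type*} [AddCommMonoid M] (f : Occ (n + n) → M) :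
    ∑ w, f w = ∑ u : Occ n, ∑ x : Occ n, f (Fin.append u x) := by
  rw [← Fintype.sum_prod_type' fun u x => f (Fin.append u x)]
  exact (Fintype.sum_equiv (appendEquiv n) _ _ fun p => rfl).symm

/-- The representation of operators as vectors is an isometry for the Hilbert–Schmidt product, and
`|η⟩⟨ψ|` is dual to the matrix element `⟨η|K|ψ⟩`. -/
lemma star_choiVec_vecMulVec_dotProduct (η ψ : Occ n → ℂ) (v : Occ (n + n) → ℂ) :
    star (choiVec (vecMulVec η (star ψ))) ⬝ᵥ v = star η ⬝ᵥ (choiOp v *ᵥ ψ) := by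
  simp only [dotProduct, sum_occ_add, mulVec, Finset.mul_sum]
  refine Finset.sum_congr rfl fun u _ => Finset.sum_congr rfl fun x _ => ?_
  rw [Pi.star_apply, choiVec_apply, leftOcc_append, rightOcc_append, vecMulVec_apply, star_mul',
    star_mul', star_pairSign, Pi.star_apply, star_star, Pi.star_apply, choiOp]
  simp only [LinearMap.coe_mk, AddHom.coe_mk, of_apply]
  ring

/-- Feeding `|η⟩⟨ψ|` to the Choi matrix and evaluating at `ψ` contracts both input indices with
`|ψ⟩⟨ψ|`, which recovers `E`; the pair signs square to one. -/
lemma choiOp_choiMatrix_mulVec (E : SuperOp n) (η ψ : Occ n → ℂ) :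
    choiOp (choiMatrix E *ᵥ choiVec (vecMulVec η (star ψ))) *ᵥ ψ = E (proj ψ) *ᵥ η := by
  have hE : E (proj ψ) = ∑ x, ∑ x', (ψ x * star (ψ x')) • E (single x x' 1) := by
    conv_lhs => rw [proj, matrix_eq_sum_single (vecMulVec ψ (star ψ))]
    simp only [map_sum]
    refine Finset.sum_congr rfl fun x _ => Finset.sum_congr rfl fun x' _ => ?_
    rw [← map_smul, smul_single, vecMulVec_apply, Pi.star_apply, smul_eq_mul, mul_one]
  ext u
  simp only [mulVec, dotProduct]
  rw [hE]
  simp only [Matrix.sum_apply, Matrix.smul_apply, smul_eq_mul, Finset.sum_mul]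
  have hK : ∀ x, choiOp (choiMatrix E *ᵥ choiVec (vecMulVec η (star ψ))) u x =
      ∑ u', ∑ x', E (single x x' 1) u u' * (η u' * star (ψ x')) := by
    intro x
    simp only [choiOp, LinearMap.coe_mk, AddHom.coe_mk, of_apply, mulVec, dotProduct, sum_occ_add,
      Finset.sum_mul]
    refine Finset.sum_congr rfl fun u' _ => Finset.sum_congr rfl fun x' _ => ?_
    rw [choiMatrix, choiVec_apply, leftOcc_append, rightOcc_append, leftOcc_append,
      rightOcc_append, vecMulVec_apply, Pi.star_apply]
    have s1 := pairSign_mul_self x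
    have s2 := pairSign_mul_self x'
    linear_combination (E (single x x' 1) u u' * η u' * star (ψ x')) * s2 +
      (E (single x x' 1) u u' * η u' * star (ψ x') * (pairSign x' * pairSign x')) * s1
  simp only [hK, Finset.sum_mul]
  rw [Finset.sum_comm]
  refine Finset.sum_congr rfl fun u' _ => Finset.sum_congr rfl fun x _ =>
    Finset.sum_congr rfl fun x' _ => ?_
  ring

lemma PosSemidef.mulVec_orthogonal {m : Type*} [Fintype m] [DecidableEq m] {C : Matrix m m ℂ}
    (hC : C.PosSemidef) {v : m → ℂ} (hv : star v ⬝ᵥ (C *ᵥ v) = 0) (u : m → ℂ) :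
    star v ⬝ᵥ (C *ᵥ u) = 0 := by
  have h1 := (hC.dotProduct_mulVec_zero_iff v).1 hv
  rw [dotProduct_mulVec, ← hC.1.eq, ← star_mulVec, h1, star_zero, zero_dotProduct]

/-- If a map with a positive Choi matrix maps `ψ` to the pure state `φ`, then all operators in the
range of the Choi matrix map `ψ` to multiples of `φ`. -/
lemma exists_choiOp_mulVec_eq_smul {E : SuperOp n} (hE : (choiMatrix E).PosSemidef)
    {ψ φ : Occ n → ℂ} (hφ : star φ ⬝ᵥ φ = 1) (hmap : E (proj ψ) = proj φ)
    (v : Occ (n + n) → ℂ) : ∃ a : ℂ, choiOp (choiMatrix E *ᵥ v) *ᵥ ψ = a • φ := by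
  -- The expectation of `C` in the vector of `|η⟩⟨ψ|` is `⟨η|φ⟩⟨φ|η⟩ = 0`. By positivity this vector
  -- lies in the kernel of `C`, hence is orthogonal to its range.
  have hη : ∀ η : Occ n → ℂ, star η ⬝ᵥ φ = 0 →
      star η ⬝ᵥ (choiOp (choiMatrix E *ᵥ v) *ᵥ ψ) = 0 := by
    intro η h
    rw [← star_choiVec_vecMulVec_dotProduct]
    refine PosSemidef.mulVec_orthogonal hE ?_ v
    rw [star_choiVec_vecMulVec_dotProduct, choiOp_choiMatrix_mulVec, hmap, proj, vecMulVec_mulVec,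
      star_dotProduct φ η, h]
    simp
  set k := choiOp (choiMatrix E *ᵥ v) *ᵥ ψ
  refine ⟨star φ ⬝ᵥ k, ?_⟩
  set η := k - (star φ ⬝ᵥ k) • φ
  have h1 : star η ⬝ᵥ φ = 0 := by
    rw [star_dotProduct, dotProduct_sub, dotProduct_smul, hφ]
    simp
  have h2 := hη η h1
  have h3 : star η ⬝ᵥ η = 0 := by
    rw [dotProduct_sub, dotProduct_smul, h1, h2]; simp
  exact sub_eq_zero.1 (dotProduct_star_self_eq_zero.1 h3)

/-- The functional `v ↦ ⟨g| K |ψ⟩` for the operator `K` represented by `v`. -/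
def matrixElement (g ψ : Occ n → ℂ) : (Occ (n + n) → ℂ) →ₗ[ℂ] ℂ where
  toFun v := star g ⬝ᵥ (choiOp v *ᵥ ψ)
  map_add' u v := by rw [map_add, add_mulVec, dotProduct_add]
  map_smul' c v := by rw [map_smul, smul_mulVec, dotProduct_smul]; rfl

lemma matrixElement_choiVec (g ψ : Occ n → ℂ) (K : Op n) :
    matrixElement g ψ (choiVec K) = star g ⬝ᵥ (K *ᵥ ψ) := by
  simp [matrixElement]

lemma choiOp_pairParity_mulVec (v : Occ (n + n) → ℂ) :
    choiOp (pairParity Finset.univ *ᵥ v) = parity n * choiOp v * parity n := by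
  conv_lhs => rw [← choiVec_choiOp v]
  rw [pairParity_choiVec, choiOp_choiVec, parity_eq]

lemma pairParity_univ_mul_majorana (p : Fin (n + n) × Fin 2) :
    pairParity Finset.univ * majorana p = -(majorana p * pairParity Finset.univ) := by
  obtain ⟨J, a⟩ := p
  induction J using Fin.addCases with
  | left j => rw [pairParity_mul_majorana_castAdd]; simp
  | right j => rw [pairParity_mul_majorana_natAdd, if_pos (Finset.mem_univ j), neg_one_smul]

/-! ### From the relation for one pair of modes to a single Kraus operator. -/

section

variable {E : SuperOp n} {ψ φ : Occ n → ℂ}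

/-- The Choi matrix of a Gaussian map between pure states with definite parity relates the
operators in its range to a fixed transformation of the modes. -/
lemma exists_twisted_relation (hG : IsGaussianMap E) (hcov : ∀ j, IsCovariant (parityOn {j}) E)
    (hcovP : IsCovariant (parity n) E) (hφ : star φ ⬝ᵥ φ = 1) {ε ε' : ℂ} (hε : ε * ε = 1)
    (hε' : ε' * ε' = 1) (hPφ : parity n *ᵥ φ = ε • φ) (hPψ : parity n *ᵥ ψ = ε' • ψ)
    (hmap : E (proj ψ) = proj φ) {v : Occ (n + n) → ℂ}
    (hQv : pairParity Finset.univ *ᵥ v = (ε * ε') • v)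
    (hv : choiOp (choiMatrix E *ᵥ v) *ᵥ ψ = φ) (j : Fin n) (g : Occ n → ℂ) :
    ∃ y z : ℂ, ∀ v', (star g ⬝ᵥ (annihilation j *ᵥ φ)) •
        ((annihilation j)ᴴ * choiOp (choiMatrix E *ᵥ v')) +
      (star g ⬝ᵥ ((annihilation j)ᴴ *ᵥ φ)) • (annihilation j * choiOp (choiMatrix E *ᵥ v')) =
      parity n * choiOp (choiMatrix E *ᵥ v') * parity n * modeComb j y z := by
  set C := choiMatrix E
  have hC := hG.choiMatrix_posSemidef
  have hQC : pairParity Finset.univ * C = C * pairParity Finset.univ :=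
    IsCovariant.pairParity_mul_choiMatrix (by rwa [← parity_eq])
  -- The operator `K` in question maps `ψ` to a multiple of `φ`. A Majorana operator has reversed
  -- its parity, so `K ψ` has parity opposite to `φ` and must vanish.
  have hF : ∀ p, matrixElement g ψ (C *ᵥ (majorana p *ᵥ v)) = 0 := by
    intro p
    obtain ⟨a, ha⟩ := exists_choiOp_mulVec_eq_smul hC hφ hmap (majorana p *ᵥ v)
    set K := choiOp (C *ᵥ (majorana p *ᵥ v))
    have h1 : parity n * K * parity n = -(ε * ε') • K := by
      rw [← choiOp_pairParity_mulVec, mulVec_mulVec, mulVec_mulVec, hQC, mul_assoc,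
        pairParity_univ_mul_majorana, mul_neg, neg_mulVec, ← mulVec_mulVec, ← mulVec_mulVec, hQv,
        mulVec_smul, mulVec_smul, map_neg, map_smul, neg_smul]
    have h2 : parity n *ᵥ (K *ᵥ ψ) = -ε • (K *ᵥ ψ) := by
      have h3 : parity n * K = (-(ε * ε') • K) * parity n := by
        rw [← h1, mul_assoc, parity_mul_self, mul_one]
      rw [mulVec_mulVec, h3, ← mulVec_mulVec, hPψ, mulVec_smul, smul_mulVec, smul_smul]
      congr 1
      linear_combination (-ε) * hε'
    rw [ha, mulVec_smul, hPφ, smul_smul, smul_smul] at h2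
    have h4 : (2 * ε * a) • φ = 0 := by
      have : (2 * ε * a) • φ = (a * ε) • φ - (-ε * a) • φ := by rw [← sub_smul]; congr 1; ring
      rw [this, h2, sub_self]
    have hφ0 : φ ≠ 0 := fun h => by simp [h] at hφ
    have hε0 : ε ≠ 0 := left_ne_zero_of_mul_eq_one hε
    have ha0 : a = 0 := by
      simpa [hε0] using (smul_eq_zero.1 h4).resolve_right hφ0
    change star g ⬝ᵥ (K *ᵥ ψ) = 0
    rw [ha, ha0, zero_smul, dotProduct_zero]
  have key := contracted_localPair hG j (hcov j) (matrixElement g ψ) v hF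
  set K₀ := choiOp (C *ᵥ v)
  have hK₀ : C *ᵥ v = choiVec K₀ := (choiVec_choiOp _).symm
  -- The coefficients are the matrix elements produced by the second-copy terms; they involve only
  -- `K₀`, not `v'`.
  refine ⟨star g ⬝ᵥ ((parity n * K₀ * parity n * (annihilation j)ᴴ) *ᵥ ψ),
    star g ⬝ᵥ ((parity n * K₀ * parity n * annihilation j) *ᵥ ψ), fun v' => ?_⟩
  have h1 := congrArg choiOp (key v')
  change choiOp (_ • (_ *ᵥ (C *ᵥ v')) + _ • (_ *ᵥ (C *ᵥ v')) + (_ • (_ *ᵥ (C *ᵥ v')) +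
    _ • (_ *ᵥ (C *ᵥ v')))) = _ at h1
  set L := choiOp (C *ᵥ v')
  have hL : C *ᵥ v' = choiVec L := (choiVec_choiOp _).symm
  rw [hL] at h1
  change choiOp (matrixElement g ψ (_ *ᵥ (C *ᵥ v)) • _ + matrixElement g ψ (_ *ᵥ (C *ᵥ v)) • _ +
    (matrixElement g ψ (_ *ᵥ (C *ᵥ v)) • _ + matrixElement g ψ (_ *ᵥ (C *ᵥ v)) • _)) = _ at h1
  rw [hK₀] at h1
  simp only [annihilation_castAdd_choiVec, creation_castAdd_choiVec, annihilation_natAdd_choiVec,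
    creation_natAdd_choiVec, matrixElement_choiVec, ← mulVec_mulVec ψ (annihilation j),
    ← mulVec_mulVec ψ (annihilation j)ᴴ, map_add, map_smul, choiOp_choiVec, map_zero, neg_mulVec,
    dotProduct_neg] at h1
  rw [hv] at h1
  rw [modeComb, mul_add, mul_smul_comm, mul_smul_comm]
  rw [← sub_eq_zero, ← h1]
  module

/-- A Gaussian map that is covariant under the local parities and maps a pure fermionic state to
a pure fermionic state in which every mode is partially occupied has a single Kraus operator, and
this operator transforms every mode into itself. -/
theorem exists_kraus_of_isGaussianMap (hG : IsGaussianMap E)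
    (hcov : ∀ j, IsCovariant (parityOn {j}) E)
    (hcovP : IsCovariant (parity n) E) (hφ : star φ ⬝ᵥ φ = 1) {ε ε' : ℂ} (hε : ε * ε = 1)
    (hε' : ε' * ε' = 1) (hPφ : parity n *ᵥ φ = ε • φ) (hPψ : parity n *ᵥ ψ = ε' • ψ)
    (hmap : E (proj ψ) = proj φ) (hb : ∀ j, annihilation j *ᵥ φ ≠ 0)
    (hc : ∀ j, (annihilation j)ᴴ *ᵥ φ ≠ 0) :
    ∃ (K : Op n) (y z : Fin n → ℂ), (∀ ρ, E ρ = K * ρ * Kᴴ) ∧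
      ∀ j, y j * z j = 0 ∧ annihilation j * K = K * modeComb j (y j) (z j) := by
  set C := choiMatrix E with hCdef
  have hC := hG.choiMatrix_posSemidef
  have hQC : pairParity Finset.univ * C = C * pairParity Finset.univ :=
    IsCovariant.pairParity_mul_choiMatrix (by rwa [← parity_eq])
  -- With this vector the resulting operator `K` maps `ψ` exactly to `φ`, and its parity is the
  -- product of the two state parities.
  set v := choiVec (vecMulVec φ (star ψ))
  have hQv : pairParity Finset.univ *ᵥ v = (ε * ε') • v := by
    have h1 : star ψ ᵥ* parity n = star ε' • star ψ := by
      rw [← star_smul, ← hPψ, star_mulVec, parity_conjTranspose]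
    have h2 : star ε' = ε' := by
      rcases mul_self_eq_one_iff.1 hε' with h | h <;> simp [h]
    rw [pairParity_choiVec, ← parity_eq, mul_vecMulVec, vecMulVec_mul, hPφ, h1, h2,
      smul_vecMulVec, vecMulVec_smul, smul_smul, map_smul]
  set K := choiOp (C *ᵥ v) with hKdef
  have hKψ : K *ᵥ ψ = φ := by
    rw [hKdef, choiOp_choiMatrix_mulVec, hmap, proj, vecMulVec_mulVec, hφ]
    simp
  have hKne : K ≠ 0 := fun h => by
    rw [h, zero_mulVec] at hKψ
    rw [← hKψ] at hφ
    simp at hφ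
  have hPK : parity n * K * parity n = (ε * ε') • K := by
    rw [← choiOp_pairParity_mulVec, mulVec_mulVec, hQC, ← mulVec_mulVec, hQv, mulVec_smul,
      map_smul]
  have hδ : (ε * ε') * (ε * ε') = 1 := by linear_combination ε' * ε' * hε + hε'
  -- Because of this orthogonality, taking one of the two vectors as `g` keeps just one term of the
  -- relation.
  have hbc : ∀ j, star (annihilation j *ᵥ φ) ⬝ᵥ ((annihilation j)ᴴ *ᵥ φ) = 0 := fun j => by
    rw [star_mulVec, ← dotProduct_mulVec, mulVec_mulVec, creation_mul_self, zero_mulVec,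
      dotProduct_zero]
  have hcb : ∀ j, star ((annihilation j)ᴴ *ᵥ φ) ⬝ᵥ (annihilation j *ᵥ φ) = 0 := fun j => by
    rw [star_dotProduct, hbc, star_zero]
  have hrelb : ∀ j, ∃ y z : ℂ, ∀ v', annihilation j * choiOp (C *ᵥ v') =
      parity n * choiOp (C *ᵥ v') * parity n * modeComb j y z := by
    intro j
    obtain ⟨y, z, h⟩ := exists_twisted_relation hG hcov hcovP hφ hε hε' hPφ hPψ hmap hQv hKψ j
      ((annihilation j)ᴴ *ᵥ φ)
    have hN : star ((annihilation j)ᴴ *ᵥ φ) ⬝ᵥ ((annihilation j)ᴴ *ᵥ φ) ≠ 0 := fun h =>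
      hc j (dotProduct_star_self_eq_zero.1 h)
    refine ⟨(star ((annihilation j)ᴴ *ᵥ φ) ⬝ᵥ ((annihilation j)ᴴ *ᵥ φ))⁻¹ * y,
      (star ((annihilation j)ᴴ *ᵥ φ) ⬝ᵥ ((annihilation j)ᴴ *ᵥ φ))⁻¹ * z, fun v' => ?_⟩
    have h1 := h v'
    rw [hcb, zero_smul, zero_add] at h1
    rw [modeComb, mul_smul, mul_smul, ← smul_add, mul_smul_comm]
    rw [modeComb] at h1
    rw [← h1, smul_smul, inv_mul_cancel₀ hN, one_smul]
  have hrelc : ∀ j, ∃ w x : ℂ, ∀ v', (annihilation j)ᴴ * choiOp (C *ᵥ v') =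
      parity n * choiOp (C *ᵥ v') * parity n * modeComb j w x := by
    intro j
    obtain ⟨y, z, h⟩ := exists_twisted_relation hG hcov hcovP hφ hε hε' hPφ hPψ hmap hQv hKψ j
      (annihilation j *ᵥ φ)
    have hN : star (annihilation j *ᵥ φ) ⬝ᵥ (annihilation j *ᵥ φ) ≠ 0 := fun h =>
      hb j (dotProduct_star_self_eq_zero.1 h)
    refine ⟨(star (annihilation j *ᵥ φ) ⬝ᵥ (annihilation j *ᵥ φ))⁻¹ * y,
      (star (annihilation j *ᵥ φ) ⬝ᵥ (annihilation j *ᵥ φ))⁻¹ * z, fun v' => ?_⟩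
    have h1 := h v'
    rw [hbc, zero_smul, add_zero] at h1
    rw [modeComb, mul_smul, mul_smul, ← smul_add, mul_smul_comm]
    rw [modeComb] at h1
    rw [← h1, smul_smul, inv_mul_cancel₀ hN, one_smul]
  choose y z hyz using hrelb
  choose w x hwx using hrelc
  have hKb : ∀ j, annihilation j * K = (ε * ε') • (K * modeComb j (y j) (z j)) := fun j => by
    rw [hyz j v, hPK, smul_mul_assoc]
  have hKc : ∀ j, (annihilation j)ᴴ * K = (ε * ε') • (K * modeComb j (w j) (x j)) := fun j => by
    rw [hwx j v, hPK, smul_mul_assoc]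
  have hrange : ∀ v', ∃ c : ℂ, C *ᵥ v' = c • choiVec K := by
    intro v'
    obtain ⟨c, hc⟩ := exists_eq_smul_of_intertwiner hKne hδ hPK hKb hKc
      (fun j => hyz j v') (fun j => hwx j v')
    exact ⟨c, by rw [← map_smul, ← hc, choiVec_choiOp]⟩
  have hvK : star v ⬝ᵥ choiVec K = 1 := by
    rw [star_choiVec_vecMulVec_dotProduct, choiOp_choiVec, hKψ, hφ]
  have hCv : C *ᵥ v = choiVec K := (choiVec_choiOp _).symm
  -- A Hermitian matrix with range in a line is a multiple of the projector; the normalization comes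
  -- from `⟨v, choiVec K⟩ = ⟨φ|Kψ⟩ = 1`.
  have hCK : ∀ v', C *ᵥ v' = (star (choiVec K) ⬝ᵥ v') • choiVec K := by
    intro v'
    obtain ⟨c, hc⟩ := hrange v'
    have h1 : star v ⬝ᵥ (C *ᵥ v') = c := by
      rw [hc, dotProduct_smul, hvK, smul_eq_mul, mul_one]
    have h2 : star v ⬝ᵥ (C *ᵥ v') = star (choiVec K) ⬝ᵥ v' := by
      have hCH : Cᴴ = C := hC.1.eq
      rw [dotProduct_mulVec, ← hCv, star_mulVec, hCH]
    rw [hc, ← h2, h1]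
  have hCentry : ∀ a b, C a b = choiVec K a * star (choiVec K b) := by
    intro a b
    have h1 := congrFun (hCK (Pi.single b 1)) a
    rw [mulVec_single_one, Pi.smul_apply, smul_eq_mul, dotProduct_single, mul_one] at h1
    rw [mul_comm]
    exact h1
  have hEsingle : ∀ a b : Occ n, E (single a b 1) = K * single a b 1 * Kᴴ := by
    intro a b
    ext u u'
    have h1 := hCentry (Fin.append u a) (Fin.append u' b)
    rw [hCdef, choiMatrix, choiVec_apply, choiVec_apply] at h1
    simp only [leftOcc_append, rightOcc_append] at h1
    have s1 := pairSign_mul_self a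
    have s2 := pairSign_mul_self b
    rw [star_mul', star_pairSign] at h1
    have h2 : (K * single a b (1 : ℂ) * Kᴴ : Op n) u u' = K u a * star (K u' b) := by
      rw [Matrix.mul_apply, Finset.sum_eq_single b]
      · simp [mul_single_apply_same]
      · intro c _ hc
        rw [mul_single_apply_of_ne _ _ _ _ _ hc, zero_mul]
      · simp
    rw [h2]
    generalize E (single a b 1) u u' = e at *
    linear_combination pairSign a * pairSign b * h1 - (e - K u a * star (K u' b)) *
      (pairSign b * pairSign b * s1 + s2)
  refine ⟨K, fun j => (ε * ε') * y j, fun j => (ε * ε') * z j, fun ρ => ?_, fun j => ⟨?_, ?_⟩⟩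
  · conv_lhs => rw [matrix_eq_sum_single ρ]
    conv_rhs => rw [matrix_eq_sum_single ρ]
    simp only [map_sum, Finset.mul_sum, Finset.sum_mul]
    refine Finset.sum_congr rfl fun a _ => Finset.sum_congr rfl fun b _ => ?_
    have : single a b (ρ a b) = ρ a b • single a b (1 : ℂ) := by simp
    rw [this, map_smul, hEsingle, mul_smul_comm, smul_mul_assoc]
  · linear_combination (ε * ε') * (ε * ε') * (intertwiner_coeff hKne hδ hKb hKc j).1
  · rw [hKb j, modeComb, modeComb, mul_smul (ε * ε'), mul_smul (ε * ε'), ← smul_add, mul_smul_comm]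

end

/-! ### Fully entangled states -/

lemma parityOn_singleton_eq (j : Fin n) :
    parityOn {j} = -Complex.I • (majorana (j, 0) * majorana (j, 1)) := by
  rw [majorana_zero_mul_one, smul_smul]; simp

lemma majorana_mem_localAlgebra {S : Set (Fin n)} {p : Fin n × Fin 2} (h : p.1 ∈ S) :
    majorana p ∈ localAlgebra S :=
  Algebra.subset_adjoin ⟨p, h, rfl⟩

/-- Every operator is a combination of the monomials in the Majorana operators of mode `j` with
coefficients that act on the other modes. -/
lemma exists_mode_decomposition (j : Fin n) (X : Op n) :
    ∃ X₁ ∈ localAlgebra {j}ᶜ, ∃ X₂ ∈ localAlgebra {j}ᶜ, ∃ X₃ ∈ localAlgebra {j}ᶜ,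
      ∃ X₄ ∈ localAlgebra {j}ᶜ, X = X₁ + majorana (j, 0) * X₂ + majorana (j, 1) * X₃ +
        majorana (j, 0) * majorana (j, 1) * X₄ := by
  set R : Subalgebra ℂ (Op n) := localAlgebra {j}ᶜ
  have h10 : majorana (j, 1) * majorana (j, 0) = -(majorana (j, 0) * majorana (j, 1)) :=
    majorana_mul_of_ne (by simp)
  let D : Submodule ℂ (Op n) :=
    { carrier := {X | ∃ X₁ ∈ R, ∃ X₂ ∈ R, ∃ X₃ ∈ R, ∃ X₄ ∈ R, X = X₁ + majorana (j, 0) * X₂ +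
        majorana (j, 1) * X₃ + majorana (j, 0) * majorana (j, 1) * X₄}
      add_mem' := by
        rintro _ _ ⟨a, ha, b, hb, c, hc, d, hd, rfl⟩ ⟨a', ha', b', hb', c', hc', d', hd', rfl⟩
        refine ⟨_, R.add_mem ha ha', _, R.add_mem hb hb', _, R.add_mem hc hc', _,
          R.add_mem hd hd', ?_⟩
        simp only [mul_add]
        abel
      zero_mem' := ⟨0, R.zero_mem, 0, R.zero_mem, 0, R.zero_mem, 0, R.zero_mem, by simp⟩
      smul_mem' := by
        rintro r _ ⟨a, ha, b, hb, c, hc, d, hd, rfl⟩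
        refine ⟨_, R.smul_mem ha r, _, R.smul_mem hb r, _, R.smul_mem hc r, _,
          R.smul_mem hd r, ?_⟩
        simp only [mul_smul_comm, smul_add] }
  -- `D` collects the operators with the desired decomposition and `T` those whose left
  -- multiplication preserves `D`. It suffices that `T` contains the generators, since `1 ∈ D`.
  let T : Subalgebra ℂ (Op n) :=
    { carrier := {X | ∀ d ∈ D, X * d ∈ D}
      mul_mem' := fun {a b} ha hb d hd => by rw [mul_assoc]; exact ha _ (hb _ hd)
      add_mem' := fun {a b} ha hb d hd => by rw [add_mul]; exact D.add_mem (ha _ hd) (hb _ hd)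
      algebraMap_mem' := fun r d hd => by
        rw [← Algebra.smul_def]; exact D.smul_mem r hd }
  have hT : T = ⊤ := by
    refine eq_top_of_majorana_mem T fun p => ?_
    rintro _ ⟨a, ha, b, hb, c, hc, d, hd, rfl⟩
    by_cases hp : p.1 = j
    · obtain ⟨i, e⟩ := p
      subst hp
      fin_cases e
      · refine ⟨b, hb, a, ha, d, hd, c, hc, ?_⟩
        simp only [Fin.zero_eta, mul_add, ← mul_assoc, majorana_mul_self, one_mul]
        abel
      · refine ⟨c, hc, -d, R.neg_mem hd, a, ha, -b, R.neg_mem hb, ?_⟩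
        simp only [Fin.mk_one, mul_add, ← mul_assoc, majorana_mul_self, one_mul, h10, neg_mul,
          mul_neg]
        rw [mul_assoc (majorana _) (majorana _) (majorana _), majorana_mul_self, mul_one]
        abel
    · have hR : majorana p ∈ R := majorana_mem_localAlgebra (by simpa using hp)
      have h0 : majorana p * majorana (j, 0) = -(majorana (j, 0) * majorana p) :=
        majorana_mul_of_ne fun h => hp (congrArg Prod.fst h)
      have h1 : majorana p * majorana (j, 1) = -(majorana (j, 1) * majorana p) :=
        majorana_mul_of_ne fun h => hp (congrArg Prod.fst h)
      refine ⟨_, R.mul_mem hR ha, _, R.neg_mem (R.mul_mem hR hb), _, R.neg_mem (R.mul_mem hR hc),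
        _, R.mul_mem hR hd, ?_⟩
      simp only [mul_add, ← mul_assoc, h0, neg_mul, mul_neg]
      rw [mul_assoc (majorana _) (majorana p) (majorana _), h1]
      simp only [mul_neg, neg_mul, neg_neg, mul_assoc]
  have hX : X * 1 ∈ D := by
    have : X ∈ T := by rw [hT]; trivial
    exact this 1 ⟨1, R.one_mem, 0, R.zero_mem, 0, R.zero_mem, 0, R.zero_mem, by simp⟩
  rwa [mul_one] at hX

/-- Even operators that commute with the Majorana operators of mode `j` act on the other modes. -/
lemma mem_localAlgebra_compl {j : Fin n} {X : Op n} (hP : parity n * X = X * parity n)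
    (h0 : majorana (j, 0) * X = X * majorana (j, 0))
    (hZ : parityOn {j} * X = X * parityOn {j}) : X ∈ localAlgebra {j}ᶜ := by
  obtain ⟨a, ha, b, hb, c, hc, d, hd, hX⟩ := exists_mode_decomposition j X
  have hRZ : ∀ Y ∈ localAlgebra {j}ᶜ, parityOn {j} * Y = Y * parityOn {j} := fun Y hY =>
    commute_of_mem_localAlgebra hY fun p hp =>
      parityOn_mul_majorana_of_notMem (by simpa using hp)
  -- `P c_0` commutes with everything on the other modes and, by hypothesis, with `X`, but it
  -- anticommutes with `c_0 c_1`. This will force `d = 0`.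
  have hRP : ∀ Y ∈ localAlgebra {j}ᶜ,
      parity n * majorana (j, 0) * Y = Y * (parity n * majorana (j, 0)) := fun Y hY =>
    commute_of_mem_localAlgebra hY fun p hp => by
      have hne : (j, 0) ≠ p := fun h => hp (by simp [← h])
      rw [mul_assoc, majorana_mul_of_ne hne, mul_neg, ← mul_assoc, parity_mul_majorana, neg_mul,
        neg_neg, mul_assoc]
  have hZZ := parityOn_mul_self ({j} : Finset (Fin n))
  have hcZ : ∀ e : Fin 2, parityOn {j} * majorana (j, e) = -(majorana (j, e) * parityOn {j}) :=
    fun e => parityOn_mul_majorana_of_mem (by simp)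
  -- Conjugation by `Z_j` reverses the terms that are odd in mode `j`, so averaging over it removes
  -- `b` and `c`.
  have hX1 : X = a + majorana (j, 0) * majorana (j, 1) * d := by
    have h1 : parityOn {j} * X * parityOn {j} = X := by rw [hZ, mul_assoc, hZZ, mul_one]
    have hY : ∀ Y ∈ localAlgebra {j}ᶜ, parityOn {j} * Y * parityOn {j} = Y := fun Y hY => by
      rw [hRZ Y hY, mul_assoc, hZZ, mul_one]
    have hcY : ∀ e : Fin 2, ∀ Y ∈ localAlgebra {j}ᶜ,
        parityOn {j} * (majorana (j, e) * Y) * parityOn {j} = -(majorana (j, e) * Y) :=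
      fun e Y hY' => by
        rw [← mul_assoc, hcZ, neg_mul, neg_mul, mul_assoc, mul_assoc, ← mul_assoc (parityOn _),
          hY Y hY']
    have hccY : parityOn {j} * (majorana (j, 0) * majorana (j, 1) * d) * parityOn {j} =
        majorana (j, 0) * majorana (j, 1) * d := by
      rw [← mul_assoc, ← mul_assoc, hcZ, neg_mul, mul_assoc (majorana _), hcZ, mul_neg, neg_neg,
        ← mul_assoc, mul_assoc, mul_assoc, ← mul_assoc (parityOn _), hY d hd]
    have h2 : X = a - majorana (j, 0) * b - majorana (j, 1) * c +
        majorana (j, 0) * majorana (j, 1) * d := by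
      rw [← h1]
      conv_lhs => rw [hX]
      rw [mul_add, mul_add, mul_add, add_mul, add_mul, add_mul, hY a ha, hcY 0 b hb, hcY 1 c hc,
        hccY]
      abel
    have h3 : (2 : ℂ) • X = (2 : ℂ) • (a + majorana (j, 0) * majorana (j, 1) * d) := by
      rw [two_smul]
      nth_rewrite 1 [hX]
      rw [h2]
      module
    exact smul_right_injective _ two_ne_zero h3
  have h1 : parity n * majorana (j, 0) * X = X * (parity n * majorana (j, 0)) := by
    rw [mul_assoc, h0, ← mul_assoc, hP, mul_assoc]
  have h2 : parity n * majorana (j, 0) * (majorana (j, 0) * majorana (j, 1) * d) =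
      majorana (j, 0) * majorana (j, 1) * d * (parity n * majorana (j, 0)) := by
    have e : majorana (j, 0) * majorana (j, 1) * d = X - a := by rw [hX1]; abel
    rw [e, mul_sub, sub_mul, h1, hRP a ha]
  have h10 : majorana (j, 1) * majorana (j, 0) = -(majorana (j, 0) * majorana (j, 1)) :=
    majorana_mul_of_ne (by simp)
  have h3 : parity n * (majorana (j, 1) * d) = -(parity n * (majorana (j, 1) * d)) := by
    calc parity n * (majorana (j, 1) * d)
        = parity n * majorana (j, 0) * (majorana (j, 0) * majorana (j, 1) * d) := by
          rw [mul_assoc, ← mul_assoc (majorana (j, 0)), ← mul_assoc (majorana (j, 0)),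
            majorana_mul_self, one_mul]
      _ = majorana (j, 0) * (majorana (j, 1) * parity n) * majorana (j, 0) * d := by
          rw [h2, mul_assoc _ d, ← hRP d hd]; simp only [mul_assoc]
      _ = (majorana (j, 0) * parity n) * -(majorana (j, 1) * majorana (j, 0)) * d := by
          rw [show majorana (j, 1) * parity n = -(parity n * majorana (j, 1)) by
            rw [parity_mul_majorana, neg_neg]]
          simp only [mul_assoc, mul_neg, neg_mul]
      _ = -(parity n * majorana (j, 0)) * (majorana (j, 0) * majorana (j, 1)) * d := by
          rw [h10, neg_neg, parity_mul_majorana, neg_neg]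
      _ = _ := by
          rw [neg_mul, neg_mul, mul_assoc (parity n), ← mul_assoc (majorana (j, 0)),
            majorana_mul_self, one_mul, mul_assoc]
  have h4 : parity n * (majorana (j, 1) * d) = 0 := by
    have h : (2 : ℂ) • (parity n * (majorana (j, 1) * d)) = 0 := by
      rw [two_smul]
      nth_rewrite 1 [h3]
      exact neg_add_cancel _
    exact (smul_eq_zero.1 h).resolve_left two_ne_zero
  have h5 : d = 0 := by
    have h6 : majorana (j, 1) * (parity n * (parity n * (majorana (j, 1) * d))) = 0 := by
      rw [h4, mul_zero, mul_zero]
    rwa [← mul_assoc (parity n), parity_mul_self, one_mul, ← mul_assoc, majorana_mul_self,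
      one_mul] at h6
  rw [hX1, h5, mul_zero, add_zero]
  exact ha

lemma parityOn_singleton_mem (j : Fin n) :
    parityOn {j} ∈ localAlgebra ({j} : Set (Fin n)) := by
  have h0 : ∀ e : Fin 2, majorana (j, e) ∈ localAlgebra ({j} : Set (Fin n)) := fun e =>
    Algebra.subset_adjoin ⟨(j, e), rfl, rfl⟩
  rw [parityOn_singleton_eq j]
  exact Subalgebra.smul_mem _ (Subalgebra.mul_mem _ (h0 0) (h0 1)) _

lemma posSemidef_half_one_add {s : ℂ} (hs : s = 1 ∨ s = -1) {Z : Op n} (hZH : Zᴴ = Z)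
    (hZZ : Z * Z = 1) : ((1 / 2 : ℂ) • (1 + s • Z)).PosSemidef := by
  have hss : s * s = 1 := by rcases hs with rfl | rfl <;> norm_num
  have hstar : star s = s := by rcases hs with rfl | rfl <;> simp
  have e : (1 / 2 : ℂ) • (1 + s • Z) =
      ((1 / 2 : ℂ) • (1 + s • Z))ᴴ * ((1 / 2 : ℂ) • (1 + s • Z)) := by
    rw [conjTranspose_smul, conjTranspose_add, conjTranspose_smul, hZH, hstar, conjTranspose_one]
    have h1 : star (1 / 2 : ℂ) = 1 / 2 := by simp
    have h2 : (1 + s • Z) * (1 + s • Z) = (2 : ℂ) • (1 + s • Z) := by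
      have h3 : s • Z * (s • Z) = 1 := by
        rw [smul_mul_assoc, mul_smul_comm, hZZ, smul_smul, hss, one_smul]
      rw [mul_add, add_mul, add_mul, h3]
      simp only [one_mul, mul_one]
      module
    rw [h1, smul_mul_assoc, mul_smul_comm, h2, smul_smul, smul_smul]
    norm_num
  rw [e]
  exact posSemidef_conjTranspose_mul_self _

lemma parityOn_mul_majorana_conj {ρ : Op n} {j : Fin n} {s : ℂ}
    (hZρ : parityOn {j} * ρ = s • ρ) :
    parityOn {j} * (majorana (j, 0) * ρ * majorana (j, 0)) =
      -s • (majorana (j, 0) * ρ * majorana (j, 0)) := by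
  have hcZ : parityOn {j} * majorana (j, 0) = -(majorana (j, 0) * parityOn {j}) :=
    parityOn_mul_majorana_of_mem (by simp)
  rw [← mul_assoc, ← mul_assoc, hcZ, neg_mul, mul_assoc (majorana (j, 0)), hZρ, mul_smul_comm,
    neg_mul, smul_mul_assoc, neg_smul]

lemma majorana_conj_mul_parityOn {ρ : Op n} {j : Fin n} {s : ℂ}
    (hρZ : ρ * parityOn {j} = s • ρ) :
    majorana (j, 0) * ρ * majorana (j, 0) * parityOn {j} =
      -s • (majorana (j, 0) * ρ * majorana (j, 0)) := by
  have hcZ : parityOn {j} * majorana (j, 0) = -(majorana (j, 0) * parityOn {j}) :=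
    parityOn_mul_majorana_of_mem (by simp)
  rw [mul_assoc, ← neg_eq_iff_eq_neg.2 hcZ, mul_neg, ← mul_assoc, mul_assoc (majorana (j, 0)), hρZ,
    mul_smul_comm, smul_mul_assoc, neg_smul]

/-- Averaging `ρ` over the flip of mode `j` removes mode `j`. -/
lemma add_majorana_conj_mem {ρ : Op n} {j : Fin n} {s : ℂ}
    (hPρ : parity n * ρ = ρ * parity n) (hZρ : parityOn {j} * ρ = s • ρ)
    (hρZ : ρ * parityOn {j} = s • ρ) :
    ρ + majorana (j, 0) * ρ * majorana (j, 0) ∈ localAlgebra ({j} : Set (Fin n))ᶜ := by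
  have hcc := majorana_mul_self (j, (0 : Fin 2))
  have hPc : parity n * majorana (j, 0) = -(majorana (j, 0) * parity n) := parity_mul_majorana _
  refine mem_localAlgebra_compl ?_ ?_ ?_
  · have h : parity n * (majorana (j, 0) * ρ * majorana (j, 0)) =
        majorana (j, 0) * ρ * majorana (j, 0) * parity n := by
      rw [← mul_assoc, ← mul_assoc, hPc, neg_mul, mul_assoc _ (parity n), hPρ, neg_mul,
        mul_assoc _ _ (majorana (j, 0)), mul_assoc ρ, hPc, mul_neg, mul_neg, neg_neg]
      simp only [mul_assoc]
    rw [mul_add, add_mul, hPρ, h]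
  · rw [mul_add, add_mul, ← mul_assoc, ← mul_assoc, hcc, one_mul, mul_assoc (majorana (j, 0) * ρ),
      hcc, mul_one, add_comm]
  · rw [mul_add, add_mul, parityOn_mul_majorana_conj hZρ, majorana_conj_mul_parityOn hρZ, hZρ, hρZ]

/-- A pure fermionic state in which mode `j` has a definite occupation number factorizes. -/
lemma factorizes_of_parityOn_mulVec {φ : Occ n → ℂ} (hφ : IsPureFS φ) {j : Fin n} {s : ℂ}
    (hs : s = 1 ∨ s = -1) (h : parityOn {j} *ᵥ φ = s • φ) : Factorizes φ {j} := by
  have hss : s * s = 1 := by rcases hs with rfl | rfl <;> norm_num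
  have hstar : star s = s := by rcases hs with rfl | rfl <;> simp
  have hZH := parityOn_conjTranspose ({j} : Finset (Fin n))
  have hZρ : parityOn {j} * proj φ = s • proj φ := by
    rw [proj, mul_vecMulVec, h, smul_vecMulVec]
  have hρZ : proj φ * parityOn {j} = s • proj φ := by
    have h1 : star φ ᵥ* parityOn {j} = s • star φ := by
      rw [← hstar, ← star_smul, ← h, star_mulVec, hZH]
    rw [proj, vecMulVec_mul, h1, vecMulVec_smul]
  have hρ : (proj φ).PosSemidef := posSemidef_vecMulVec_self_star φ
  -- The first factor projects onto the occupation of mode `j` found in `φ`. The second is the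
  -- average over flips, and its flipped half has the opposite occupation, so the projector discards
  -- it.
  refine ⟨(1 / 2 : ℂ) • (1 + s • parityOn {j}), ?_,
    proj φ + majorana (j, 0) * proj φ * majorana (j, 0),
    add_majorana_conj_mem hφ.2 hZρ hρZ, posSemidef_half_one_add hs hZH (parityOn_mul_self _), ?_, ?_⟩
  · exact Subalgebra.smul_mem _ (Subalgebra.add_mem _ (Subalgebra.one_mem _)
      (Subalgebra.smul_mem _ (parityOn_singleton_mem j) _)) _
  · refine hρ.add ?_
    have := hρ.mul_mul_conjTranspose_same (majorana (j, 0))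
    rwa [majorana_conjTranspose] at this
  · rw [smul_mul_assoc, add_mul, one_mul, smul_mul_assoc, mul_add, hZρ,
      parityOn_mul_majorana_conj hZρ]
    match_scalars
    · linear_combination (-1 / 2 : ℂ) * hss
    · linear_combination (1 / 2 : ℂ) * hss

/-- If either vector vanished, mode `j` would be certainly empty or certainly full and would
factorize; `2 ≤ n` makes `{j}` a proper subset. -/
lemma IsFullyEntangled.annihilation_mulVec_ne_zero {φ : Occ n → ℂ} (hn : 2 ≤ n)
    (hφ : IsPureFS φ) (h : IsFullyEntangled φ) (j : Fin n) :
    annihilation j *ᵥ φ ≠ 0 ∧ (annihilation j)ᴴ *ᵥ φ ≠ 0 := by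
  have hne : ({j} : Set (Fin n)) ≠ Set.univ := by
    intro e
    have : Fact (2 ≤ n) := ⟨hn⟩
    have : Nontrivial (Fin n) := Fin.nontrivial_iff_two_le.2 hn
    obtain ⟨k, hk⟩ := exists_ne j
    have : k ∈ ({j} : Set (Fin n)) := by rw [e]; trivial
    exact hk this
  have hj := h {j} (Set.singleton_nonempty j) hne
  refine ⟨fun h0 => hj (factorizes_of_parityOn_mulVec hφ (Or.inl rfl) ?_),
    fun h0 => hj (factorizes_of_parityOn_mulVec hφ (Or.inr rfl) ?_)⟩
  · have h1 : parityOn {j} = 1 - (2 : ℂ) • ((annihilation j)ᴴ * annihilation j) := by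
      rw [creation_mul_annihilation]; module
    rw [h1, sub_mulVec, smul_mulVec, ← mulVec_mulVec, h0, mulVec_zero, smul_zero, one_mulVec,
      sub_zero, one_smul]
  · have h1 : parityOn {j} = (2 : ℂ) • (annihilation j * (annihilation j)ᴴ) - 1 := by
      rw [annihilation_mul_creation]; module
    rw [h1, sub_mulVec, smul_mulVec, ← mulVec_mulVec, h0, mulVec_zero, smul_zero, one_mulVec,
      zero_sub, neg_one_smul]

/-- A projector onto a line commutes with `P` only if the line is invariant; the eigenvalue is the
expectation of `P`. -/
lemma IsPureFS.exists_parity {ψ : Occ n → ℂ} (h : IsPureFS ψ) :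
    ∃ ε : ℂ, ε * ε = 1 ∧ parity n *ᵥ ψ = ε • ψ := by
  have h1 : parity n *ᵥ ψ = (star ψ ⬝ᵥ (parity n *ᵥ ψ)) • ψ := by
    have h2 := congrArg (· *ᵥ ψ) h.2.eq
    simp only [← mulVec_mulVec] at h2
    rw [proj, vecMulVec_mulVec, vecMulVec_mulVec, h.1] at h2
    simpa using h2
  refine ⟨_, ?_, h1⟩
  set ε := star ψ ⬝ᵥ (parity n *ᵥ ψ)
  have h3 : (ε * ε) • ψ = ψ := by
    rw [mul_smul, ← h1, ← mulVec_smul, ← h1, mulVec_mulVec, parity_mul_self, one_mulVec]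
  have h4 := congrArg (star ψ ⬝ᵥ ·) h3
  simpa [h.1] using h4

/-! ### Gaussian local unitaries -/

/-- The Gaussian unitary of mode `j` generated by the parity of that mode. -/
def modeRotation (j : Fin n) (t : ℝ) : Op n :=
  diagonal fun x => Complex.exp (2 * t * Complex.I * sgn {j} x)

lemma modeRotation_eq_exp (j : Fin n) (t : ℝ) :
    modeRotation j t = NormedSpace.exp ((2 * t * Complex.I) • parityOn {j}) := by
  rw [parityOn, ← diagonal_smul, Matrix.exp_diagonal, modeRotation]
  congr 1
  ext x
  rw [Pi.coe_exp, ← Complex.exp_eq_exp_ℂ]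
  rfl

lemma isGaussianModeUnitary_modeRotation (j : Fin n) (t : ℝ) (flip : Bool) :
    IsGaussianModeUnitary j (modeRotation j t * if flip then majorana (j, 1) else 1) := by
  -- The off-diagonal entries add up to `2 t c_0 c_1 = 2 t i Z_j`, the exponent of `modeRotation`.
  refine ⟨!![0, t; -t, 0], flip, ?_, ?_⟩
  · ext a b
    fin_cases a <;> fin_cases b <;> simp
  · rw [modeRotation_eq_exp]
    congr 2
    simp only [Fin.sum_univ_two, majorana_zero_mul_one, majorana_one_mul_zero, of_apply, cons_val',
      cons_val_zero, cons_val_one, empty_val', cons_val_fin_one, smul_smul, majorana_mul_self]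
    simp only [Complex.ofReal_zero, zero_smul, zero_add, add_zero, Complex.ofReal_neg, smul_neg,
      neg_smul, neg_neg, smul_smul, smul_add, Complex.I_mul_I, neg_mul]
    module

lemma modeRotation_conjTranspose_mul_self (j : Fin n) (t : ℝ) :
    (modeRotation j t)ᴴ * modeRotation j t = 1 := by
  rw [modeRotation, diagonal_conjTranspose, diagonal_mul_diagonal, ← diagonal_one]
  congr 1
  ext x
  rw [Pi.star_apply, Complex.star_def, ← Complex.exp_conj, ← Complex.exp_add]
  have h : (starRingEnd ℂ) (sgn {j} x) = sgn {j} x := star_sgn _ x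
  simp only [map_mul, Complex.conj_ofReal, Complex.conj_I, h, map_ofNat]
  rw [show (2 * (t : ℂ) * -Complex.I * sgn {j} x + 2 * t * Complex.I * sgn {j} x) = 0 by ring,
    Complex.exp_zero]

/-- The phases on the occupied and the empty state are `e^{-2it}` and `e^{2it}`; the factor is their
ratio. -/
lemma annihilation_mul_modeRotation (j : Fin n) (t : ℝ) :
    annihilation j * modeRotation j t =
      Complex.exp (-4 * t * Complex.I) • (modeRotation j t * annihilation j) := by
  ext y x
  rw [modeRotation, mul_diagonal, Matrix.smul_apply, diagonal_mul, annihilation_apply, smul_eq_mul]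
  split_ifs with h
  · have h1 : sgn {j} x = -1 := by simp [sgn, h.1]
    have h2 : sgn {j} y = 1 := by rw [h.2, sgn_flipAt_of_mem (by simp), h1, neg_neg]
    rw [h1, h2, ← mul_assoc, ← Complex.exp_add, mul_comm]
    congr 2
    ring
  · simp

lemma commute_modeRotation {j : Fin n} {A : Op n} (h : Commute A (parityOn {j})) (t : ℝ) :
    Commute A (modeRotation j t) := by
  rw [modeRotation_eq_exp]
  exact (h.smul_right _).exp_right

lemma annihilation_mul_majorana_one (j : Fin n) :
    annihilation j * majorana (j, 1) = -(majorana (j, 1) * (annihilation j)ᴴ) := by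
  rw [annihilation_conjTranspose_eq, annihilation_eq]
  simp only [smul_mul_assoc, mul_smul_comm, add_mul, mul_sub, majorana_mul_self,
    majorana_zero_mul_one, majorana_one_mul_zero]
  module

lemma annihilation_mul_majorana_of_ne {j k : Fin n} (h : j ≠ k) (a : Fin 2) :
    annihilation j * majorana (k, a) = -(majorana (k, a) * annihilation j) := by
  have h0 : majorana (j, 0) * majorana (k, a) = -(majorana (k, a) * majorana (j, 0)) :=
    majorana_mul_of_ne (by simp [h])
  have h1 : majorana (j, 1) * majorana (k, a) = -(majorana (k, a) * majorana (j, 1)) :=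
    majorana_mul_of_ne (by simp [h])
  rw [annihilation_eq]
  simp only [smul_mul_assoc, mul_smul_comm, add_mul, mul_add, h0, h1]
  module

lemma exists_exp_eq {ζ : ℂ} (h : ζ * star ζ = 1) : ∃ t : ℝ, Complex.exp (-4 * t * Complex.I) = ζ := by
  refine ⟨-ζ.arg / 4, ?_⟩
  have h1 : ‖ζ‖ = 1 := by
    have h2 : ((‖ζ‖ ^ 2 : ℝ) : ℂ) = 1 := by
      rw [← h, Complex.star_def, Complex.mul_conj, Complex.normSq_eq_norm_sq]
    have h3 : ‖ζ‖ ^ 2 = 1 := by exact_mod_cast h2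
    nlinarith [norm_nonneg ζ]
  have h4 := Complex.norm_mul_exp_arg_mul_I ζ
  rw [h1, Complex.ofReal_one, one_mul] at h4
  rw [← h4]
  congr 1
  rw [h4]
  push_cast
  ring

/-- The sign with which a Gaussian unitary of one mode passes the operators of the others. -/
def flipSign (y : ℂ) : ℂ := if y = 0 then -1 else 1

/-- Gaussian unitaries of mode `j` realize all the transformations of the annihilation operator of
mode `j` to a multiple of itself or of its adjoint. -/
lemma exists_isGaussianModeUnitary (j : Fin n) {y z : ℂ} (hyz : y * z = 0)
    (hnorm : y * star y + z * star z = 1) :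
    ∃ U : Op n, IsGaussianModeUnitary j U ∧ Uᴴ * U = 1 ∧
      annihilation j * U = U * modeComb j y z ∧
      ∀ k, k ≠ j → annihilation k * U = flipSign y • (U * annihilation k) := by
  have hcomm : ∀ k, k ≠ j → Commute (annihilation k) (parityOn {j}) := fun k hk =>
    (parityOn_mul_annihilation_of_notMem (by simpa using hk)).symm
  by_cases hy : y = 0
  · subst hy
    rw [zero_mul, zero_add] at hnorm
    -- The sign compensates the minus picked up when `b_j` passes `c_1` and becomes `b_j†`.
    obtain ⟨t, ht⟩ := exists_exp_eq (ζ := -z) (by simpa using hnorm)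
    refine ⟨_, isGaussianModeUnitary_modeRotation j t true, ?_, ?_, fun k hk => ?_⟩
    · rw [if_pos rfl, conjTranspose_mul, mul_assoc, ← mul_assoc (modeRotation j t)ᴴ,
        modeRotation_conjTranspose_mul_self, one_mul, majorana_conjTranspose, majorana_mul_self]
    · rw [if_pos rfl, ← mul_assoc, annihilation_mul_modeRotation, ht, smul_mul_assoc, mul_assoc,
        annihilation_mul_majorana_one, modeComb, zero_smul, zero_add, mul_smul_comm, mul_neg,
        smul_neg, neg_smul, neg_neg, mul_assoc]
    · rw [if_pos rfl, ← mul_assoc, (commute_modeRotation (hcomm k hk) t).eq, mul_assoc,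
        annihilation_mul_majorana_of_ne hk, flipSign, if_pos rfl, neg_one_smul, mul_neg, mul_assoc]
  · obtain rfl : z = 0 := (mul_eq_zero.1 hyz).resolve_left hy
    rw [zero_mul, add_zero] at hnorm
    obtain ⟨t, ht⟩ := exists_exp_eq hnorm
    refine ⟨_, isGaussianModeUnitary_modeRotation j t false, ?_, ?_, fun k hk => ?_⟩
    · simpa using modeRotation_conjTranspose_mul_self j t
    · simp only [Bool.false_eq_true, if_false, mul_one]
      rw [annihilation_mul_modeRotation, ht, modeComb, zero_smul, add_zero, mul_smul_comm]
    · simp only [Bool.false_eq_true, if_false, mul_one]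
      rw [flipSign, if_neg hy, one_smul, (commute_modeRotation (hcomm k hk) t).eq]

lemma mul_list_prod_of_sign {ι : Type*} {U : ι → Op n} {s : ι → ℂ} {A : Op n} (l : List ι)
    (h : ∀ k ∈ l, A * U k = s k • (U k * A)) :
    A * (l.map U).prod = (l.map s).prod • ((l.map U).prod * A) := by
  induction l with
  | nil => simp
  | cons k l ih =>
    rw [List.map_cons, List.prod_cons, List.map_cons, List.prod_cons, ← mul_assoc, h k (by simp),
      smul_mul_assoc, mul_assoc, ih fun i hi => h i (by simp [hi]), mul_smul_comm, smul_smul,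
      mul_assoc]

/-- `A` travels through the product, turning into `B` at factor `j`; every other factor contributes
its sign, whichever side of `j` it is on. -/
lemma mul_list_prod_of_mem {ι : Type*} [DecidableEq ι] {U : ι → Op n} {s : ι → ℂ} {A B : Op n}
    {j : ι} (hj : A * U j = U j * B) (hA : ∀ k, k ≠ j → A * U k = s k • (U k * A))
    (hB : ∀ k, k ≠ j → B * U k = s k • (U k * B)) (l : List ι) (hl : l.Nodup) (hjl : j ∈ l) :
    A * (l.map U).prod =
      (l.map fun k => if k = j then 1 else s k).prod • ((l.map U).prod * B) := by
  induction l with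
  | nil => simp at hjl
  | cons k l ih =>
    rw [List.nodup_cons] at hl
    rw [List.map_cons, List.prod_cons, List.map_cons, List.prod_cons]
    by_cases hk : k = j
    · subst hk
      have hne : ∀ i ∈ l, i ≠ k := fun i hi e => hl.1 (e ▸ hi)
      have hs : (l.map fun i => if i = k then 1 else s i) = l.map s :=
        List.map_congr_left fun i hi => if_neg (hne i hi)
      rw [if_pos rfl, one_mul, hs, ← mul_assoc, hj, mul_assoc,
        mul_list_prod_of_sign l fun i hi => hB i (hne i hi), mul_smul_comm, mul_assoc]
    · have hjl' : j ∈ l := (List.mem_cons.1 hjl).resolve_left (Ne.symm hk)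
      rw [if_neg hk, ← mul_assoc, hA k hk, smul_mul_assoc, mul_assoc, ih hl.2 hjl',
        mul_smul_comm, smul_smul, mul_assoc]

lemma list_prod_isometry {ι : Type*} {U : ι → Op n} (l : List ι) (h : ∀ k, (U k)ᴴ * U k = 1) :
    ((l.map U).prod)ᴴ * (l.map U).prod = 1 := by
  induction l with
  | nil => simp
  | cons k l ih =>
    rw [List.map_cons, List.prod_cons, conjTranspose_mul, mul_assoc, ← mul_assoc (U k)ᴴ, h,
      one_mul, ih]

lemma modeComb_conjTranspose (j : Fin n) (y z : ℂ) :
    (modeComb j y z)ᴴ = modeComb j (star z) (star y) := by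
  rw [modeComb, modeComb, conjTranspose_add, conjTranspose_smul, conjTranspose_smul,
    conjTranspose_conjTranspose, add_comm]

/-- The adjoint of a relation `A U = U B` for a unitary `U`. -/
lemma conjTranspose_mul_of_isometry {U A B : Op n} (hU : Uᴴ * U = 1) (h : A * U = U * B) :
    Aᴴ * U = U * Bᴴ := by
  have hU' : U * Uᴴ = 1 := mul_eq_one_comm.1 hU
  have h1 : A = U * B * Uᴴ := by rw [← h, mul_assoc, hU', mul_one]
  rw [h1, conjTranspose_mul, conjTranspose_mul, conjTranspose_conjTranspose, mul_assoc, mul_assoc,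
    hU, mul_one]

/-- A Gaussian local unitary realizes any unitary transformation of every annihilation operator
to a multiple of itself or of its adjoint. -/
theorem exists_isGLU {y z : Fin n → ℂ} (hyz : ∀ j, y j * z j = 0)
    (hnorm : ∀ j, y j * star (y j) + z j * star (z j) = 1) :
    ∃ V : Op n, IsGLU V ∧ Vᴴ * V = 1 ∧
      ∀ j, annihilation j * V = V * modeComb j (y j) (z j) := by
  -- `σ j` is the total sign that mode `j` collects from the parity flips of all other modes. Each
  -- `U j` is chosen for coefficients multiplied by `σ j`, and `σ j ^ 2 = 1` restores the prescribed
  -- ones.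
  set σ : Fin n → ℂ := fun j =>
    ((List.finRange n).map fun k => if k = j then 1 else flipSign (y k)).prod with hσdef
  have hsign : ∀ k, flipSign (y k) = 1 ∨ flipSign (y k) = -1 := fun k => by
    unfold flipSign; split_ifs <;> simp
  have hσ : ∀ j, σ j = 1 ∨ σ j = -1 := by
    intro j
    have : ∀ l : List (Fin n), (l.map fun k => if k = j then 1 else flipSign (y k)).prod = 1 ∨
        (l.map fun k => if k = j then 1 else flipSign (y k)).prod = -1 := by
      intro l
      induction l with
      | nil => simp
      | cons k l ih =>
        rw [List.map_cons, List.prod_cons]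
        split_ifs
        · simpa using ih
        · rcases hsign k with h | h <;> rcases ih with h' | h' <;> simp [h, h']
    exact this _
  have hU : ∀ j, ∃ U : Op n, IsGaussianModeUnitary j U ∧ Uᴴ * U = 1 ∧
      annihilation j * U = U * modeComb j (σ j * y j) (σ j * z j) ∧
      ∀ k, k ≠ j → annihilation k * U = flipSign (y j) • (U * annihilation k) := by
    intro j
    have h1 : (σ j * y j) * (σ j * z j) = 0 := by linear_combination σ j * σ j * hyz j
    have h2 : (σ j * y j) * star (σ j * y j) + (σ j * z j) * star (σ j * z j) = 1 := by
      rcases hσ j with h | h <;> simpa [h] using hnorm j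
    -- There is no circularity: rescaling by `σ j` does not change whether `U j` contains a flip.
    have h3 : flipSign (σ j * y j) = flipSign (y j) := by
      rcases hσ j with h | h <;> simp [h, flipSign]
    rw [← h3]
    exact exists_isGaussianModeUnitary j h1 h2
  choose U hUG hUU hUj hUk using hU
  refine ⟨(List.ofFn U).prod, ⟨U, hUG, rfl⟩, ?_, fun j => ?_⟩
  · rw [List.ofFn_eq_map]
    exact list_prod_isometry _ hUU
  · have hc : ∀ k, k ≠ j → (annihilation j)ᴴ * U k = flipSign (y k) • (U k * (annihilation j)ᴴ) := by
      intro k hk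
      have h1 : annihilation j * U k = U k * (flipSign (y k) • annihilation j) := by
        rw [hUk k j hk.symm, mul_smul_comm]
      have h2 := conjTranspose_mul_of_isometry (hUU k) h1
      have h3 : star (flipSign (y k)) = flipSign (y k) := by
        rcases hsign k with h | h <;> simp [h]
      rw [h2, conjTranspose_smul, h3, mul_smul_comm]
    have h1 := mul_list_prod_of_mem (U := U) (s := fun k => flipSign (y k)) (hUj j)
      (fun k hk => hUk k j hk.symm) (fun k hk => by
        rw [modeComb, add_mul, mul_add, smul_mul_assoc, smul_mul_assoc, mul_smul_comm,
          mul_smul_comm, hUk k j hk.symm, hc k hk]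
        module)
      (List.finRange n) (List.nodup_finRange n) (List.mem_finRange j)
    rw [List.ofFn_eq_map, h1]
    change σ j • _ = _
    rw [modeComb, modeComb, mul_add, mul_add, mul_smul_comm, mul_smul_comm, mul_smul_comm,
      mul_smul_comm, smul_add, smul_smul, smul_smul, ← mul_assoc, ← mul_assoc]
    have h4 : σ j * σ j = 1 := by rcases hσ j with h | h <;> simp [h]
    rw [h4, one_mul, one_mul]

/-! ### Unitary Kraus operators -/

/-- The Kraus operator of a trace-preserving map with a single Kraus operator is an isometry. -/
lemma conjTranspose_mul_self_of_trace {K : Op n} (h : ∀ ρ : Op n, (K * ρ * Kᴴ).trace = ρ.trace) :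
    Kᴴ * K = 1 := by
  have h1 : ∀ ρ : Op n, ((Kᴴ * K - 1) * ρ).trace = 0 := fun ρ => by
    rw [sub_mul, one_mul, trace_sub, mul_assoc, trace_mul_comm, ← h ρ, sub_self]
  exact sub_eq_zero.1 (trace_mul_conjTranspose_self_eq_zero_iff.1 (h1 (Kᴴ * K - 1)ᴴ))

/-- A unitary preserves `b b† + b† b = 1`, and for the transformed mode this anticommutator is `|y|²
+ |z|²`. -/
lemma norm_of_annihilation_mul {K : Op n} (hK : Kᴴ * K = 1) {j : Fin n} {y z : ℂ}
    (h : annihilation j * K = K * modeComb j y z) : y * star y + z * star z = 1 := by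
  have h' := conjTranspose_mul_of_isometry hK h
  have h1 : K * (modeComb j y z * (modeComb j y z)ᴴ + (modeComb j y z)ᴴ * modeComb j y z) =
      K * 1 := by
    rw [mul_add, ← mul_assoc, ← mul_assoc, ← h, ← h', mul_assoc, mul_assoc, ← h, ← h', ← mul_assoc,
      ← mul_assoc, ← add_mul, annihilation_anticomm_creation, one_mul, mul_one]
  have h2 := congrArg (Kᴴ * ·) h1
  simp only [← mul_assoc, hK, one_mul, modeComb_conjTranspose, modeComb_mul_add_mul] at h2
  have h3 := congrFun (congrFun h2 fun _ => false) fun _ => false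
  simpa using h3

/-- Isometries that transform the annihilation operators in the same way agree up to a phase. -/
lemma exists_eq_smul_of_annihilation_mul {K U : Op n} (hK : Kᴴ * K = 1) (hU : Uᴴ * U = 1)
    {D : Fin n → Op n} (h : ∀ j, annihilation j * K = K * D j)
    (h' : ∀ j, annihilation j * U = U * D j) : ∃ c : ℂ, c * star c = 1 ∧ K = c • U := by
  -- The two transformations cancel in `K U†`, which therefore commutes with all modes and is a
  -- scalar by irreducibility.
  have key : ∀ A B : Op n, A * K = K * B → A * U = U * B → A * (K * Uᴴ) = K * Uᴴ * A := by
    intro A B hA hB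
    have h1 : Uᴴ * A = B * Uᴴ := by
      have hU' : U * Uᴴ = 1 := mul_eq_one_comm.1 hU
      calc Uᴴ * A = Uᴴ * (A * U) * Uᴴ := by rw [mul_assoc, mul_assoc A, hU', mul_one]
        _ = B * Uᴴ := by rw [hB, ← mul_assoc, hU, one_mul]
    rw [← mul_assoc, hA, mul_assoc, mul_assoc, h1]
  obtain ⟨c, hc⟩ := exists_eq_smul_one_of_commute (X := K * Uᴴ)
    (fun j => key _ _ (h j) (h' j))
    fun j => key _ _ (conjTranspose_mul_of_isometry hK (h j))
      (conjTranspose_mul_of_isometry hU (h' j))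
  have hKU : K = c • U := by
    calc K = K * Uᴴ * U := by rw [mul_assoc, hU, mul_one]
      _ = c • U := by rw [hc, smul_mul_assoc, one_mul]
  refine ⟨c, ?_, hKU⟩
  rw [hKU, conjTranspose_smul, smul_mul_assoc, mul_smul_comm, hU, smul_smul] at hK
  have h3 := congrFun (congrFun hK fun _ => false) fun _ => false
  rw [mul_comm]
  simpa using h3

end Fermion

end

/-! ### Rigidity of GLOCC maps between fully entangled pure states. -/

theorem mainTheorem2 (n : ℕ) (hn : 2 ≤ n) (E : Fermion.SuperOp n) (hE : Fermion.IsGLOCC E)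
    (ψ φ : Fermion.Occ n → ℂ)
    (hψ : Fermion.IsPureFS ψ) (hψ' : Fermion.IsFullyEntangled ψ)
    (hφ : Fermion.IsPureFS φ) (hφ' : Fermion.IsFullyEntangled φ)
    (hmap : E (Fermion.proj ψ) = Fermion.proj φ) :
    ∃ V : Fermion.Op n, Fermion.IsGLU V ∧ ∀ ρ : Fermion.Op n, E ρ = V * ρ * Vᴴ := by
  obtain ⟨hLOCC, hG⟩ := hE
  obtain ⟨ε, hε, hPφ⟩ := hφ.exists_parity
  obtain ⟨ε', hε', hPψ⟩ := hψ.exists_parity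
  obtain ⟨K, y, z, hEK, hK⟩ := Fermion.exists_kraus_of_isGaussianMap hG
    (fun j => hLOCC.isCovariant (Fermion.isLocalParity_parityOn j))
    (hLOCC.isCovariant Fermion.isLocalParity_parity) hφ.1 hε hε' hPφ hPψ hmap
    (fun j => (hφ'.annihilation_mulVec_ne_zero hn hφ j).1)
    (fun j => (hφ'.annihilation_mulVec_ne_zero hn hφ j).2)
  have hKK : Kᴴ * K = 1 :=
    Fermion.conjTranspose_mul_self_of_trace fun ρ => by rw [← hEK, hLOCC.trace]
  obtain ⟨V, hV, hVV, hVb⟩ := Fermion.exists_isGLU (fun j => (hK j).1)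
    fun j => Fermion.norm_of_annihilation_mul hKK (hK j).2
  obtain ⟨c, hc, hKV⟩ :=
    Fermion.exists_eq_smul_of_annihilation_mul hKK hVV (fun j => (hK j).2) hVb
  refine ⟨V, hV, fun ρ => ?_⟩
  rw [hEK, hKV, conjTranspose_smul, smul_mul_assoc, smul_mul_assoc, mul_smul_comm, smul_smul, hc,
    one_smul]
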